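/- Let $u\in L_2[0,\pi]$ be complex-valued and let $L$ be the operator $Ly=-y''+qy$, $q=u'$ (distributional derivative), in $L_2[0,\pi]$ with Dirichlet conditions. Precisely, with the quasi-derivative $y^{[1]}=y'-uy$, the domain of $L$ consists of the $y$ such that $y$ and $y^{[1]}$ are absolutely continuous on $[0,\pi]$, $l(y):=-(y^{[1]})'-uy^{[1]}-u^2y\in L_2[0,\pi]$ and $y(0)=y(\pi)=0$, and $Ly=l(y)$. For $\lambda\in\mathbb C$ let $\omega(\cdot,\lambda)$ be the solution of $l(\omega)=\lambda\omega$ with $\omega(0,\lambda)=0$, $\omega^{[1]}(0,\lambda)=1$. Let $\mu_1,\mu_2,\dots$ be the distinct eigenvalues of $L$, listed by increasing modulus and, for equal moduli, by increasing argument in $(-\pi,\pi]$, and let $p_k$ be the algebraic multiplicity of $\mu_k$, i.e. the maximal length of a chain $y^0\neq0,y^1,\dots$ with $(L-\mu_k)y^0=0$, $(L-\mu_k)y^{j}=y^{j-1}$. Let $\{y_n\}_{n\ge1}$ be the system of eigen- and associated functions obtained by listing successively, for $k=1,2,\dots$, the functions $\partial_\lambda^j\omega(\cdot,\mu_k)$,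 $j=0,\dots,p_k-1$, each divided by its $L_2$-norm, and let $\{w_n\}_{n\ge1}\subset L_2[0,\pi]$ be biorthogonal to it: $(y_n,w_k)=\delta_{nk}$, where $(f,g)=\int_0^\pi f\overline g\,dx$. These systems exist, and there are a constant $C_u$ and a sequence $\upsilon_u(m)\to0$ $(m\to\infty)$, depending only on $u$, such that for every $f\in L_2[0,\pi]$, with $c_n=(f,w_n)$ and $c_{n,0}=\sqrt{2/\pi}\,(f,\sin nx)$, the expansions of $f$ in the system $\{y_n\}$ and in sines are uniformly equiconvergent on the whole of $[0,\pi]$, $$\lim_{m\to\infty}\ \Bigl\|\sum_{n=1}^m c_ny_n(x)-\sum_{n=1}^m\sqrt{\tfrac2\pi}\,c_{n,0}\sin nx\Bigr\|_{C[0,\pi]}=0,$$ and for all $m\ge1$ $$\Bigl\|\sum_{n=1}^m c_ny_n(x)-\sum_{n=1}^m\sqrt{\tfrac2\pi}\,c_{n,0}\sin nx\Bigr\|_{C[0,\pi]}\le C_u\Bigl(\sum_{n\ge\sqrt m}|c_{n,0}|^2\Bigr)^{1/2}+\|f\|_{L_2}\,\upsilon_u(m).$$ -/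

import Mathlib

open MeasureTheory Filter Topology Set

noncomputable section

namespace SturmLiouville

/-- Membership in the complex space `L₂[0, π]`. -/
def MemL2 (f : ℝ → ℂ) : Prop :=
  MemLp f 2 (volume.restrict (Icc (0 : ℝ) Real.pi))

/-- The inner product `(f, g) = ∫₀^π f(x) conj(g(x)) dx` of `L₂[0, π]`. -/
def inn (f g : ℝ → ℂ) : ℂ :=
  ∫ x in (0 : ℝ)..Real.pi, f x * (starRingEnd ℂ) (g x)

/-- The norm of `L₂[0, π]`. -/
def normL2 (f : ℝ → ℂ) : ℝ :=
  Real.sqrt (∫ x in (0 : ℝ)..Real.pi, ‖f x‖ ^ 2)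

/-- `y` and `y₁` are absolutely continuous on `[0, π]`, `y₁` is the quasi-derivative
`y^[1] = y' - u y`, and `l(y) = g`, where `l(y) = -y'' + u' y` is understood through the
quasi-derivative as `l(y) = -(y^[1])' - u y^[1] - u² y`. Absolute continuity and the
almost everywhere differential equations are written in the equivalent integral form. -/
structure QuasiDiff (u y y₁ g : ℝ → ℂ) : Prop where
  cont : ContinuousOn y (Icc 0 Real.pi)
  cont₁ : ContinuousOn y₁ (Icc 0 Real.pi)
  eq : ∀ x ∈ Icc (0 : ℝ) Real.pi,
    y x = y 0 + ∫ t in (0 : ℝ)..x, (y₁ t + u t * y t)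
  eq₁ : ∀ x ∈ Icc (0 : ℝ) Real.pi,
    y₁ x = y₁ 0 - ∫ t in (0 : ℝ)..x, (u t * y₁ t + u t ^ 2 * y t + g t)

/-- `y` belongs to the domain of the Dirichlet operator `L` in `L₂[0, π]` and `L y = g`:
`y` and `y^[1]` are absolutely continuous, `l(y) = g ∈ L₂[0, π]`, `y(0) = y(π) = 0`. -/
def DirichletOp (u y g : ℝ → ℂ) : Prop :=
  MemL2 g ∧ y 0 = 0 ∧ y Real.pi = 0 ∧ ∃ y₁ : ℝ → ℂ, QuasiDiff u y y₁ g

/-- `Y 0, …, Y (p - 1)` is a chain consisting of an eigenfunction and associated functions of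
`L` for the eigenvalue `z`: `Y 0 ≠ 0`, `(L - z) (Y 0) = 0`, `(L - z) (Y (j + 1)) = Y j`. -/
structure IsChain (u : ℝ → ℂ) (z : ℂ) (p : ℕ) (Y : ℕ → ℝ → ℂ) : Prop where
  pos : 0 < p
  ne_zero : ∃ x ∈ Icc (0 : ℝ) Real.pi, Y 0 x ≠ 0
  eigen : DirichletOp u (Y 0) (fun x => z * Y 0 x)
  assoc : ∀ j : ℕ, j + 1 < p →
    DirichletOp u (Y (j + 1)) (fun x => z * Y (j + 1) x + Y j x)

/-- `z` is an eigenvalue of `L`. -/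
def IsEigenvalue (u : ℝ → ℂ) (z : ℂ) : Prop :=
  ∃ y : ℝ → ℂ, (∃ x ∈ Icc (0 : ℝ) Real.pi, y x ≠ 0) ∧ DirichletOp u y (fun x => z * y x)

/-- The algebraic multiplicity of the eigenvalue `z` is `p`: the largest length of a chain. -/
def HasAlgMultiplicity (u : ℝ → ℂ) (z : ℂ) (p : ℕ) : Prop :=
  IsGreatest {n : ℕ | ∃ Y : ℕ → ℝ → ℂ, IsChain u z n Y} p

/-- `ω z` is, on `[0, π]`, the solution `ω(·, z)` of `l(ω) = z ω` with
`ω(0, z) = 0`, `ω^[1](0, z) = 1`, for every complex `z`. -/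
def IsOmega (u : ℝ → ℂ) (ω : ℂ → ℝ → ℂ) : Prop :=
  ∀ z : ℂ, ω z 0 = 0 ∧ ∃ ω₁ : ℝ → ℂ, ω₁ 0 = 1 ∧ QuasiDiff u (ω z) ω₁ (fun x => z * ω z x)

/-- The derivative of order `j` of `ω(x, z)` with respect to the spectral parameter. -/
def omegaDeriv (ω : ℂ → ℝ → ℂ) (j : ℕ) (z : ℂ) (x : ℝ) : ℂ :=
  iteratedDeriv j (fun s : ℂ => ω s x) z

/-- `y 1, y 2, …` is (on `[0, π]`) the normalized system of eigenfunctions and associated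
functions of `L`. The distinct eigenvalues `μ 0, μ 1, …` are listed by increasing modulus and,
for equal moduli, by increasing argument in `(-π, π]`; `p k` is the algebraic multiplicity of
`μ k`; the system runs successively through the blocks `∂_z^j ω(·, μ k)`, `0 ≤ j < p k`, each
function being divided by its norm in `L₂[0, π]`. The value `y 0` is not used. -/
def IsRootSystem (u : ℝ → ℂ) (y : ℕ → ℝ → ℂ) : Prop :=
  ∃ (ω : ℂ → ℝ → ℂ) (μ : ℕ → ℂ) (p : ℕ → ℕ),
    IsOmega u ω ∧
    range μ = {z : ℂ | IsEigenvalue u z} ∧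
    (∀ k : ℕ, ‖μ k‖ < ‖μ (k + 1)‖ ∨
      (‖μ k‖ = ‖μ (k + 1)‖ ∧ (μ k).arg < (μ (k + 1)).arg)) ∧
    (∀ k : ℕ, HasAlgMultiplicity u (μ k) (p k)) ∧
    ∀ k j : ℕ, j < p k → ∀ x ∈ Icc (0 : ℝ) Real.pi,
      y ((∑ i ∈ Finset.range k, p i) + j + 1) x =
        omegaDeriv ω j (μ k) x / (normL2 (omegaDeriv ω j (μ k)) : ℂ)

/-- `w 1, w 2, …` is a system in `L₂[0, π]` biorthogonal to `y 1, y 2, …`. -/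
def IsBiorthogonal (y w : ℕ → ℝ → ℂ) : Prop :=
  (∀ n : ℕ, 1 ≤ n → MemL2 (w n)) ∧
  ∀ n k : ℕ, 1 ≤ n → 1 ≤ k → inn (y n) (w k) = if n = k then 1 else 0

/-- The sine coefficient `c_{n,0} = √(2/π) (f, sin nx)`. -/
def sineCoeff (f : ℝ → ℂ) (n : ℕ) : ℂ :=
  (Real.sqrt (2 / Real.pi) : ℂ) * inn f (fun x => (Real.sin (n * x) : ℂ))

/-- The difference of the partial sums of order `m`:
`∑_{n=1}^m c_n y_n(x) - ∑_{n=1}^m √(2/π) c_{n,0} sin nx`, with `c_n = (f, w_n)`. -/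
def partialSumDiff (y w : ℕ → ℝ → ℂ) (f : ℝ → ℂ) (m : ℕ) (x : ℝ) : ℂ :=
  (∑ n ∈ Finset.Icc 1 m, inn f (w n) * y n x) -
    ∑ n ∈ Finset.Icc 1 m,
      (Real.sqrt (2 / Real.pi) : ℂ) * sineCoeff f n * (Real.sin (n * x) : ℂ)

end SturmLiouville

end

noncomputable section

namespace SturmLiouville

open scoped ENNReal

/-! ### Indefinite integrals of complex functions -/

/-! For large `m` the partial sum of order `m` in the root functions is the Riesz projection `P_m =
-(1/2πi) ∮ (L - z)⁻¹ dz` over the circle `|z| = r²`, `r = m + 1/2`. The sine partial sum `S_m` is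
the same integral for the free operator. The analytic core is `norm_projOp_sub_le`: `P_m - S_m`
tends to zero in the norm of operators from `L₂` to `C`. This is stronger than the stated estimate,
and the constant in front of the tail of `f` can be taken to be zero.

In the sine basis `(L - z) y = f` reads `(k² - z) y_k + ∑_j q_jk y_j = f_k` (`QuasiDiff.weak`).
Although the potential is a distribution, `|q_jk| ≤ |j-k| a_{|j-k|} + (j+k) a_{j+k}`, where the
`a_n` are the moduli of the sine coefficients of `u` and are square summable (`norm_qmat_le`).
Divided by the square roots of `|j² - z|` and `|k² - z|`, this matrix has a Hilbert–Schmidt norm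
that tends to zero uniformly on the circles (`eventually_hsNorm_le`). Hence large circles carry no
eigenvalue, and `y_k` splits into a free term, a term of first order and a remainder.

The free term integrates to `S_m f`. An entry of the first order term has a nonzero contour integral
only if `j` and `k` lie on different sides of `r`, and then at most `2π / (|j-k| (j+k))`;
inequalities of Hilbert type sum these (`tsum_opp_first_order_sq_le`). The remainder is estimated
pointwise on the circle: the `ℓ¹` norm of its coefficients, which dominates the uniform norm, is
`o(1) ‖f‖ / (r τ^{17/16})` with `τ = 1/2 + |z - r²|/(2r)` (`QuasiDiff.tsum_remainder_le`). Since
`17/16 > 1`, its integral over the circle is `o(1) ‖f‖`.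

The algebraic part identifies `P_m`. The eigenvalues are the zeros of the entire function `ω(π, z)`,
and the order of a zero is the maximal length of a chain (`IsChain.le_order`,
`isChain_of_le_order`). Residues express `P_m f` through the derivatives of `ω` in `z`
(`exists_projOp_eq_sum`), on which `P_m` acts as the identity or as zero (`projOp_spec_rootV`).
Being close to `S_m`, the projection `P_m` has rank `m`, so exactly `m` root functions belong to the
disc (`Separates.sum_mult`). Strong convergence of `P_m` to the identity makes the root functions
complete. The biorthogonal functions are coordinate functionals of the `P_m`, and completeness makes
them unique. Finally `υ(m)` is the operator norm of the difference of the two partial sums, which is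
finite for every `m` and tends to zero. -/

lemma absolutelyContinuous_intervalIntegral {f : ℝ → ℂ} {a b : ℝ}
    (h : IntervalIntegrable f volume a b) :
    AbsolutelyContinuousOnInterval (fun x ↦ ∫ v in a..x, f v) a b := by
  -- Increments of the integral of `f` are dominated by those of the integral of `‖f‖`, so the real
  -- case suffices.
  have h1 := h.norm.absolutelyContinuousOnInterval_intervalIntegral (c := a) (by simp)
  unfold AbsolutelyContinuousOnInterval at h1 ⊢
  refine squeeze_zero' (Eventually.of_forall fun _ => Finset.sum_nonneg fun _ _ => dist_nonneg)
    ?_ h1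
  rw [eventually_inf_principal]
  filter_upwards with E hE
  refine Finset.sum_le_sum fun i hi => ?_
  obtain ⟨hx, hy⟩ := hE.1 i hi
  have hs : ∀ z ∈ uIcc a b, IntervalIntegrable f volume a z := fun z hz =>
    h.mono_set (uIcc_subset_uIcc_left hz)
  rw [dist_eq_norm, dist_eq_norm, intervalIntegral.integral_interval_sub_left (hs _ hx) (hs _ hy),
    intervalIntegral.integral_interval_sub_left (hs _ hx).norm (hs _ hy).norm]
  exact intervalIntegral.norm_integral_le_abs_integral_norm

lemma absolutelyContinuous_const (c : ℂ) (a b : ℝ) :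
    AbsolutelyContinuousOnInterval (fun _ : ℝ => c) a b :=
  ContDiffOn.absolutelyContinuousOnInterval contDiffOn_const

/-- Product rule for two indefinite integrals. -/
lemma integral_mul_add_mul_indefinite {F G f g : ℝ → ℂ} {b : ℝ}
    (hf : IntervalIntegrable f volume 0 b) (hg : IntervalIntegrable g volume 0 b) (hb : 0 ≤ b)
    (hF : ∀ x ∈ Icc 0 b, F x = F 0 + ∫ t in (0 : ℝ)..x, f t)
    (hG : ∀ x ∈ Icc 0 b, G x = G 0 + ∫ t in (0 : ℝ)..x, g t) :
    ∫ x in (0 : ℝ)..b, (f x * G x + F x * g x) = F b * G b - F 0 * G 0 := by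
  -- `F` and `G` are known only on `[0, b]`; the integral formulas extend them, so that two-sided
  -- derivatives make sense.
  set F' : ℝ → ℂ := fun x => F 0 + ∫ t in (0 : ℝ)..x, f t with hF'
  set G' : ℝ → ℂ := fun x => G 0 + ∫ t in (0 : ℝ)..x, g t with hG'
  have aF : AbsolutelyContinuousOnInterval F' 0 b :=
    (absolutelyContinuous_const _ _ _).fun_add (absolutelyContinuous_intervalIntegral hf)
  have aG : AbsolutelyContinuousOnInterval G' 0 b :=
    (absolutelyContinuous_const _ _ _).fun_add (absolutelyContinuous_intervalIntegral hg)
  have hprod : IntervalIntegrable (fun x => f x * G' x + F' x * g x) volume 0 b :=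
    (hf.mul_continuousOn aG.continuousOn).add (hg.continuousOn_mul aF.continuousOn)
  -- The product minus the integral of its formal derivative is absolutely continuous with zero
  -- derivative almost everywhere, hence constant.
  have a1 : AbsolutelyContinuousOnInterval
      (fun x => F' x * G' x - ∫ t in (0 : ℝ)..x, (f t * G' t + F' t * g t)) 0 b :=
    (aF.fun_smul aG).fun_sub (absolutelyContinuous_intervalIntegral hprod)
  have hd : ∀ᵐ x, x ∈ uIcc 0 b → HasDerivAt
      (fun x => F' x * G' x - ∫ t in (0 : ℝ)..x, (f t * G' t + F' t * g t)) 0 x := by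
    filter_upwards [hf.ae_hasDerivAt_integral, hg.ae_hasDerivAt_integral,
      hprod.ae_hasDerivAt_integral] with x h1 h2 h3 hx
    have e1 : HasDerivAt F' (f x) x := (h1 hx 0 (by simp)).const_add _
    have e2 : HasDerivAt G' (g x) x := (h2 hx 0 (by simp)).const_add _
    convert! (e1.mul e2).sub (h3 hx 0 (by simp)) using 1
    ring
  obtain ⟨C, hC⟩ := a1.const_of_ae_hasDerivAt_zero hd
  have c0 := hC 0 (by simp)
  have cb := hC b (by simp)
  have hE : ∫ x in (0 : ℝ)..b, (f x * G x + F x * g x)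
      = ∫ x in (0 : ℝ)..b, (f x * G' x + F' x * g x) := by
    refine intervalIntegral.integral_congr fun x hx => ?_
    rw [uIcc_of_le hb] at hx
    simp only [hF', hG']
    rw [hF x hx, hG x hx]
  rw [hE]
  simp only [hF', hG'] at c0 cb ⊢
  simp only [intervalIntegral.integral_same, add_zero, sub_zero] at c0
  rw [← hF b ⟨hb, le_rfl⟩, ← hG b ⟨hb, le_rfl⟩] at cb
  rw [c0, ← cb]; ring

/-! ### The space `L₂[0, π]` -/

/-- Lebesgue measure on `[0, π]`. -/
abbrev muI : Measure ℝ := volume.restrict (Icc (0 : ℝ) Real.pi)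

lemma muI_eq : muI = volume.restrict (Ioc (0 : ℝ) Real.pi) := (restrict_Ioc_eq_restrict_Icc).symm

lemma integral_eq_muI {E : Type*} [NormedAddCommGroup E] [NormedSpace ℝ E] (f : ℝ → E) :
    ∫ x in (0 : ℝ)..Real.pi, f x = ∫ x, f x ∂muI := by
  rw [intervalIntegral.integral_of_le Real.pi_pos.le, muI_eq]

lemma intervalIntegrable_iff_muI {f : ℝ → ℂ} :
    IntervalIntegrable f volume 0 Real.pi ↔ Integrable f muI := by
  rw [intervalIntegrable_iff_integrableOn_Ioc_of_le Real.pi_pos.le, IntegrableOn, muI_eq]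

lemma MemL2.intervalIntegrable {f : ℝ → ℂ} (hf : MemL2 f) :
    IntervalIntegrable f volume 0 Real.pi :=
  intervalIntegrable_iff_muI.2 (MemLp.integrable (by norm_num) hf)

lemma MemL2.mul_integrable {f g : ℝ → ℂ} (hf : MemL2 f) (hg : MemL2 g) :
    IntervalIntegrable (fun x => f x * g x) volume 0 Real.pi :=
  intervalIntegrable_iff_muI.2 (MemLp.integrable_mul hf hg)

lemma memL2_of_continuousOn {f : ℝ → ℂ} (hf : ContinuousOn f (Icc 0 Real.pi)) : MemL2 f := by
  obtain ⟨C, hC⟩ := isCompact_Icc.exists_bound_of_continuousOn hf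
  refine MemLp.of_bound (hf.aestronglyMeasurable measurableSet_Icc) C ?_
  exact (ae_restrict_iff' measurableSet_Icc).2 (Eventually.of_forall hC)

lemma MemL2.mul_continuousOn {f g : ℝ → ℂ} (hf : MemL2 f) (hg : ContinuousOn g (Icc 0 Real.pi)) :
    MemL2 (fun x => f x * g x) := by
  obtain ⟨C, hC⟩ := isCompact_Icc.exists_bound_of_continuousOn hg
  refine MemLp.of_le_mul (c := C) hf (hf.1.mul (hg.aestronglyMeasurable measurableSet_Icc)) ?_
  refine (ae_restrict_iff' measurableSet_Icc).2 (Eventually.of_forall fun x hx => ?_)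
  rw [norm_mul, mul_comm]
  exact mul_le_mul_of_nonneg_right (hC x hx) (norm_nonneg _)

/-- The element of the Hilbert space `L₂[0, π]` given by a square integrable function. -/
def toL2 (f : ℝ → ℂ) (hf : MemL2 f) : Lp ℂ 2 muI := MemLp.toLp f hf

lemma MemL2.add {f g : ℝ → ℂ} (hf : MemL2 f) (hg : MemL2 g) : MemL2 (fun x => f x + g x) :=
  MemLp.add hf hg

lemma MemL2.sub {f g : ℝ → ℂ} (hf : MemL2 f) (hg : MemL2 g) : MemL2 (fun x => f x - g x) :=
  MemLp.sub hf hg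

lemma MemL2.const_mul {f : ℝ → ℂ} (hf : MemL2 f) (c : ℂ) : MemL2 (fun x => c * f x) :=
  MemLp.const_mul hf c

lemma MemL2.sum {ι : Type*} {s : Finset ι} {f : ι → ℝ → ℂ} (hf : ∀ i ∈ s, MemL2 (f i)) :
    MemL2 (fun x => ∑ i ∈ s, f i x) :=
  memLp_finsetSum _ hf

lemma toL2_add {f g : ℝ → ℂ} (hf : MemL2 f) (hg : MemL2 g) :
    toL2 (fun x => f x + g x) (hf.add hg) = toL2 f hf + toL2 g hg := rfl

lemma toL2_sub {f g : ℝ → ℂ} (hf : MemL2 f) (hg : MemL2 g) :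
    toL2 (fun x => f x - g x) (hf.sub hg) = toL2 f hf - toL2 g hg := rfl

lemma toL2_const_mul {f : ℝ → ℂ} (hf : MemL2 f) (c : ℂ) :
    toL2 (fun x => c * f x) (hf.const_mul c) = c • toL2 f hf := rfl

lemma toL2_congr {f g : ℝ → ℂ} (hf : MemL2 f) (hg : MemL2 g)
    (h : ∀ x ∈ Icc (0 : ℝ) Real.pi, f x = g x) : toL2 f hf = toL2 g hg :=
  (MemLp.toLp_eq_toLp_iff hf hg).2
    ((ae_restrict_iff' measurableSet_Icc).2 (Eventually.of_forall h))

lemma toL2_coe (F : Lp ℂ 2 muI) : toL2 F (Lp.memLp F) = F := Lp.toLp_coeFn F _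

lemma toL2_sum {ι : Type*} (s : Finset ι) {f : ι → ℝ → ℂ} (hf : ∀ i ∈ s, MemL2 (f i))
    (hf' : ∀ i, MemL2 (f i)) :
    toL2 (fun x => ∑ i ∈ s, f i x) (MemL2.sum hf) = ∑ i ∈ s, toL2 (f i) (hf' i) := by
  classical
  induction s using Finset.induction_on with
  | empty =>
    simp only [Finset.sum_empty]
    exact (MemLp.toLp_eq_toLp_iff _ (MemLp.zero (ε := ℂ))).2 (Eventually.of_forall fun x => rfl)
  | insert i s hi ih =>
    rw [Finset.sum_insert hi, ← ih (fun j _ => hf' j), ← toL2_add]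
    exact toL2_congr _ _ fun x _ => Finset.sum_insert hi

lemma inn_eq_inner {f g : ℝ → ℂ} (hf : MemL2 f) (hg : MemL2 g) :
    inn f g = inner ℂ (toL2 g hg) (toL2 f hf) := by
  rw [inn, integral_eq_muI, L2.inner_def]
  refine integral_congr_ae ?_
  filter_upwards [MemLp.coeFn_toLp hf, MemLp.coeFn_toLp hg] with x h1 h2
  rw [toL2, toL2, h1, h2, RCLike.inner_apply]

lemma normL2_eq_norm {f : ℝ → ℂ} (hf : MemL2 f) : normL2 f = ‖toL2 f hf‖ := by
  have h : ((∫ x in (0 : ℝ)..Real.pi, ‖f x‖ ^ 2 : ℝ) : ℂ) = inn f f := by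
    rw [inn, ← intervalIntegral.integral_ofReal]
    refine intervalIntegral.integral_congr fun x _ => ?_
    simp [RCLike.mul_conj]
  rw [inn_eq_inner hf hf, inner_self_eq_norm_sq_to_K] at h
  have h' : (∫ x in (0 : ℝ)..Real.pi, ‖f x‖ ^ 2 : ℝ) = ‖toL2 f hf‖ ^ 2 := by
    apply Complex.ofReal_injective
    rw [h]; simp
  rw [normL2, h', Real.sqrt_sq (norm_nonneg _)]

lemma normL2_nonneg (f : ℝ → ℂ) : 0 ≤ normL2 f := Real.sqrt_nonneg _

lemma norm_inn_le {f g : ℝ → ℂ} (hf : MemL2 f) (hg : MemL2 g) :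
    ‖inn f g‖ ≤ normL2 f * normL2 g := by
  rw [inn_eq_inner hf hg, normL2_eq_norm hf, normL2_eq_norm hg, mul_comm]
  exact norm_inner_le_norm _ _

lemma normL2_le_of_bound {f : ℝ → ℂ} {C : ℝ} (hC : 0 ≤ C)
    (h : ∀ x ∈ Icc (0 : ℝ) Real.pi, ‖f x‖ ≤ C) : normL2 f ≤ Real.sqrt Real.pi * C := by
  rw [normL2, ← Real.sqrt_sq hC, ← Real.sqrt_mul Real.pi_pos.le]
  refine Real.sqrt_le_sqrt ?_
  have := intervalIntegral.norm_integral_le_of_norm_le_const (a := 0) (b := Real.pi)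
    (f := fun x => ‖f x‖ ^ 2) (C := C ^ 2) (fun x hx => by
      rw [uIoc_of_le Real.pi_pos.le] at hx
      rw [norm_pow, norm_norm]
      exact pow_le_pow_left₀ (norm_nonneg _) (h x ⟨hx.1.le, hx.2⟩) 2)
  rw [sub_zero, abs_of_pos Real.pi_pos] at this
  rw [mul_comm Real.pi]
  exact (le_abs_self _).trans this

/-! ### Parseval identities for sines and cosines -/

/-- A family of unit vectors satisfying the Parseval identity is orthonormal. -/
lemma orthonormal_of_parseval {H : Type*} [NormedAddCommGroup H] [InnerProductSpace ℂ H]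
    {v : ℕ → H} (h1 : ∀ n, ‖v n‖ = 1)
    (h : ∀ f : H, HasSum (fun n => ‖inner ℂ (v n) f‖ ^ 2) (‖f‖ ^ 2)) : Orthonormal ℂ v := by
  refine ⟨h1, fun i j hij => ?_⟩
  by_contra hne
  -- In the Parseval identity of `v j` the term of index `j` already exhausts the sum `‖v j‖² = 1`.
  have hs := (h (v j))
  have := hs.summable.sum_le_tsum {i, j} (fun _ _ => by positivity)
  rw [hs.tsum_eq, Finset.sum_pair hij, inner_self_eq_norm_sq_to_K, h1] at this
  have hp : 0 < ‖inner ℂ (v i) (v j)‖ := norm_pos_iff.2 hne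
  norm_num at this
  exact hne this

/-- The Hilbert basis given by a family of unit vectors satisfying the Parseval identity. -/
def parsevalBasis {H : Type*} [NormedAddCommGroup H] [InnerProductSpace ℂ H] [CompleteSpace H]
    {v : ℕ → H} (h1 : ∀ n, ‖v n‖ = 1)
    (h : ∀ f : H, HasSum (fun n => ‖inner ℂ (v n) f‖ ^ 2) (‖f‖ ^ 2)) : HilbertBasis ℕ ℂ H :=
  HilbertBasis.mkOfOrthogonalEqBot (orthonormal_of_parseval h1 h) (by
    rw [Submodule.eq_bot_iff]
    intro f hf
    have h0 : ∀ n, inner ℂ (v n) f = 0 := fun n =>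
      (Submodule.mem_orthogonal _ _).1 hf _ (Submodule.subset_span ⟨n, rfl⟩)
    have := h f
    simp only [h0, norm_zero, ne_eq, OfNat.ofNat_ne_zero, not_false_eq_true, zero_pow] at this
    have := this.unique hasSum_zero
    simpa using this)

/-- The `n`-th function of the orthonormal cosine system on `[0, π]`. -/
def cosFun (n : ℕ) (x : ℝ) : ℂ :=
  if n = 0 then ((Real.sqrt Real.pi)⁻¹ : ℝ) else ((Real.sqrt (2 / Real.pi) * Real.cos (n * x) : ℝ) : ℂ)

/-- The `n`-th function of the orthonormal sine system on `[0, π]`. -/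
def sinFun (n : ℕ) (x : ℝ) : ℂ := ((Real.sqrt (2 / Real.pi) * Real.sin (n * x) : ℝ) : ℂ)

lemma continuous_cosFun (n : ℕ) : Continuous (cosFun n) := by
  unfold cosFun
  split_ifs <;> fun_prop

lemma continuous_sinFun (n : ℕ) : Continuous (sinFun n) := by
  unfold sinFun
  fun_prop

lemma memL2_cosFun (n : ℕ) : MemL2 (cosFun n) :=
  memL2_of_continuousOn (continuous_cosFun n).continuousOn

lemma memL2_sinFun (n : ℕ) : MemL2 (sinFun n) :=
  memL2_of_continuousOn (continuous_sinFun n).continuousOn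

/-- The extension of `f` from `[0, π]` to `[-π, π]`, even for `ε = 1` and odd for `ε = -1`. -/
def parityExt (ε : ℂ) (f : ℝ → ℂ) (x : ℝ) : ℂ := (Ioi (0 : ℝ)).piecewise f (fun x => ε * f (-x)) x

lemma memLp_parityExt (ε : ℂ) {f : ℝ → ℂ} (hf : MemL2 f) :
    MemLp (parityExt ε f) 2 (volume.restrict (Ioc (-Real.pi) Real.pi)) := by
  unfold MemL2 at hf
  refine MemLp.piecewise measurableSet_Ioi ?_ ?_
  · rw [Measure.restrict_restrict measurableSet_Ioi]
    refine hf.mono_measure (Measure.restrict_mono_set _ ?_)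
    exact fun x hx => ⟨le_of_lt hx.1, hx.2.2⟩
  · rw [Measure.restrict_restrict measurableSet_Ioi.compl]
    have h1 : MemLp (fun x => f (-x)) 2 (volume.restrict (Icc (-Real.pi) 0)) := by
      have hp : MeasurePreserving (fun x : ℝ => -x) (volume.restrict (Icc (-Real.pi) 0))
          (volume.restrict (Icc (0 : ℝ) Real.pi)) := by
        have := (Measure.measurePreserving_neg (volume : Measure ℝ)).restrict_preimage
          (s := Icc (0 : ℝ) Real.pi) measurableSet_Icc
        simpa using this
      exact hf.comp_measurePreserving hp
    refine (h1.const_mul ε).mono_measure (Measure.restrict_mono_set _ ?_)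
    exact fun x hx => ⟨hx.2.1.le, by simpa using hx.1⟩

lemma integral_parityExt {E : Type*} [NormedAddCommGroup E] [NormedSpace ℝ E] (ε : ℂ) (f : ℝ → ℂ)
    (Φ : ℝ → ℂ → E)
    (hi : IntervalIntegrable (fun x => Φ x (parityExt ε f x)) volume (-Real.pi) Real.pi) :
    ∫ x in (-Real.pi)..Real.pi, Φ x (parityExt ε f x)
      = ∫ x in (0 : ℝ)..Real.pi, (Φ x (f x) + Φ (-x) (ε * f x)) := by
  have h0 : (0 : ℝ) ∈ uIcc (-Real.pi) Real.pi := by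
    rw [uIcc_of_le (by linarith [Real.pi_pos])]; constructor <;> linarith [Real.pi_pos]
  have i1 := hi.mono_set (uIcc_subset_uIcc_left h0)
  have i2 := hi.mono_set (uIcc_subset_uIcc_right h0)
  have i1' : IntervalIntegrable (fun x => Φ (-x) (parityExt ε f (-x))) volume 0 Real.pi := by
    have := (IntervalIntegrable.iff_comp_neg (f := fun x => Φ x (parityExt ε f x))).1 i1
    simpa using this.symm
  have e1 : ∫ x in (-Real.pi)..0, Φ x (parityExt ε f x)
      = ∫ x in (0 : ℝ)..Real.pi, Φ (-x) (parityExt ε f (-x)) := by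
    rw [intervalIntegral.integral_comp_neg (fun x => Φ x (parityExt ε f x))]; simp
  rw [← intervalIntegral.integral_add_adjacent_intervals i1 i2, e1,
    ← intervalIntegral.integral_add i1' i2, ]
  refine intervalIntegral.integral_congr_ae (Eventually.of_forall fun x hx => ?_)
  rw [uIoc_of_le Real.pi_pos.le] at hx
  have hx0 : 0 < x := hx.1
  have n1 : parityExt ε f x = f x := by simp [parityExt, hx0]
  have n2 : parityExt ε f (-x) = ε * f x := by
    simp [parityExt, Set.piecewise, hx0.le]
  rw [n1, n2, add_comm]

lemma fourierCoeffOn_parityExt (ε : ℂ) {f : ℝ → ℂ} (hf : MemL2 f) (n : ℤ) :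
    fourierCoeffOn (a := -Real.pi) (b := Real.pi) (by linarith [Real.pi_pos]) (parityExt ε f) n
      = (2 * Real.pi : ℂ)⁻¹ * ∫ x in (0 : ℝ)..Real.pi,
          (Complex.exp (-(n * x : ℝ) * Complex.I) + ε * Complex.exp ((n * x : ℝ) * Complex.I)) * f x := by
  have hlt : -Real.pi < Real.pi := by linarith [Real.pi_pos]
  have hc : ∀ x : ℝ, fourier (-n) (x : AddCircle (Real.pi - -Real.pi))
      = Complex.exp (-(n * x : ℝ) * Complex.I) := by
    intro x
    rw [fourier_coe_apply]
    congr 1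
    have : (Real.pi : ℂ) ≠ 0 := by exact_mod_cast Real.pi_ne_zero
    push_cast
    field_simp
    ring
  rw [fourierCoeffOn_eq_integral _ _ hlt]
  simp only [hc, smul_eq_mul]
  have hm := memLp_parityExt ε hf
  have hfin : IntervalIntegrable (parityExt ε f) volume (-Real.pi) Real.pi := by
    rw [intervalIntegrable_iff_integrableOn_Ioc_of_le hlt.le]
    exact MemLp.integrable (by norm_num) hm
  rw [integral_parityExt ε f (fun x z => Complex.exp (-(n * x : ℝ) * Complex.I) * z)
    (hfin.continuousOn_mul (by fun_prop))]
  rw [Complex.real_smul]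
  congr 1
  · push_cast; rw [one_div]; congr 1; ring
  · refine intervalIntegral.integral_congr fun x _ => ?_
    push_cast
    simp only [mul_neg, neg_mul, neg_neg]
    ring

/-- Parseval for exponentials on `[-π, π]` applied to an even or odd extension. The bracket is `2
cos` for `ε = 1` and `-2i sin` for `ε = -1`, so both half-range Parseval identities are contained
here. -/
lemma hasSum_parityExt (ε : ℂ) (hε : ‖ε‖ = 1) {f : ℝ → ℂ} (hf : MemL2 f) :
    HasSum (fun n : ℤ => ‖∫ x in (0 : ℝ)..Real.pi,
      (Complex.exp (-(n * x : ℝ) * Complex.I) + ε * Complex.exp ((n * x : ℝ) * Complex.I)) * f x‖ ^ 2)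
      (4 * Real.pi * normL2 f ^ 2) := by
  have hlt : -Real.pi < Real.pi := by linarith [Real.pi_pos]
  have hm := memLp_parityExt ε hf
  have h := hasSum_sq_fourierCoeffOn hlt hm
  have hprod : IntervalIntegrable (fun x => ‖parityExt ε f x‖ ^ 2) volume (-Real.pi) Real.pi := by
    rw [intervalIntegrable_iff_integrableOn_Ioc_of_le hlt.le]
    exact hm.integrable_norm_pow (by norm_num)
  rw [integral_parityExt ε f (fun _ z => ‖z‖ ^ 2) hprod] at h
  simp only [fourierCoeffOn_parityExt ε hf, norm_mul, hε, one_mul, mul_pow] at h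
  have h2 := h.mul_left ((2 * Real.pi) ^ 2)
  convert! h2 using 1
  · funext n
    rw [norm_inv, norm_mul, Complex.norm_real, Real.norm_of_nonneg Real.pi_pos.le]
    simp only [Complex.norm_ofNat]
    rw [← mul_assoc, ← mul_pow, mul_inv_cancel₀ (by positivity), one_pow, one_mul]
  · have e : ∫ x in (0 : ℝ)..Real.pi, (‖f x‖ ^ 2 + ‖f x‖ ^ 2) = 2 * normL2 f ^ 2 := by
      rw [normL2, Real.sq_sqrt (intervalIntegral.integral_nonneg Real.pi_pos.le
        (fun _ _ => by positivity)), ← intervalIntegral.integral_const_mul]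
      refine intervalIntegral.integral_congr fun x _ => ?_
      ring
    rw [e, smul_eq_mul]
    field_simp
    ring

lemma inn_cosFun (f : ℝ → ℂ) (n : ℕ) (hn : n ≠ 0) : inn f (cosFun n)
    = Real.sqrt (2 / Real.pi) * ∫ x in (0 : ℝ)..Real.pi, Real.cos (n * x) * f x := by
  rw [inn, ← intervalIntegral.integral_const_mul]
  refine intervalIntegral.integral_congr fun x _ => ?_
  simp only [cosFun, hn, if_false, Complex.conj_ofReal]
  push_cast; ring

lemma inn_cosFun_zero (f : ℝ → ℂ) : inn f (cosFun 0)
    = ((Real.sqrt Real.pi)⁻¹ : ℝ) * ∫ x in (0 : ℝ)..Real.pi, f x := by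
  rw [inn, ← intervalIntegral.integral_const_mul]
  refine intervalIntegral.integral_congr fun x _ => ?_
  simp only [cosFun, if_true, Complex.conj_ofReal]
  ring

lemma inn_sinFun (f : ℝ → ℂ) (n : ℕ) : inn f (sinFun n)
    = Real.sqrt (2 / Real.pi) * ∫ x in (0 : ℝ)..Real.pi, Real.sin (n * x) * f x := by
  rw [inn, ← intervalIntegral.integral_const_mul]
  refine intervalIntegral.integral_congr fun x _ => ?_
  simp only [sinFun, Complex.conj_ofReal]
  push_cast; ring

lemma sineCoeff_eq (f : ℝ → ℂ) (n : ℕ) : sineCoeff f n = inn f (sinFun n) := by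
  rw [inn_sinFun, sineCoeff, inn]
  congr 1
  refine intervalIntegral.integral_congr fun x _ => ?_
  simp only [Complex.conj_ofReal]
  ring

lemma norm_sqrt_two_div_pi_mul_sq (z : ℂ) :
    ‖(Real.sqrt (2 / Real.pi) : ℂ) * z‖ ^ 2 = 2 / Real.pi * ‖z‖ ^ 2 := by
  rw [norm_mul, mul_pow, Complex.norm_real, Real.norm_of_nonneg (Real.sqrt_nonneg _),
    Real.sq_sqrt (by positivity)]

lemma exp_add_exp (z : ℂ) : Complex.exp (-z * Complex.I) + 1 * Complex.exp (z * Complex.I)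
    = 2 * Complex.cos z := by
  rw [Complex.cos]; ring

lemma exp_sub_exp (z : ℂ) : Complex.exp (-z * Complex.I) + (-1) * Complex.exp (z * Complex.I)
    = (-2 * Complex.I) * Complex.sin z := by
  rw [Complex.sin]
  linear_combination (Complex.exp (-z * Complex.I) - Complex.exp (z * Complex.I)) * Complex.I_sq

lemma hasSum_sq_cos {f : ℝ → ℂ} (hf : MemL2 f) :
    HasSum (fun n => ‖inn f (cosFun n)‖ ^ 2) (normL2 f ^ 2) := by
  have hpi := Real.pi_pos
  have h := hasSum_parityExt 1 (by simp) hf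
  set A : ℤ → ℂ := fun n => ∫ x in (0 : ℝ)..Real.pi, Real.cos (n * x) * f x with hA
  have e : ∀ n : ℤ, (∫ x in (0 : ℝ)..Real.pi, (Complex.exp (-(n * x : ℝ) * Complex.I)
      + 1 * Complex.exp ((n * x : ℝ) * Complex.I)) * f x) = 2 * A n := by
    intro n
    rw [hA, ← intervalIntegral.integral_const_mul]
    refine intervalIntegral.integral_congr fun x _ => ?_
    simp only [exp_add_exp, ← Complex.ofReal_cos, mul_assoc]
  simp only [e] at h
  have h2 := (h.nat_add_neg).mul_left (1 / (4 * Real.pi))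
  have hAneg : ∀ n : ℕ, A (-(n : ℤ)) = A n := by
    intro n; simp [hA]
  have h0 : ∀ n : ℕ, n ≠ 0 → ‖inn f (cosFun n)‖ ^ 2
      = 1 / (4 * Real.pi) * (‖2 * A (n : ℤ)‖ ^ 2 + ‖2 * A (-(n : ℤ))‖ ^ 2) := by
    intro n hn
    rw [inn_cosFun f n hn, norm_sqrt_two_div_pi_mul_sq, hAneg, norm_mul, mul_pow]
    simp only [hA, Int.cast_natCast, Complex.norm_ofNat]
    field_simp
    ring
  have hz : ‖inn f (cosFun 0)‖ ^ 2 = 1 / (4 * Real.pi) * ‖2 * A 0‖ ^ 2 := by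
    rw [inn_cosFun_zero, norm_mul, mul_pow, norm_mul, mul_pow, Complex.norm_real,
      Real.norm_of_nonneg (by positivity), inv_pow, Real.sq_sqrt hpi.le]
    simp only [hA, Int.cast_zero, zero_mul, Real.cos_zero, Complex.ofReal_one, one_mul,
      Complex.norm_ofNat]
    field_simp
    ring
  -- Folding the two-sided series counts the index `0` twice, and `cosFun 0` has its own
  -- normalization; the term at `0` is therefore replaced.
  have h3 := h2.update 0 (‖inn f (cosFun 0)‖ ^ 2)
  convert! h3 using 1
  · funext n
    by_cases hn : n = 0
    · subst hn; simp
    · rw [Function.update_of_ne hn, h0 n hn]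
  · simp only [Nat.cast_zero, neg_zero, hz]
    field_simp
    ring

lemma hasSum_sq_sin {f : ℝ → ℂ} (hf : MemL2 f) :
    HasSum (fun n => ‖inn f (sinFun n)‖ ^ 2) (normL2 f ^ 2) := by
  have hpi := Real.pi_pos
  have h := hasSum_parityExt (-1) (by simp) hf
  set A : ℤ → ℂ := fun n => ∫ x in (0 : ℝ)..Real.pi, Real.sin (n * x) * f x with hA
  have e : ∀ n : ℤ, (∫ x in (0 : ℝ)..Real.pi, (Complex.exp (-(n * x : ℝ) * Complex.I)
      + (-1) * Complex.exp ((n * x : ℝ) * Complex.I)) * f x) = (-2 * Complex.I) * A n := by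
    intro n
    rw [hA, ← intervalIntegral.integral_const_mul]
    refine intervalIntegral.integral_congr fun x _ => ?_
    simp only [exp_sub_exp, ← Complex.ofReal_sin, mul_assoc]
  simp only [e] at h
  have h2 := (h.nat_add_neg).mul_left (1 / (4 * Real.pi))
  have hAneg : ∀ n : ℕ, A (-(n : ℤ)) = - A n := by
    intro n; simp [hA]
  have hA0 : A 0 = 0 := by simp [hA]
  convert! h2 using 1
  · funext n
    rw [inn_sinFun f n, norm_sqrt_two_div_pi_mul_sq, hAneg, mul_neg, norm_neg, norm_mul, mul_pow]
    simp only [hA, Int.cast_natCast, norm_mul, norm_neg, Complex.norm_ofNat, Complex.norm_I]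
    field_simp
    ring
  · rw [hA0]; field_simp; simp

lemma normL2_cosFun (n : ℕ) : normL2 (cosFun n) = 1 := by
  have hpi := Real.pi_pos
  rw [normL2, Real.sqrt_eq_one]
  by_cases hn : n = 0
  · simp only [cosFun, hn, if_true, Complex.norm_real, Real.norm_eq_abs, sq_abs, inv_pow,
      Real.sq_sqrt hpi.le, intervalIntegral.integral_const, sub_zero, smul_eq_mul]
    field_simp
  · have : ∀ x : ℝ, ‖cosFun n x‖ ^ 2 = 2 / Real.pi * Real.cos (n * x) ^ 2 := by
      intro x
      simp only [cosFun, hn, if_false, Complex.norm_real, Real.norm_eq_abs, sq_abs, mul_pow]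
      rw [Real.sq_sqrt (by positivity)]
    simp only [this, intervalIntegral.integral_const_mul]
    have hn' : (n : ℝ) ≠ 0 := by exact_mod_cast hn
    rw [intervalIntegral.integral_comp_mul_left (fun x => Real.cos x ^ 2) hn', integral_cos_sq]
    simp [Real.sin_nat_mul_pi]
    field_simp

lemma normL2_sinFun (n : ℕ) (hn : n ≠ 0) : normL2 (sinFun n) = 1 := by
  have hpi := Real.pi_pos
  rw [normL2, Real.sqrt_eq_one]
  have : ∀ x : ℝ, ‖sinFun n x‖ ^ 2 = 2 / Real.pi * Real.sin (n * x) ^ 2 := by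
    intro x
    simp only [sinFun, Complex.norm_real, Real.norm_eq_abs, sq_abs, mul_pow]
    rw [Real.sq_sqrt (by positivity)]
  simp only [this, intervalIntegral.integral_const_mul]
  have hn' : (n : ℝ) ≠ 0 := by exact_mod_cast hn
  rw [intervalIntegral.integral_comp_mul_left (fun x => Real.sin x ^ 2) hn', integral_sin_sq]
  simp [Real.sin_nat_mul_pi]
  field_simp

/-- The cosine basis of `L₂[0, π]`. -/
def cosBasis : HilbertBasis ℕ ℂ (Lp ℂ 2 muI) :=
  parsevalBasis (v := fun n => toL2 (cosFun n) (memL2_cosFun n))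
    (fun n => by rw [← normL2_eq_norm, normL2_cosFun])
    (fun f => by
      have hf : MemL2 f := Lp.memLp f
      have h := hasSum_sq_cos hf
      rw [normL2_eq_norm hf, toL2_coe] at h
      simpa only [inn_eq_inner hf (memL2_cosFun _), toL2_coe] using h)

/-- The sine basis of `L₂[0, π]`. -/
def sinBasis : HilbertBasis ℕ ℂ (Lp ℂ 2 muI) :=
  parsevalBasis (v := fun n => toL2 (sinFun (n + 1)) (memL2_sinFun (n + 1)))
    (fun n => by rw [← normL2_eq_norm, normL2_sinFun _ n.succ_ne_zero])
    (fun f => by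
      have hf : MemL2 f := Lp.memLp f
      have h := hasSum_sq_sin hf
      rw [← hasSum_nat_add_iff' 1] at h
      have h0 : inn f (sinFun 0) = 0 := by simp [inn, sinFun]
      rw [normL2_eq_norm hf, toL2_coe] at h
      simp only [Finset.range_one, Finset.sum_singleton, h0, norm_zero] at h
      simpa [inn_eq_inner hf (memL2_sinFun _), toL2_coe] using h)

lemma cosBasis_apply (n : ℕ) : cosBasis n = toL2 (cosFun n) (memL2_cosFun n) := by
  simp [cosBasis, parsevalBasis]

lemma sinBasis_apply (n : ℕ) :
    sinBasis n = toL2 (sinFun (n + 1)) (memL2_sinFun (n + 1)) := by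
  simp [sinBasis, parsevalBasis]

/-- Parseval identity for the cosine system. -/
lemma hasSum_inn_cos {f g : ℝ → ℂ} (hf : MemL2 f) (hg : MemL2 g) :
    HasSum (fun n => inn f (cosFun n) * inn (cosFun n) g) (inn f g) := by
  have h := cosBasis.hasSum_inner_mul_inner (toL2 g hg) (toL2 f hf)
  rw [← inn_eq_inner hf hg] at h
  convert! h using 1
  funext n
  rw [cosBasis_apply, ← inn_eq_inner, ← inn_eq_inner, mul_comm]

lemma inn_sinFun_sinFun (j k : ℕ) (hk : k ≠ 0) :
    inn (sinFun j) (sinFun k) = if j = k then 1 else 0 := by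
  rcases eq_or_ne j 0 with rfl | hj
  · rw [if_neg hk.symm]; simp [inn, sinFun]
  obtain ⟨j, rfl⟩ := Nat.exists_eq_succ_of_ne_zero hj
  obtain ⟨k, rfl⟩ := Nat.exists_eq_succ_of_ne_zero hk
  have := orthonormal_iff_ite.1 sinBasis.orthonormal k j
  rw [sinBasis_apply, sinBasis_apply, ← inn_eq_inner] at this
  simp only [Nat.succ_eq_add_one, this, Nat.add_right_cancel_iff, eq_comm]

/-- Convergence of sine series in `L₂[0, π]`. -/
lemma tendsto_sine_sum {f : ℝ → ℂ} (hf : MemL2 f) :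
    Tendsto (fun m : ℕ => normL2 (fun x => f x - ∑ n ∈ Finset.Icc 1 m, sineCoeff f n * sinFun n x))
      atTop (𝓝 0) := by
  have h := (sinBasis.hasSum_repr (toL2 f hf)).tendsto_sum_nat
  have h2 := tendsto_iff_norm_sub_tendsto_zero.1 h
  refine h2.congr fun m => ?_
  have hmem : ∀ n, MemL2 (fun x => sineCoeff f n * sinFun n x) := fun n =>
    memL2_of_continuousOn ((continuous_const.mul (continuous_sinFun n)).continuousOn)
  have e2 : ∀ i, sinBasis.repr (toL2 f hf) i • sinBasis i = toL2 _ (hmem (i + 1)) := by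
    intro i
    rw [HilbertBasis.repr_apply_apply, sinBasis_apply, ← inn_eq_inner hf, ← sineCoeff_eq,
      ← toL2_const_mul]
  rw [normL2_eq_norm (hf.sub (MemL2.sum fun n _ => hmem n)), toL2_sub hf (MemL2.sum fun n _ => hmem n),
    toL2_sum _ (fun n _ => hmem n) hmem,
    norm_sub_rev]
  congr 2
  rw [Finset.sum_congr rfl (fun i _ => e2 i), Finset.range_eq_Ico,
    Finset.sum_Ico_add' (fun i => toL2 _ (hmem i)) 0 m 1]
  rfl

/-! ### Volterra operators on `C[0, π]` -/

/-- Continuous functions on `[0, π]`. -/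
abbrev CI : Type := C(Icc (0 : ℝ) Real.pi, ℂ)

/-- Extension of a continuous function on `[0, π]` to the line by constants. -/
def ext (φ : CI) : ℝ → ℂ := IccExtend Real.pi_pos.le φ

lemma continuous_ext (φ : CI) : Continuous (ext φ) := φ.continuous.Icc_extend'

lemma ext_of_mem (φ : CI) {x : ℝ} (hx : x ∈ Icc (0 : ℝ) Real.pi) : ext φ x = φ ⟨x, hx⟩ :=
  IccExtend_of_mem _ _ hx

lemma ext_coe (φ : CI) (x : Icc (0 : ℝ) Real.pi) : ext φ x = φ x := ext_of_mem φ x.2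

lemma norm_ext_le (φ : CI) (x : ℝ) : ‖ext φ x‖ ≤ ‖φ‖ := φ.norm_coe_le_norm _

lemma memL2_ext (φ : CI) : MemL2 (ext φ) := memL2_of_continuousOn (continuous_ext φ).continuousOn

/-- Restriction of a function continuous on `[0, π]`. -/
def res (y : ℝ → ℂ) (hy : ContinuousOn y (Icc 0 Real.pi)) : CI := ⟨_, hy.domRestrict⟩

lemma res_apply (y : ℝ → ℂ) (hy : ContinuousOn y (Icc 0 Real.pi)) (x : Icc (0 : ℝ) Real.pi) :
    res y hy x = y x := rfl

lemma ext_res {y : ℝ → ℂ} (hy : ContinuousOn y (Icc 0 Real.pi)) {x : ℝ}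
    (hx : x ∈ Icc (0 : ℝ) Real.pi) : ext (res y hy) x = y x := ext_of_mem _ hx

lemma zero_mem_I : (0 : ℝ) ∈ Icc (0 : ℝ) Real.pi := ⟨le_rfl, Real.pi_pos.le⟩

lemma pi_mem_I : Real.pi ∈ Icc (0 : ℝ) Real.pi := ⟨Real.pi_pos.le, le_rfl⟩

lemma IntervalIntegrable.sub_I {k : ℝ → ℂ} (hk : IntervalIntegrable k volume 0 Real.pi) {x : ℝ}
    (hx : x ∈ Icc (0 : ℝ) Real.pi) : IntervalIntegrable k volume 0 x :=
  hk.mono_set (uIcc_subset_uIcc_left (by rwa [uIcc_of_le Real.pi_pos.le]))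

lemma integral_norm_le_I {k : ℝ → ℂ} (hk : IntervalIntegrable k volume 0 Real.pi) {x : ℝ}
    (hx : x ∈ Icc (0 : ℝ) Real.pi) : ∫ t in (0 : ℝ)..x, ‖k t‖ ≤ ∫ t in (0 : ℝ)..Real.pi, ‖k t‖ :=
  intervalIntegral.integral_mono_interval le_rfl hx.1 hx.2
    (Eventually.of_forall fun _ => norm_nonneg _) hk.norm

/-- The operator `φ ↦ ∫₀^x k φ` of `C[0, π]`, for an integrable function `k`. -/
def intOp (k : ℝ → ℂ) (hk : IntervalIntegrable k volume 0 Real.pi) : CI →L[ℂ] CI :=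
  LinearMap.mkContinuous
    { toFun := fun φ => res (fun x => ∫ t in (0 : ℝ)..x, k t * ext φ t) (by
        have := intervalIntegral.continuousOn_primitive_interval' (μ := volume)
          (hk.mul_continuousOn (continuous_ext φ).continuousOn) (a := 0) (by simp)
        rwa [uIcc_of_le Real.pi_pos.le] at this)
      map_add' := fun φ ψ => by
        ext x
        simp only [res_apply, ContinuousMap.add_apply]
        rw [← intervalIntegral.integral_add]
        · refine intervalIntegral.integral_congr fun t _ => ?_
          simp [ext, IccExtend, mul_add]
        · exact (IntervalIntegrable.sub_I hk x.2).mul_continuousOn (continuous_ext φ).continuousOn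
        · exact (IntervalIntegrable.sub_I hk x.2).mul_continuousOn (continuous_ext ψ).continuousOn
      map_smul' := fun c φ => by
        ext x
        simp only [res_apply, ContinuousMap.smul_apply, RingHom.id_apply, smul_eq_mul]
        rw [← intervalIntegral.integral_const_mul]
        refine intervalIntegral.integral_congr fun t _ => ?_
        simp [ext, IccExtend]; ring }
    (∫ t in (0 : ℝ)..Real.pi, ‖k t‖) (fun φ => by
      have h0 : 0 ≤ ∫ t in (0 : ℝ)..Real.pi, ‖k t‖ :=
        intervalIntegral.integral_nonneg Real.pi_pos.le fun _ _ => norm_nonneg _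
      refine (ContinuousMap.norm_le _ (by positivity)).2 fun x => ?_
      simp only [LinearMap.coe_mk, AddHom.coe_mk, res_apply]
      refine (intervalIntegral.norm_integral_le_of_norm_le (g := fun t => ‖k t‖ * ‖φ‖) x.2.1
        (Eventually.of_forall fun t _ => ?_)
        ((IntervalIntegrable.sub_I hk x.2).norm.mul_const _)).trans ?_
      · rw [norm_mul]; exact mul_le_mul_of_nonneg_left (norm_ext_le φ t) (norm_nonneg _)
      · rw [intervalIntegral.integral_mul_const]
        exact mul_le_mul_of_nonneg_right (integral_norm_le_I hk x.2) (norm_nonneg _))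

lemma intOp_apply (k : ℝ → ℂ) (hk : IntervalIntegrable k volume 0 Real.pi) (φ : CI)
    (x : Icc (0 : ℝ) Real.pi) : intOp k hk φ x = ∫ t in (0 : ℝ)..x, k t * ext φ t := rfl

/-- The function `e^{κ x}` on `[0, π]`. -/
def expCI (κ : ℝ) : CI := ⟨fun x => (Real.exp (κ * x) : ℂ), by fun_prop⟩

/-- Multiplication by `e^{κ x}`. -/
def expMul (κ : ℝ) : CI →L[ℂ] CI := ContinuousLinearMap.mul ℂ CI (expCI κ)

lemma expMul_apply (κ : ℝ) (φ : CI) (x : Icc (0 : ℝ) Real.pi) :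
    expMul κ φ x = (Real.exp (κ * x) : ℂ) * φ x := rfl

lemma expMul_comp_neg (κ : ℝ) (φ : CI) : expMul κ (expMul (-κ) φ) = φ := by
  ext x
  rw [expMul_apply, expMul_apply, ← mul_assoc, ← Complex.ofReal_mul, ← Real.exp_add]
  simp

/-- In an exponentially weighted norm the operator `φ ↦ ∫₀^x k φ` is small. -/
lemma exists_weighted_intOp_le (k : ℝ → ℂ) (hk : IntervalIntegrable k volume 0 Real.pi) {ε : ℝ}
    (hε : 0 < ε) : ∃ κ₀ : ℝ, ∀ κ ≥ κ₀, ∀ φ : CI,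
      ‖expMul (-κ) (intOp k hk (expMul κ φ))‖ ≤ ε * ‖φ‖ := by
  -- `k` is a bounded function `g` plus a part with small `L₁` norm. The weight `e^{-κ(x-t)} ≤ 1`
  -- leaves the small part small, and integrating the weight against `g` gains the factor `1/κ`.
  obtain ⟨g, hg, hgi⟩ := (intervalIntegrable_iff_muI.1 hk).exists_boundedContinuous_integral_sub_le
    (half_pos hε)
  refine ⟨max 1 (2 * ‖g‖ / ε), fun κ hκ φ => ?_⟩
  have hκ0 : 0 < κ := lt_of_lt_of_le one_pos ((le_max_left _ _).trans hκ)
  have hκ1 : ‖g‖ / κ ≤ ε / 2 := by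
    have := (le_max_right _ _).trans hκ
    rw [div_le_iff₀ hε] at this
    rw [div_le_iff₀ hκ0]; linarith
  refine (ContinuousMap.norm_le _ (by positivity)).2 fun x => ?_
  rw [expMul_apply, intOp_apply, ← intervalIntegral.integral_const_mul]
  have hkg : IntervalIntegrable (fun t => k t - g t) volume 0 Real.pi :=
    intervalIntegrable_iff_muI.2 ((intervalIntegrable_iff_muI.1 hk).sub hgi)
  have hgc : IntervalIntegrable (fun t => Real.exp (-κ * x) * Real.exp (κ * t) * ‖g‖ * ‖φ‖)
    volume 0 x := (by fun_prop : Continuous _).intervalIntegrable _ _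
  refine (intervalIntegral.norm_integral_le_of_norm_le (μ := volume)
    (g := fun t => ‖k t - g t‖ * ‖φ‖ + Real.exp (-κ * x) * Real.exp (κ * t) * ‖g‖ * ‖φ‖)
    x.2.1 (Eventually.of_forall fun t ht => ?_)
    (((IntervalIntegrable.sub_I hkg x.2).norm.mul_const _).add hgc)).trans ?_
  · have hti : t ∈ Icc (0 : ℝ) Real.pi := ⟨ht.1.le, ht.2.trans x.2.2⟩
    rw [ext_of_mem _ hti, expMul_apply]
    simp only [norm_mul, Complex.norm_real, Real.norm_eq_abs, Real.abs_exp]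
    have h1 : Real.exp (-κ * x) * Real.exp (κ * t) ≤ 1 := by
      rw [← Real.exp_add]
      refine Real.exp_le_one_iff.2 ?_
      nlinarith [ht.2]
    have h2 : ‖k t‖ ≤ ‖k t - g t‖ + ‖g‖ := by
      have := norm_add_le (k t - g t) (g t)
      rw [sub_add_cancel] at this
      linarith [g.norm_coe_le_norm t]
    have h3 : ‖φ ⟨t, hti⟩‖ ≤ ‖φ‖ := φ.norm_coe_le_norm _
    have h0 : 0 ≤ Real.exp (-κ * x) * Real.exp (κ * t) := by positivity
    calc _ = (Real.exp (-κ * x) * Real.exp (κ * t)) * ‖k t‖ * ‖φ ⟨t, hti⟩‖ := by ring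
      _ ≤ (Real.exp (-κ * x) * Real.exp (κ * t)) * (‖k t - g t‖ + ‖g‖) * ‖φ‖ := by gcongr
      _ = (Real.exp (-κ * x) * Real.exp (κ * t)) * ‖k t - g t‖ * ‖φ‖
          + (Real.exp (-κ * x) * Real.exp (κ * t)) * ‖g‖ * ‖φ‖ := by ring
      _ ≤ 1 * ‖k t - g t‖ * ‖φ‖ + (Real.exp (-κ * x) * Real.exp (κ * t)) * ‖g‖ * ‖φ‖ := by gcongr
      _ = _ := by rw [one_mul]
  · rw [intervalIntegral.integral_add ((IntervalIntegrable.sub_I hkg x.2).norm.mul_const _) hgc]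
    have e1 : ∫ t in (0 : ℝ)..x, ‖k t - g t‖ * ‖φ‖ ≤ ε / 2 * ‖φ‖ := by
      rw [intervalIntegral.integral_mul_const]
      refine mul_le_mul_of_nonneg_right ((integral_norm_le_I hkg x.2).trans ?_) (norm_nonneg _)
      rw [integral_eq_muI]; exact hg
    have e2 : ∫ t in (0 : ℝ)..x, Real.exp (-κ * x) * Real.exp (κ * t) * ‖g‖ * ‖φ‖
        ≤ ε / 2 * ‖φ‖ := by
      have : ∫ t in (0 : ℝ)..x, Real.exp (κ * t) = (Real.exp (κ * x) - 1) / κ := by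
        rw [intervalIntegral.integral_comp_mul_left (fun t => Real.exp t) hκ0.ne', integral_exp]
        simp [div_eq_inv_mul]
      simp only [intervalIntegral.integral_mul_const, intervalIntegral.integral_const_mul, this]
      refine mul_le_mul_of_nonneg_right (le_trans ?_ hκ1) (norm_nonneg _)
      have h5 : Real.exp (-κ * x) * Real.exp (κ * x) = 1 := by rw [← Real.exp_add]; simp
      have h6 : Real.exp (-κ * x) * ((Real.exp (κ * x) - 1) / κ)
          = (1 - Real.exp (-κ * x)) / κ := by
        have : Real.exp (-κ * x) * ((Real.exp (κ * x) - 1) / κ)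
          = (Real.exp (-κ * x) * Real.exp (κ * x) - Real.exp (-κ * x)) / κ := by ring
        rw [this, h5]
      rw [h6, div_mul_eq_mul_div]
      gcongr
      have := Real.exp_pos (-κ * x)
      nlinarith [norm_nonneg g]
    linarith

/-! ### The first order system -/

/-- Pairs `(y, y^[1])` of continuous functions on `[0, π]`. -/
abbrev CI2 : Type := CI × CI

variable {u : ℝ → ℂ}

lemma MemL2.sq_integrable (hu : MemL2 u) :
    IntervalIntegrable (fun x => u x ^ 2) volume 0 Real.pi := by
  simpa [sq] using hu.mul_integrable hu

lemma one_integrable : IntervalIntegrable (fun _ => (1 : ℂ)) volume 0 Real.pi :=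
  intervalIntegrable_const

/-- The integral operator of the system `y' = y^[1] + u y`, `(y^[1])' = -u y^[1] - u² y`. -/
def volt (hu : MemL2 u) : CI2 →L[ℂ] CI2 :=
  ((intOp _ one_integrable).comp (ContinuousLinearMap.snd ℂ CI CI)
    + (intOp _ hu.intervalIntegrable).comp (ContinuousLinearMap.fst ℂ CI CI)).prod
  (-((intOp _ hu.intervalIntegrable).comp (ContinuousLinearMap.snd ℂ CI CI)
    + (intOp _ hu.sq_integrable).comp (ContinuousLinearMap.fst ℂ CI CI)))

/-- The operator `(y, y^[1]) ↦ (0, -∫₀^x y)`. -/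
def spec : CI2 →L[ℂ] CI2 :=
  (0 : CI2 →L[ℂ] CI).prod (-((intOp _ one_integrable).comp (ContinuousLinearMap.fst ℂ CI CI)))

/-- The operator `1 - V - z J` of the system `l(y) = z y` in integral form. -/
def sysOp (hu : MemL2 u) (z : ℂ) : CI2 →L[ℂ] CI2 := 1 - volt hu - z • spec

lemma volt_apply (hu : MemL2 u) (Y : CI2) : volt hu Y
    = (intOp _ one_integrable Y.2 + intOp _ hu.intervalIntegrable Y.1,
      -(intOp _ hu.intervalIntegrable Y.2 + intOp _ hu.sq_integrable Y.1)) := rfl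

lemma spec_apply (Y : CI2) : spec Y = (0, -intOp _ one_integrable Y.1) := rfl

lemma sysOp_apply (hu : MemL2 u) (z : ℂ) (Y : CI2) :
    sysOp hu z Y = Y - volt hu Y - z • spec Y := rfl

lemma smul_spec_apply (z : ℂ) (Y : CI2) : z • spec Y = (0, -(z • intOp _ one_integrable Y.1)) := by
  refine Prod.ext ?_ ?_
  · ext x; simp [spec_apply]
  · ext x; simp [spec_apply]

lemma sysOp_apply_fst (hu : MemL2 u) (z : ℂ) (Y : CI2) :
    (sysOp hu z Y).1 = Y.1 - (intOp _ one_integrable Y.2 + intOp _ hu.intervalIntegrable Y.1) := by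
  rw [sysOp_apply, smul_spec_apply, volt_apply]
  exact sub_zero _

lemma sysOp_apply_snd (hu : MemL2 u) (z : ℂ) (Y : CI2) :
    (sysOp hu z Y).2 = Y.2 + (intOp _ hu.intervalIntegrable Y.2 + intOp _ hu.sq_integrable Y.1)
      + z • intOp _ one_integrable Y.1 := by
  rw [sysOp_apply, smul_spec_apply, volt_apply]
  simp only [Prod.snd_sub, sub_neg_eq_add]

/-- An initial value problem has no spectrum: conjugation by `e^{κx}` with `κ` large brings the
Volterra part to norm at most `1/2`, and the Neumann series converges. -/
lemma isUnit_sysOp (hu : MemL2 u) (z : ℂ) : IsUnit (sysOp hu z) := by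
  -- The second component of `W` collects three weighted integrals, the first only two; `3/8` is
  -- below `1/2`.
  have h8 : (0 : ℝ) < 1 / 8 := by norm_num
  obtain ⟨κ₁, h1⟩ := exists_weighted_intOp_le _ one_integrable h8
  obtain ⟨κ₂, h2⟩ := exists_weighted_intOp_le _ hu.intervalIntegrable h8
  obtain ⟨κ₃, h3⟩ := exists_weighted_intOp_le _ hu.sq_integrable h8
  obtain ⟨κ₄, h4⟩ := exists_weighted_intOp_le _ (one_integrable.const_mul z) h8
  set κ := max (max κ₁ κ₂) (max κ₃ κ₄) with hκ
  replace h1 := h1 κ (by simp [hκ])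
  replace h2 := h2 κ (by simp [hκ])
  replace h3 := h3 κ (by simp [hκ])
  replace h4 := h4 κ (by simp [hκ])
  set M : CI2 →L[ℂ] CI2 := (expMul κ).prodMap (expMul κ) with hM
  set M' : CI2 →L[ℂ] CI2 := (expMul (-κ)).prodMap (expMul (-κ)) with hM'
  have hMM' : M * M' = 1 := by
    refine ContinuousLinearMap.ext fun Y => ?_
    exact Prod.ext (expMul_comp_neg κ Y.1) (expMul_comp_neg κ Y.2)
  have hM'M : M' * M = 1 := by
    refine ContinuousLinearMap.ext fun Y => ?_
    have := fun φ => expMul_comp_neg (-κ) φ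
    simp only [neg_neg] at this
    exact Prod.ext (this Y.1) (this Y.2)
  set W := M' * (volt hu + z • spec) * M with hW
  have hz : ∀ φ, z • intOp _ one_integrable φ = intOp _ (one_integrable.const_mul z) φ := by
    intro φ
    ext x
    simp only [ContinuousMap.smul_apply, intOp_apply, smul_eq_mul,
      ← intervalIntegral.integral_const_mul]
    refine intervalIntegral.integral_congr fun t _ => ?_
    ring
  have hWn : ‖W‖ ≤ 1 / 2 := by
    refine ContinuousLinearMap.opNorm_le_bound _ (by norm_num) fun Y => ?_
    have e1 : (W Y).1 = expMul (-κ) (intOp _ one_integrable (expMul κ Y.2))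
        + expMul (-κ) (intOp _ hu.intervalIntegrable (expMul κ Y.1)) := by
      have : (W Y).1 = expMul (-κ) ((volt hu (M Y)).1 + (z • spec (M Y)).1) := rfl
      rw [this, volt_apply, smul_spec_apply]
      simp only [add_zero, map_add]
      rfl
    have e2 : (W Y).2 = -(expMul (-κ) (intOp _ hu.intervalIntegrable (expMul κ Y.2))
        + expMul (-κ) (intOp _ hu.sq_integrable (expMul κ Y.1))
        + expMul (-κ) (intOp _ (one_integrable.const_mul z) (expMul κ Y.1))) := by
      have : (W Y).2 = expMul (-κ) ((volt hu (M Y)).2 + (z • spec (M Y)).2) := rfl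
      rw [this, volt_apply, smul_spec_apply, ← neg_add, hz, map_neg, map_add, map_add]
      rfl
    have n1 : ‖Y.1‖ ≤ ‖Y‖ := norm_fst_le Y
    have n2 : ‖Y.2‖ ≤ ‖Y‖ := norm_snd_le Y
    refine max_le ?_ ?_
    · rw [e1]
      refine (norm_add_le _ _).trans ?_
      linarith [h1 Y.2, h2 Y.1, norm_nonneg Y]
    · rw [e2, norm_neg]
      refine (norm_add₃_le).trans ?_
      linarith [h2 Y.2, h3 Y.1, h4 Y.1, norm_nonneg Y]
  have hW1 : ‖W‖ < 1 := lt_of_le_of_lt hWn (by norm_num)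
  have hu1 : IsUnit (1 - W) := isUnit_one_sub_of_norm_lt_one (R := CI2 →L[ℂ] CI2) hW1
  have hMu : IsUnit M := ⟨⟨M, M', hMM', hM'M⟩, rfl⟩
  have hMu' : IsUnit M' := ⟨⟨M', M, hM'M, hMM'⟩, rfl⟩
  have : sysOp hu z = M * (1 - W) * M' := by
    refine ContinuousLinearMap.ext fun Y => ?_
    have hYY : M (M' Y) = Y := congrArg (fun T : CI2 →L[ℂ] CI2 => T Y) hMM'
    have e : (M * (1 - W) * M') Y = M (M' Y - M' (volt hu (M (M' Y)) + z • spec (M (M' Y)))) := rfl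
    have hYT : ∀ V : CI2, M (M' V) = V := fun V => congrArg (fun T : CI2 →L[ℂ] CI2 => T V) hMM'
    rw [e, hYY, map_sub, hYT, hYT, sysOp_apply, sub_sub]
  rw [this]
  exact (hMu.mul hu1).mul hMu'

/-- The inverse of the operator of the system. -/
def solOp (hu : MemL2 u) (z : ℂ) : CI2 →L[ℂ] CI2 := Ring.inverse (sysOp hu z)

lemma sysOp_solOp (hu : MemL2 u) (z : ℂ) (Y : CI2) : sysOp hu z (solOp hu z Y) = Y := by
  have := Ring.mul_inverse_cancel _ (isUnit_sysOp hu z)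
  exact congrArg (fun T : CI2 →L[ℂ] CI2 => T Y) this

lemma solOp_sysOp (hu : MemL2 u) (z : ℂ) (Y : CI2) : solOp hu z (sysOp hu z Y) = Y := by
  have := Ring.inverse_mul_cancel _ (isUnit_sysOp hu z)
  exact congrArg (fun T : CI2 →L[ℂ] CI2 => T Y) this

lemma differentiable_inverse_pencil {E : Type*} [NormedAddCommGroup E] [NormedSpace ℂ E]
    [CompleteSpace E] (A B : E →L[ℂ] E) (h : ∀ z : ℂ, IsUnit (A - z • B)) :
    Differentiable ℂ (fun z : ℂ => Ring.inverse (A - z • B)) := by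
  intro z
  have h2 : DifferentiableAt ℂ (fun z : ℂ => A - z • B) z := by fun_prop
  exact (differentiableAt_inverse (h z)).comp z h2

lemma differentiable_solOp (hu : MemL2 u) : Differentiable ℂ (solOp hu) :=
  differentiable_inverse_pencil (1 - volt hu) spec (isUnit_sysOp hu)

/-- Data of the integral equation: initial values `a`, `b` and right hand side `h`. -/
def initData (a b : ℂ) (h : ℝ → ℂ) (hh : IntervalIntegrable h volume 0 Real.pi) : CI2 :=
  (ContinuousMap.const _ a, ContinuousMap.const _ b - intOp h hh 1)

/-- `(y, y^[1])` for the solution of `l(y) = z y + h` with `y(0) = a`, `y^[1](0) = b`. -/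
def sol (hu : MemL2 u) (z a b : ℂ) (h : ℝ → ℂ) (hh : IntervalIntegrable h volume 0 Real.pi) : CI2 :=
  solOp hu z (initData a b h hh)

lemma intOp_one_apply (h : ℝ → ℂ) (hh : IntervalIntegrable h volume 0 Real.pi)
    (x : Icc (0 : ℝ) Real.pi) : intOp h hh 1 x = ∫ t in (0 : ℝ)..x, h t := by
  rw [intOp_apply]
  refine intervalIntegral.integral_congr fun t _ => ?_
  simp [ext, IccExtend]

/-- The operator equation is the integrated system itself. With the converse `QuasiDiff.sysOp_eq`,
existence and uniqueness for the initial value problem become the invertibility of `sysOp`. -/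
lemma quasiDiff_of_sysOp (hu : MemL2 u) {z a b : ℂ} {h : ℝ → ℂ}
    (hh : IntervalIntegrable h volume 0 Real.pi) {Y : CI2}
    (hY : sysOp hu z Y = initData a b h hh) :
    ext Y.1 0 = a ∧ ext Y.2 0 = b ∧
      QuasiDiff u (ext Y.1) (ext Y.2) (fun x => z * ext Y.1 x + h x) := by
  have E1 : ∀ x : Icc (0 : ℝ) Real.pi, Y.1 x
      = a + ∫ t in (0 : ℝ)..x, (ext Y.2 t + u t * ext Y.1 t) := by
    intro x
    have := congrArg (fun W : CI2 => W.1 x) hY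
    simp only [sysOp_apply_fst, initData, ContinuousMap.sub_apply, ContinuousMap.add_apply,
      intOp_apply, ContinuousMap.const_apply] at this
    rw [intervalIntegral.integral_add ((continuous_ext _).intervalIntegrable _ _)
      ((IntervalIntegrable.sub_I hu.intervalIntegrable x.2).mul_continuousOn (continuous_ext _).continuousOn)]
    simp only [one_mul] at this
    linear_combination this
  have E2 : ∀ x : Icc (0 : ℝ) Real.pi, Y.2 x
      = b - ∫ t in (0 : ℝ)..x, (u t * ext Y.2 t + u t ^ 2 * ext Y.1 t + (z * ext Y.1 t + h t)) := by
    intro x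
    have := congrArg (fun W : CI2 => W.2 x) hY
    simp only [sysOp_apply_snd, initData, ContinuousMap.sub_apply, ContinuousMap.add_apply,
      ContinuousMap.smul_apply, intOp_one_apply, ContinuousMap.const_apply] at this
    simp only [intOp_apply, smul_eq_mul, one_mul] at this
    have i1 := (IntervalIntegrable.sub_I hu.intervalIntegrable x.2).mul_continuousOn
      (continuous_ext Y.2).continuousOn
    have i2 := (IntervalIntegrable.sub_I hu.sq_integrable x.2).mul_continuousOn
      (continuous_ext Y.1).continuousOn
    have i3 : IntervalIntegrable (fun t => z * ext Y.1 t) volume 0 x :=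
      (continuous_const.mul (continuous_ext Y.1)).intervalIntegrable _ _
    have i4 := IntervalIntegrable.sub_I hh x.2
    rw [intervalIntegral.integral_add (i1.add i2) (i3.add i4), intervalIntegral.integral_add i1 i2,
      intervalIntegral.integral_add i3 i4, intervalIntegral.integral_const_mul]
    linear_combination this
  have a0 : ext Y.1 0 = a := by rw [ext_of_mem _ zero_mem_I, E1]; simp
  have b0 : ext Y.2 0 = b := by rw [ext_of_mem _ zero_mem_I, E2]; simp
  refine ⟨a0, b0, (continuous_ext _).continuousOn, (continuous_ext _).continuousOn,
    fun x hx => ?_, fun x hx => ?_⟩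
  · rw [a0, ext_of_mem _ hx, E1]
  · rw [b0, ext_of_mem _ hx, E2]

lemma QuasiDiff.sysOp_eq (hu : MemL2 u) {y y₁ : ℝ → ℂ} {z : ℂ} {h : ℝ → ℂ}
    (hh : IntervalIntegrable h volume 0 Real.pi)
    (hq : QuasiDiff u y y₁ (fun x => z * y x + h x)) :
    sysOp hu z (res y hq.cont, res y₁ hq.cont₁) = initData (y 0) (y₁ 0) h hh := by
  have hc : ∀ {w : ℝ → ℂ} (hw : ContinuousOn w (Icc 0 Real.pi)) (k : ℝ → ℂ)
      (x : Icc (0 : ℝ) Real.pi), ∫ t in (0 : ℝ)..x, k t * ext (res w hw) t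
        = ∫ t in (0 : ℝ)..x, k t * w t := by
    intro w hw k x
    refine intervalIntegral.integral_congr fun t ht => ?_
    rw [uIcc_of_le x.2.1] at ht
    simp only [ext_res hw ⟨ht.1, ht.2.trans x.2.2⟩]
  have hc' : ∀ {w : ℝ → ℂ} (hw : ContinuousOn w (Icc 0 Real.pi)) (x : Icc (0 : ℝ) Real.pi),
      ∫ t in (0 : ℝ)..x, ext (res w hw) t = ∫ t in (0 : ℝ)..x, w t := by
    intro w hw x
    simpa using hc hw (fun _ => 1) x
  have hcI : ∀ {w : ℝ → ℂ} (hw : ContinuousOn w (Icc 0 Real.pi)) (x : Icc (0 : ℝ) Real.pi),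
      ContinuousOn w (uIcc 0 (x : ℝ)) := by
    intro w hw x
    rw [uIcc_of_le x.2.1]
    exact hw.mono (Icc_subset_Icc_right x.2.2)
  refine Prod.ext ?_ ?_
  · ext x
    have := hq.eq x x.2
    simp only [sysOp_apply_fst, initData, ContinuousMap.sub_apply, ContinuousMap.add_apply,
      intOp_apply, ContinuousMap.const_apply, res_apply, hc, one_mul, hc']
    rw [intervalIntegral.integral_add ((hcI hq.cont₁ x).intervalIntegrable)
      ((IntervalIntegrable.sub_I hu.intervalIntegrable x.2).mul_continuousOn (hcI hq.cont x))] at this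
    linear_combination this
  · ext x
    have := hq.eq₁ x x.2
    simp only [sysOp_apply_snd, initData, ContinuousMap.sub_apply, ContinuousMap.add_apply,
      ContinuousMap.smul_apply, intOp_one_apply, ContinuousMap.const_apply]
    simp only [intOp_apply, hc, res_apply, smul_eq_mul, one_mul, hc']
    have i1 := (IntervalIntegrable.sub_I hu.intervalIntegrable x.2).mul_continuousOn (hcI hq.cont₁ x)
    have i2 := (IntervalIntegrable.sub_I hu.sq_integrable x.2).mul_continuousOn (hcI hq.cont x)
    have i3 : IntervalIntegrable (fun t => z * y t) volume 0 x :=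
      ((hcI hq.cont x).intervalIntegrable).const_mul z
    have i4 := IntervalIntegrable.sub_I hh x.2
    rw [intervalIntegral.integral_add (i1.add i2) (i3.add i4), intervalIntegral.integral_add i1 i2,
      intervalIntegral.integral_add i3 i4, intervalIntegral.integral_const_mul] at this
    linear_combination this

/-- Uniqueness for the initial value problem. -/
lemma QuasiDiff.eq_sol (hu : MemL2 u) {y y₁ : ℝ → ℂ} {z : ℂ} {h : ℝ → ℂ}
    (hh : IntervalIntegrable h volume 0 Real.pi)
    (hq : QuasiDiff u y y₁ (fun x => z * y x + h x)) {x : ℝ} (hx : x ∈ Icc (0 : ℝ) Real.pi) :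
    y x = ext (sol hu z (y 0) (y₁ 0) h hh).1 x ∧ y₁ x = ext (sol hu z (y 0) (y₁ 0) h hh).2 x := by
  have : sol hu z (y 0) (y₁ 0) h hh = (res y hq.cont, res y₁ hq.cont₁) := by
    rw [sol, ← hq.sysOp_eq hu hh, solOp_sysOp]
  rw [this]
  exact ⟨(ext_res hq.cont hx).symm, (ext_res hq.cont₁ hx).symm⟩

lemma sol_spec (hu : MemL2 u) (z a b : ℂ) (h : ℝ → ℂ) (hh : IntervalIntegrable h volume 0 Real.pi) :
    ext (sol hu z a b h hh).1 0 = a ∧ ext (sol hu z a b h hh).2 0 = b ∧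
      QuasiDiff u (ext (sol hu z a b h hh).1) (ext (sol hu z a b h hh).2)
        (fun x => z * ext (sol hu z a b h hh).1 x + h x) :=
  quasiDiff_of_sysOp hu hh (sysOp_solOp hu z _)

/-! ### The equation in the sine basis -/

variable {u : ℝ → ℂ}

/-- Matrix of the potential in the sine basis, `-∫ u d(e_j e_k)`. -/
def qmat (u : ℝ → ℂ) (j k : ℕ) : ℂ :=
  -∫ x in (0 : ℝ)..Real.pi, u x * (j * cosFun j x * sinFun k x + sinFun j x * (k * cosFun k x))

/-- The factor `k` annihilates the exceptional constant `cosFun 0`, so one formula covers every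
index. -/
lemma mul_cosFun (k : ℕ) (x : ℝ) :
    (k : ℂ) * cosFun k x = ((k * (Real.sqrt (2 / Real.pi) * Real.cos (k * x)) : ℝ) : ℂ) := by
  rcases eq_or_ne k 0 with rfl | hk
  · simp
  · simp [cosFun, hk]

lemma hasDerivAt_sinFun (k : ℕ) (x : ℝ) : HasDerivAt (sinFun k) (k * cosFun k x) x := by
  rw [mul_cosFun]
  have h : HasDerivAt (fun x : ℝ => Real.sqrt (2 / Real.pi) * Real.sin (k * x))
      (k * (Real.sqrt (2 / Real.pi) * Real.cos (k * x))) x := by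
    have := ((hasDerivAt_id x).const_mul (k : ℝ)).sin.const_mul (Real.sqrt (2 / Real.pi))
    simp only [id_eq, mul_one] at this
    convert! this using 1; ring
  exact h.ofReal_comp

lemma hasDerivAt_cosFun (k : ℕ) (x : ℝ) : HasDerivAt (cosFun k) (-(k * sinFun k x)) x := by
  rcases eq_or_ne k 0 with rfl | hk
  · have e : cosFun 0 = fun _ => (((Real.sqrt Real.pi)⁻¹ : ℝ) : ℂ) := by funext x; simp [cosFun]
    rw [e]
    simpa using hasDerivAt_const x (((Real.sqrt Real.pi)⁻¹ : ℝ) : ℂ)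
  have h : HasDerivAt (fun x : ℝ => Real.sqrt (2 / Real.pi) * Real.cos (k * x))
      (-(k * (Real.sqrt (2 / Real.pi) * Real.sin (k * x)))) x := by
    have := ((hasDerivAt_id x).const_mul (k : ℝ)).cos.const_mul (Real.sqrt (2 / Real.pi))
    simp only [id_eq, mul_one] at this
    convert! this using 1; ring
  have e : cosFun k = fun x : ℝ => ((Real.sqrt (2 / Real.pi) * Real.cos (k * x) : ℝ) : ℂ) := by
    funext x; simp [cosFun, hk]
  rw [e, show -((k : ℂ) * sinFun k x)
    = ((-(k * (Real.sqrt (2 / Real.pi) * Real.sin (k * x))) : ℝ) : ℂ) by simp [sinFun]]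
  exact h.ofReal_comp

lemma sinFun_zero (k : ℕ) : sinFun k 0 = 0 := by simp [sinFun]

lemma sinFun_pi (k : ℕ) : sinFun k Real.pi = 0 := by simp [sinFun, Real.sin_nat_mul_pi]

lemma conj_sinFun (k : ℕ) (x : ℝ) : (starRingEnd ℂ) (sinFun k x) = sinFun k x :=
  Complex.conj_ofReal _

lemma conj_cosFun (k : ℕ) (x : ℝ) : (starRingEnd ℂ) (cosFun k x) = cosFun k x := by
  unfold cosFun; split_ifs <;> exact Complex.conj_ofReal _

lemma sinFun_integral (k : ℕ) (x : ℝ) :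
    sinFun k x = sinFun k 0 + ∫ t in (0 : ℝ)..x, k * cosFun k t := by
  rw [intervalIntegral.integral_eq_sub_of_hasDerivAt (fun t _ => hasDerivAt_sinFun k t)
    ((continuous_const.mul (continuous_cosFun k)).intervalIntegrable _ _)]
  ring

lemma cosFun_integral (k : ℕ) (x : ℝ) :
    cosFun k x = cosFun k 0 + ∫ t in (0 : ℝ)..x, -(k * sinFun k t) := by
  rw [intervalIntegral.integral_eq_sub_of_hasDerivAt (fun t _ => hasDerivAt_cosFun k t)
    ((continuous_const.mul (continuous_sinFun k)).neg.intervalIntegrable _ _)]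
  ring

lemma norm_sinFun_le (k : ℕ) (x : ℝ) : ‖sinFun k x‖ ≤ 1 := by
  rw [sinFun, Complex.norm_real, Real.norm_eq_abs, abs_mul, abs_of_nonneg (Real.sqrt_nonneg _)]
  have h1 : Real.sqrt (2 / Real.pi) ≤ 1 := by
    exact Real.sqrt_le_one.2 ((div_le_one Real.pi_pos).2 Real.two_le_pi)
  have h2 := Real.abs_sin_le_one (k * x)
  have := mul_le_mul h1 h2 (abs_nonneg _) zero_le_one
  simpa using this

lemma sineCoeff_zero (f : ℝ → ℂ) : sineCoeff f 0 = 0 := by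
  simp [sineCoeff, inn]

lemma QuasiDiff.memL2_deriv (hu : MemL2 u) {y y₁ g : ℝ → ℂ} (hq : QuasiDiff u y y₁ g) :
    MemL2 (fun x => y₁ x + u x * y x) :=
  (memL2_of_continuousOn hq.cont₁).add (hu.mul_continuousOn hq.cont)

/-- Integration by parts, with boundary terms removed by the Dirichlet conditions. The derivative
`y' = y^[1] + u y` is in `L₂`, so the numbers `k y_k` are square summable. -/
lemma QuasiDiff.inn_deriv_cosFun (hu : MemL2 u) {y y₁ g : ℝ → ℂ} (hq : QuasiDiff u y y₁ g)
    (h0 : y 0 = 0) (hpi : y Real.pi = 0) (k : ℕ) :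
    inn (fun x => y₁ x + u x * y x) (cosFun k) = k * sineCoeff y k := by
  have hD := (hq.memL2_deriv hu).intervalIntegrable
  have hs : IntervalIntegrable (fun t => -((k : ℂ) * sinFun k t)) volume 0 Real.pi :=
    (continuous_const.mul (continuous_sinFun k)).neg.intervalIntegrable _ _
  have h := integral_mul_add_mul_indefinite (F := y) (G := cosFun k) hD hs Real.pi_pos.le
    hq.eq (fun x _ => cosFun_integral k x)
  rw [h0, hpi, zero_mul, zero_mul, sub_zero, intervalIntegral.integral_add] at h
  · rw [sineCoeff_eq, inn, inn, ← intervalIntegral.integral_const_mul]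
    simp only [conj_cosFun, conj_sinFun]
    have e : ∫ x in (0 : ℝ)..Real.pi, (k : ℂ) * (y x * sinFun k x)
        = -∫ x in (0 : ℝ)..Real.pi, y x * -(k * sinFun k x) := by
      rw [← intervalIntegral.integral_neg]
      refine intervalIntegral.integral_congr fun x _ => ?_
      ring
    rw [e]
    linear_combination h
  · exact hD.mul_continuousOn (continuous_cosFun k).continuousOn
  · refine hs.continuousOn_mul ?_
    rw [uIcc_of_le Real.pi_pos.le]; exact hq.cont

lemma QuasiDiff.summable_sq (hu : MemL2 u) {y y₁ g : ℝ → ℂ} (hq : QuasiDiff u y y₁ g)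
    (h0 : y 0 = 0) (hpi : y Real.pi = 0) :
    Summable (fun k : ℕ => ((k : ℝ) * ‖sineCoeff y k‖) ^ 2) := by
  have := (hasSum_sq_cos (hq.memL2_deriv hu)).summable
  refine this.congr fun k => ?_
  rw [hq.inn_deriv_cosFun hu h0 hpi, norm_mul, Complex.norm_natCast]

/-- The inequality of means bounds `|y_k|` by `(k |y_k|)² + k⁻²`, both summable. -/
lemma QuasiDiff.summable_coeff (hu : MemL2 u) {y y₁ g : ℝ → ℂ} (hq : QuasiDiff u y y₁ g)
    (h0 : y 0 = 0) (hpi : y Real.pi = 0) : Summable (fun k : ℕ => ‖sineCoeff y k‖) := by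
  have h1 := hq.summable_sq hu h0 hpi
  have h2 : Summable (fun k : ℕ => 1 / (k : ℝ) ^ 2) := Real.summable_one_div_nat_pow.2 (by norm_num)
  refine (h1.add h2).of_nonneg_of_le (fun _ => norm_nonneg _) fun k => ?_
  rcases eq_or_ne k 0 with rfl | hk
  · simp [sineCoeff_zero]
  · have hk' : (0 : ℝ) < k := by exact_mod_cast Nat.pos_of_ne_zero hk
    have e : ‖sineCoeff y k‖ = (k * ‖sineCoeff y k‖) * (1 / k) := by field_simp
    have : 1 / (k : ℝ) ^ 2 = (1 / k) ^ 2 := by ring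
    rw [this]
    nlinarith [sq_nonneg (k * ‖sineCoeff y k‖ - 1 / k), sq_nonneg (k * ‖sineCoeff y k‖ + 1 / k),
      sq_nonneg (k * ‖sineCoeff y k‖), sq_nonneg (1 / (k : ℝ))]

/-- A function of the form domain is the pointwise sum of its sine series. -/
lemma QuasiDiff.hasSum_sine (hu : MemL2 u) {y y₁ g : ℝ → ℂ} (hq : QuasiDiff u y y₁ g)
    (h0 : y 0 = 0) (hpi : y Real.pi = 0) {x : ℝ} (hx : x ∈ Icc (0 : ℝ) Real.pi) :
    HasSum (fun j => sineCoeff y j * sinFun j x) (y x) := by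
  have hD := hq.memL2_deriv hu
  set D : ℝ → ℂ := fun x => y₁ x + u x * y x with hDdef
  -- Parseval in the cosine basis for `y'` against the indicator of `[0, x]`: the pairing is `∫₀^x
  -- y' = y(x)`, and the cosines integrate to sines.
  set χ : ℝ → ℂ := (Iic x).indicator 1 with hχ
  have hχm : MemL2 χ := by
    have : MemL2 (1 : ℝ → ℂ) := memL2_of_continuousOn continuous_one.continuousOn
    exact MemLp.indicator measurableSet_Iic this
  have hprod : ∀ f : ℝ → ℂ, inn f χ = ∫ t in (0 : ℝ)..x, f t := by
    intro f
    have : (fun t => f t * (starRingEnd ℂ) (χ t)) = (Iic x).indicator f := by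
      funext t
      simp only [hχ, indicator]
      split_ifs <;> simp
    rw [inn, this, intervalIntegral.integral_of_le Real.pi_pos.le,
      intervalIntegral.integral_of_le hx.1, integral_indicator measurableSet_Iic,
      Measure.restrict_restrict measurableSet_Iic]
    congr 2
    ext t
    simp only [mem_inter_iff, mem_Iic, mem_Ioc]
    exact ⟨fun h => ⟨h.2.1, h.1⟩, fun h => ⟨h.2, h.1, h.2.trans hx.2⟩⟩
  have h := hasSum_inn_cos hD hχm
  have e : inn D χ = y x := by rw [hprod, hq.eq x hx, h0, zero_add]
  rw [e] at h
  convert! h using 1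
  funext j
  rw [hq.inn_deriv_cosFun hu h0 hpi, hprod]
  have := sinFun_integral j x
  rw [sinFun_zero, zero_add, intervalIntegral.integral_const_mul] at this
  rw [this]; ring

/-- The equation `l(y) = g` in the sine basis. -/
lemma QuasiDiff.weak (hu : MemL2 u) {y y₁ g : ℝ → ℂ} (hq : QuasiDiff u y y₁ g) (hg : MemL2 g)
    (h0 : y 0 = 0) (hpi : y Real.pi = 0) (k : ℕ) :
    HasSum (fun j => sineCoeff y j * qmat u j k) (sineCoeff g k - k ^ 2 * sineCoeff y k) := by
  have hD := hq.memL2_deriv hu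
  set D : ℝ → ℂ := fun x => y₁ x + u x * y x with hDdef
  have cy : ContinuousOn y (uIcc 0 Real.pi) := by rw [uIcc_of_le Real.pi_pos.le]; exact hq.cont
  have cy1 : ContinuousOn y₁ (uIcc 0 Real.pi) := by rw [uIcc_of_le Real.pi_pos.le]; exact hq.cont₁
  have cs : ∀ k : ℕ, Continuous (fun x => (k : ℂ) * cosFun k x) := fun k =>
    continuous_const.mul (continuous_cosFun k)
  have iu := hu.intervalIntegrable
  have ig := hg.intervalIntegrable
  have ih : IntervalIntegrable (fun t => -(u t * y₁ t + u t ^ 2 * y t + g t)) volume 0 Real.pi :=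
    (((iu.mul_continuousOn cy1).add (hu.sq_integrable.mul_continuousOn cy)).add ig).neg
  have ic : IntervalIntegrable (fun t => (k : ℂ) * cosFun k t) volume 0 Real.pi :=
    (cs k).intervalIntegrable _ _
  -- The second equation of the system is tested against `sinFun k`, which vanishes at both ends.
  have hparts := integral_mul_add_mul_indefinite (F := y₁) (G := sinFun k) ih ic Real.pi_pos.le
    (fun x hx => by
      rw [hq.eq₁ x hx, intervalIntegral.integral_neg, sub_eq_add_neg]) (fun x _ => sinFun_integral k x)
  rw [sinFun_zero, sinFun_pi, mul_zero, mul_zero, sub_zero] at hparts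
  -- integrals of the separate terms
  have iuD : IntervalIntegrable (fun x => u x * sinFun k x * D x) volume 0 Real.pi :=
    (hu.mul_continuousOn (continuous_sinFun k).continuousOn).mul_integrable hD
  have iDc : IntervalIntegrable (fun x => D x * (k * cosFun k x)) volume 0 Real.pi :=
    hD.intervalIntegrable.mul_continuousOn (cs k).continuousOn
  have iuy : IntervalIntegrable (fun x => u x * y x * (k * cosFun k x)) volume 0 Real.pi :=
    (iu.mul_continuousOn cy).mul_continuousOn (cs k).continuousOn
  have igs : IntervalIntegrable (fun x => g x * sinFun k x) volume 0 Real.pi :=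
    ig.mul_continuousOn (continuous_sinFun k).continuousOn
  have e1 : (∫ x in (0 : ℝ)..Real.pi, (D x * (k * cosFun k x)))
      - (∫ x in (0 : ℝ)..Real.pi, u x * y x * (k * cosFun k x))
      - (∫ x in (0 : ℝ)..Real.pi, u x * sinFun k x * D x)
      - (∫ x in (0 : ℝ)..Real.pi, g x * sinFun k x) = 0 := by
    rw [← hparts, ← intervalIntegral.integral_sub iDc iuy, ← intervalIntegral.integral_sub
      (iDc.sub iuy) iuD, ← intervalIntegral.integral_sub ((iDc.sub iuy).sub iuD) igs]
    refine intervalIntegral.integral_congr fun x _ => ?_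
    simp only [hDdef]; ring
  have e2 : ∫ x in (0 : ℝ)..Real.pi, (D x * (k * cosFun k x)) = k ^ 2 * sineCoeff y k := by
    have := hq.inn_deriv_cosFun hu h0 hpi k
    rw [inn] at this
    simp only [conj_cosFun] at this
    have h' : ∫ x in (0 : ℝ)..Real.pi, (D x * (k * cosFun k x))
        = k * ∫ x in (0 : ℝ)..Real.pi, (y₁ x + u x * y x) * cosFun k x := by
      rw [← intervalIntegral.integral_const_mul]
      refine intervalIntegral.integral_congr fun x _ => ?_
      simp only [hDdef]; ring
    rw [h', this]; ring
  have e3 : ∫ x in (0 : ℝ)..Real.pi, g x * sinFun k x = sineCoeff g k := by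
    rw [sineCoeff_eq, inn]; simp only [conj_sinFun]
  -- the two series
  have hw : MemL2 (fun x => (starRingEnd ℂ) (u x * sinFun k x)) :=
    (hu.mul_continuousOn (continuous_sinFun k).continuousOn).star
  have S1 := hasSum_inn_cos hD hw
  have e4 : inn D (fun x => (starRingEnd ℂ) (u x * sinFun k x))
      = ∫ x in (0 : ℝ)..Real.pi, u x * sinFun k x * D x := by
    rw [inn]
    refine intervalIntegral.integral_congr fun x _ => ?_
    simp only [Complex.conj_conj]; ring
  rw [e4] at S1
  have hterm : ∀ j : ℕ, IntervalIntegrable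
      (fun x => u x * (sinFun j x * (k * cosFun k x))) volume 0 Real.pi := fun j =>
    iu.mul_continuousOn ((continuous_sinFun j).mul (cs k)).continuousOn
  -- The series of `y'` is handled by Parseval above. Here the absolutely convergent sine series of
  -- `y` is integrated term by term, dominated by `|y_j| ‖u e_k'‖`.
  have S2 : HasSum (fun j => sineCoeff y j * ∫ x in (0 : ℝ)..Real.pi,
      u x * (sinFun j x * (k * cosFun k x)))
      (∫ x in (0 : ℝ)..Real.pi, u x * y x * (k * cosFun k x)) := by
    have hcn : IntervalIntegrable (fun x => ‖u x * (k * cosFun k x)‖) volume 0 Real.pi :=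
      (iu.mul_continuousOn (cs k).continuousOn).norm
    have := intervalIntegral.hasSum_integral_of_dominated_convergence (μ := volume) (a := 0)
      (b := Real.pi) (F := fun j x => sineCoeff y j * (u x * (sinFun j x * (k * cosFun k x))))
      (f := fun x => u x * y x * (k * cosFun k x))
      (fun j x => ‖sineCoeff y j‖ * ‖u x * (k * cosFun k x)‖)
      (fun j => ((hterm j).const_mul _).aestronglyMeasurable_restrict_uIoc)
      (fun j => Eventually.of_forall fun x _ => by
        rw [norm_mul]
        refine mul_le_mul_of_nonneg_left ?_ (norm_nonneg _)
        rw [show u x * (sinFun j x * (k * cosFun k x)) = sinFun j x * (u x * (k * cosFun k x)) by ring,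
          norm_mul]
        exact mul_le_of_le_one_left (norm_nonneg _) (norm_sinFun_le j x))
      (Eventually.of_forall fun x _ => (hq.summable_coeff hu h0 hpi).mul_right _)
      (by
        simp only [tsum_mul_right]
        exact hcn.const_mul _)
      (Eventually.of_forall fun x hx => by
        rw [uIoc_of_le Real.pi_pos.le] at hx
        have := (hq.hasSum_sine hu h0 hpi (x := x) ⟨hx.1.le, hx.2⟩).mul_right
          (u x * (k * cosFun k x))
        convert! this using 1
        · funext j; ring
        · ring)
    convert! this using 1
    funext j
    rw [intervalIntegral.integral_const_mul]
  have S := (S1.add S2).neg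
  convert! S using 1
  · funext j
    rw [hq.inn_deriv_cosFun hu h0 hpi, inn, qmat]
    have hc1 : IntervalIntegrable (fun x => u x * (j * cosFun j x * sinFun k x)) volume 0 Real.pi :=
      iu.mul_continuousOn ((cs j).mul (continuous_sinFun k)).continuousOn
    have : ∫ x in (0 : ℝ)..Real.pi, u x * (j * cosFun j x * sinFun k x + sinFun j x * (k * cosFun k x))
        = (∫ x in (0 : ℝ)..Real.pi, u x * (j * cosFun j x * sinFun k x))
          + ∫ x in (0 : ℝ)..Real.pi, u x * (sinFun j x * (k * cosFun k x)) := by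
      rw [← intervalIntegral.integral_add hc1 (hterm j)]
      refine intervalIntegral.integral_congr fun x _ => ?_
      ring
    rw [this]
    have h6 : ∫ x in (0 : ℝ)..Real.pi, u x * (j * cosFun j x * sinFun k x)
        = j * ∫ x in (0 : ℝ)..Real.pi, cosFun j x * (starRingEnd ℂ) ((starRingEnd ℂ) (u x * sinFun k x)) := by
      rw [← intervalIntegral.integral_const_mul]
      refine intervalIntegral.integral_congr fun x _ => ?_
      simp only [Complex.conj_conj]; ring
    rw [h6]; ring
  · rw [e2, e3] at e1
    linear_combination -e1

/-- Bound of the matrix of the potential. -/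
lemma norm_qmat_le (hu : MemL2 u) (j k : ℕ) : ‖qmat u j k‖ ≤
    (Nat.dist j k : ℝ) * ‖sineCoeff u (Nat.dist j k)‖ + ((j + k : ℕ) : ℝ) * ‖sineCoeff u (j + k)‖ := by
  have hpi := Real.pi_pos
  set c : ℝ := Real.sqrt (2 / Real.pi) with hc
  have hc0 : 0 < c := Real.sqrt_pos.2 (by positivity)
  have hc1 : c ≤ 1 := by
    exact Real.sqrt_le_one.2 ((div_le_one hpi).2 Real.two_le_pi)
  -- The product `e_j e_k` of sines is a combination of cosines of `(j - k) x` and `(j + k) x`, and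
  -- its derivative one of sines. As `n sin nx` is even in `n`, only `|j - k|` matters. The factor
  -- `c / 2 ≤ 1` is dropped at the end.
  have key : ∀ x : ℝ, (j : ℂ) * cosFun j x * sinFun k x + sinFun j x * (k * cosFun k x)
      = (c / 2 : ℝ) * (((j + k : ℕ) : ℝ) * sinFun (j + k) x
        - (Nat.dist j k : ℝ) * sinFun (Nat.dist j k) x) := by
    intro x
    rw [mul_cosFun, mul_cosFun]
    simp only [sinFun, ← hc]
    norm_cast
    have hd : ((Nat.dist j k : ℕ) : ℝ) * Real.sin (Nat.dist j k * x)
        = ((j : ℝ) - k) * Real.sin ((j - k) * x) := by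
      rcases le_total j k with h | h
      · rw [Nat.dist_eq_sub_of_le h, Nat.cast_sub h,
          show ((k : ℝ) - j) * x = -((j - k) * x) by ring, Real.sin_neg]
        ring
      · rw [Nat.dist_eq_sub_of_le_right h, Nat.cast_sub h]
    have hs : Real.sin (((j + k : ℕ) : ℝ) * x) = Real.sin (j * x) * Real.cos (k * x)
        + Real.cos (j * x) * Real.sin (k * x) := by
      rw [← Real.sin_add]; congr 1; push_cast; ring
    have hs2 : Real.sin (((j : ℝ) - k) * x) = Real.sin (j * x) * Real.cos (k * x)
        - Real.cos (j * x) * Real.sin (k * x) := by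
      rw [← Real.sin_sub]; congr 1; ring
    rw [hs2] at hd
    rw [hs]
    push_cast
    linear_combination (c ^ 2 / 2) * hd
  have hprod : ∀ n : ℕ, IntervalIntegrable (fun x => u x * sinFun n x) volume 0 Real.pi := fun n =>
    hu.intervalIntegrable.mul_continuousOn (continuous_sinFun n).continuousOn
  have hsc : ∀ n : ℕ, ∫ x in (0 : ℝ)..Real.pi, u x * sinFun n x = sineCoeff u n := by
    intro n; rw [sineCoeff_eq, inn]; simp only [conj_sinFun]
  have e : qmat u j k = (c / 2 : ℝ) * ((Nat.dist j k : ℝ) * sineCoeff u (Nat.dist j k)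
      - ((j + k : ℕ) : ℝ) * sineCoeff u (j + k)) := by
    rw [qmat]
    simp only [key]
    rw [← hsc, ← hsc, ← intervalIntegral.integral_const_mul, ← intervalIntegral.integral_const_mul,
      ← intervalIntegral.integral_sub ((hprod _).const_mul _) ((hprod _).const_mul _),
      ← intervalIntegral.integral_const_mul, ← intervalIntegral.integral_neg]
    refine intervalIntegral.integral_congr fun x _ => ?_
    ring
  rw [e, norm_mul, Complex.norm_real, Real.norm_of_nonneg (by positivity)]
  refine (mul_le_of_le_one_left (norm_nonneg _) (by linarith)).trans ?_
  refine (norm_sub_le _ _).trans ?_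
  simp only [norm_mul, Complex.norm_real, Real.norm_natCast]
  exact le_rfl

/-! ### Sums of nonnegative series -/

/-- The Cauchy–Schwarz inequality for series in `[0, ∞]`. -/
lemma ennreal_cauchy_schwarz {ι : Type*} (f g : ι → ℝ≥0∞) :
    (∑' i, f i * g i) ^ 2 ≤ (∑' i, f i ^ 2) * ∑' i, g i ^ 2 := by
  let _ : MeasurableSpace ι := ⊤
  have h := ENNReal.lintegral_mul_le_Lp_mul_Lq (Measure.count : Measure ι)
    (Real.HolderConjugate.two_two) (f := f) (g := g)
    (measurable_from_top).aemeasurable (measurable_from_top).aemeasurable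
  rw [lintegral_count, lintegral_count, lintegral_count] at h
  simp only [Pi.mul_apply, ENNReal.rpow_two] at h
  calc (∑' i, f i * g i) ^ 2 ≤ ((∑' i, f i ^ 2) ^ (1 / 2 : ℝ) * (∑' i, g i ^ 2) ^ (1 / 2 : ℝ)) ^ 2 := by
        gcongr
    _ = _ := by
        rw [mul_pow, ← ENNReal.rpow_natCast, ← ENNReal.rpow_natCast, ← ENNReal.rpow_mul,
          ← ENNReal.rpow_mul]
        norm_num

/-- The distances from `m + 1/2` to the natural numbers are the numbers `i + 1/2`, each taken at
most once on either side. -/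
lemma tsum_dist_half_le (φ : ℝ → ℝ≥0∞) (m : ℕ) :
    ∑' k : ℕ, φ |(k : ℝ) - (m + 1 / 2)| ≤ 2 * ∑' i : ℕ, φ (i + 1 / 2) := by
  have h0 := Summable.sum_add_tsum_nat_add' (f := fun k : ℕ => φ |(k : ℝ) - (m + 1 / 2)|)
    (k := m + 1) ENNReal.summable
  rw [← h0, two_mul]
  refine add_le_add ?_ ?_
  · rw [← Finset.sum_range_reflect]
    refine le_trans (le_of_eq (Finset.sum_congr rfl fun i hi => ?_)) (ENNReal.sum_le_tsum (Finset.range (m + 1)))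
    have hi' : i ≤ m := Nat.lt_succ_iff.1 (Finset.mem_range.1 hi)
    congr 1
    rw [show m + 1 - 1 - i = m - i by omega, Nat.cast_sub hi', abs_of_nonpos]
    · ring
    · have : (0 : ℝ) ≤ i := Nat.cast_nonneg i
      linarith
  · refine ENNReal.tsum_le_tsum fun i => le_of_eq ?_
    congr 1
    have : (0 : ℝ) ≤ i := Nat.cast_nonneg i
    push_cast
    rw [abs_of_nonneg (by linarith)]
    ring

/-- For fixed `j` a given distance is attained by at most two indices `k`. -/
lemma tsum_natDist_le (ψ : ℕ → ℝ≥0∞) (j : ℕ) :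
    ∑' k : ℕ, ψ (Nat.dist j k) ≤ 2 * ∑' n, ψ n := by
  have h0 := Summable.sum_add_tsum_nat_add' (f := fun k : ℕ => ψ (Nat.dist j k))
    (k := j + 1) ENNReal.summable
  rw [← h0, two_mul]
  refine add_le_add ?_ ?_
  · rw [← Finset.sum_range_reflect]
    refine le_trans (le_of_eq (Finset.sum_congr rfl fun i hi => ?_)) (ENNReal.sum_le_tsum (Finset.range (j + 1)))
    have hi' : i ≤ j := Nat.lt_succ_iff.1 (Finset.mem_range.1 hi)
    congr 1
    rw [Nat.dist]; omega
  · refine le_trans (le_of_eq ?_) (ENNReal.tsum_comp_le_tsum_of_injective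
      (f := fun i : ℕ => i + 1) (fun a b h => by simpa using h) ψ)
    refine tsum_congr fun i => ?_
    congr 1
    rw [Nat.dist]; omega

lemma tsum_add_le (ψ : ℕ → ℝ≥0∞) (j : ℕ) : ∑' k : ℕ, ψ (j + k) ≤ ∑' n, ψ n :=
  ENNReal.tsum_comp_le_tsum_of_injective (f := fun i : ℕ => j + i) (fun a b h => by simpa using h) ψ

/-- A double series with a function of `|j - k|` and of `j + k`. -/
lemma tsum_tsum_kernel_le (ψ χ g : ℕ → ℝ≥0∞) :
    ∑' k, ∑' j, (ψ (Nat.dist j k) + χ (j + k)) * (g j + g k)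
      ≤ (4 * ∑' n, ψ n + 2 * ∑' n, χ n) * ∑' n, g n := by
  have h1 : ∑' k, ∑' j, (ψ (Nat.dist j k) + χ (j + k)) * g j
      ≤ (2 * ∑' n, ψ n + ∑' n, χ n) * ∑' n, g n := by
    rw [ENNReal.tsum_comm, ← ENNReal.tsum_mul_left]
    refine ENNReal.tsum_le_tsum fun j => ?_
    rw [ENNReal.tsum_mul_right]
    gcongr
    rw [ENNReal.tsum_add]
    exact add_le_add (tsum_natDist_le ψ j) (tsum_add_le χ j)
  have h2 : ∑' k, ∑' j, (ψ (Nat.dist j k) + χ (j + k)) * g k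
      ≤ (2 * ∑' n, ψ n + ∑' n, χ n) * ∑' n, g n := by
    rw [← ENNReal.tsum_mul_left]
    refine ENNReal.tsum_le_tsum fun k => ?_
    rw [ENNReal.tsum_mul_right]
    gcongr
    rw [ENNReal.tsum_add]
    refine add_le_add ?_ ?_
    · simpa only [Nat.dist_comm] using tsum_natDist_le ψ k
    · simpa only [Nat.add_comm] using tsum_add_le χ k
  simp only [mul_add, ENNReal.tsum_add]
  refine (add_le_add h1 h2).trans (le_of_eq ?_)
  ring

/-! ### Weights attached to a circle -/

/-- Size relations between the quantities attached to an index `j`: here `ρ⁴ = r`,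
`A⁴ = |j - r| + t`, `T⁴ = t + 1/2`, `γ⁴ = |j - r|`, `p = j + r` and `d = |j² - z|`. -/
structure WeightData (ρ T p γ A d : ℝ) : Prop where
  ρ_pos : 0 < ρ
  T_pos : 0 < T
  γ_pos : 0 < γ
  γ_le : γ ≤ A
  T_le : T ≤ A
  ρ_le : ρ ^ 4 ≤ p
  γ_le' : γ ^ 4 ≤ p
  A_le : A ^ 4 ≤ 2 * p
  p_le : p ≤ A ^ 4 + 2 * ρ ^ 4
  le_d : p * A ^ 4 ≤ 4 * d
  T_le' : T ≤ 2 * ρ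

namespace WeightData

variable {ρ T p γ A d p' γ' A' d' : ℝ}

lemma A_pos (h : WeightData ρ T p γ A d) : 0 < A := h.γ_pos.trans_le h.γ_le

lemma p_pos (h : WeightData ρ T p γ A d) : 0 < p := (pow_pos h.ρ_pos 4).trans_le h.ρ_le

lemma d_pos (h : WeightData ρ T p γ A d) : 0 < d := by
  have := mul_pos h.p_pos (pow_pos h.A_pos 4)
  linarith [h.le_d]

/-- The total power is shared between `ρ⁻³ = r^{-3/4}`, a gain as the circle grows, and `γ⁻⁵ = |j -
r|^{-5/4}`, summable over `j`. The weights are fourth roots so that these exponents become integers.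
-/
lemma inv_le (h : WeightData ρ T p γ A d) : 1 / (p * A ^ 4) ≤ 1 / ρ ^ 3 * (1 / γ ^ 5) := by
  have hρ := h.ρ_pos
  have hγ := h.γ_pos
  rw [one_div_mul_one_div]
  refine one_div_le_one_div_of_le (by positivity) ?_
  have h1 : γ ^ 4 ≤ A ^ 4 := pow_le_pow_left₀ hγ.le h.γ_le 4
  have h2 : ρ ^ 3 * γ ≤ p := by
    rcases le_total ρ γ with hle | hle
    · calc ρ ^ 3 * γ ≤ γ ^ 3 * γ := by gcongr
        _ = γ ^ 4 := by ring
        _ ≤ p := h.γ_le'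
    · calc ρ ^ 3 * γ ≤ ρ ^ 3 * ρ := by gcongr
        _ = ρ ^ 4 := by ring
        _ ≤ p := h.ρ_le
  calc ρ ^ 3 * γ ^ 5 = (ρ ^ 3 * γ) * γ ^ 4 := by ring
    _ ≤ p * A ^ 4 := mul_le_mul h2 h1 (by positivity) h.p_pos.le

/-- Of the eight factors `A`, three become `T`, which gives decay away from the positive half-axis,
and five become `γ` for summability. -/
lemma inv_pow_eight_le (h : WeightData ρ T p γ A d) : 1 / A ^ 8 ≤ 1 / T ^ 3 * (1 / γ ^ 5) := by
  have hT := h.T_pos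
  have hγ := h.γ_pos
  rw [one_div_mul_one_div]
  refine one_div_le_one_div_of_le (by positivity) ?_
  calc T ^ 3 * γ ^ 5 ≤ A ^ 3 * A ^ 5 := by
        have := h.A_pos
        gcongr
        · exact h.T_le
        · exact h.γ_le
    _ = A ^ 8 := by ring

lemma inv_pow_six_le (h : WeightData ρ T p γ A d) : 1 / A ^ 6 ≤ 1 / T * (1 / γ ^ 5) := by
  have hT := h.T_pos
  have hγ := h.γ_pos
  rw [one_div_mul_one_div]
  refine one_div_le_one_div_of_le (by positivity) ?_
  calc T * γ ^ 5 ≤ A * A ^ 5 := by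
        gcongr
        · exact h.A_pos.le
        · exact h.T_le
        · exact h.γ_le
    _ = A ^ 6 := by ring

lemma dd_ge (h : WeightData ρ T p γ A d) (h' : WeightData ρ T p' γ' A' d') :
    (p * A ^ 4) * (p' * A' ^ 4) ≤ 16 * (d * d') := by
  have := mul_le_mul h.le_d h'.le_d (mul_pos h'.p_pos (pow_pos h'.A_pos 4)).le
    (by linarith [h.d_pos])
  linarith

/-- By `A⁴ ≤ 2p` the left side is at most `4 (p A⁴ + p' A'⁴)`. This is the product `p A⁴ p' A'⁴ ≤ 16
d d'` times the sum of the inverses. -/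
lemma core_diff (h : WeightData ρ T p γ A d) (h' : WeightData ρ T p' γ' A' d') :
    (A ^ 4 + A' ^ 4) ^ 2 ≤ 64 * (d * d') * (1 / (p * A ^ 4) + 1 / (p' * A' ^ 4)) := by
  have hp := h.p_pos
  have hp' := h'.p_pos
  have hA0 := h.A_pos
  have hA0' := h'.A_pos
  have hA := pow_pos h.A_pos 4
  have hA' := pow_pos h'.A_pos 4
  have e : ((p * A ^ 4) * (p' * A' ^ 4)) * (1 / (p * A ^ 4) + 1 / (p' * A' ^ 4))
      = p' * A' ^ 4 + p * A ^ 4 := by field_simp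
  have hs : 0 ≤ 1 / (p * A ^ 4) + 1 / (p' * A' ^ 4) := by positivity
  have := mul_le_mul_of_nonneg_right (dd_ge h h') hs
  rw [e] at this
  have h1 := mul_le_mul_of_nonneg_right h.A_le hA.le
  have h2 := mul_le_mul_of_nonneg_right h'.A_le hA'.le
  nlinarith [sq_nonneg (A ^ 4 - A' ^ 4)]

/-- Since `p ≤ A⁴ + 2ρ⁴` and `ρ⁴ ≤ p'`, one has `p² ≤ p A⁴ + 2 p p'`. The mixed product yields the
term `1/(A⁴ A'⁴)`, which carries no decay in `ρ`; it is compensated by pairing it with a tail of the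
coefficients of `u`. -/
lemma core_sum (h : WeightData ρ T p γ A d) (h' : WeightData ρ T p' γ' A' d') :
    (p + p') ^ 2 ≤ 32 * (d * d') * (1 / (p * A ^ 4) + 1 / (p' * A' ^ 4)
      + 4 * (1 / (A ^ 4 * A' ^ 4))) := by
  have hp := h.p_pos
  have hp' := h'.p_pos
  have hA0 := h.A_pos
  have hA0' := h'.A_pos
  have hA := pow_pos h.A_pos 4
  have hA' := pow_pos h'.A_pos 4
  have e : ((p * A ^ 4) * (p' * A' ^ 4)) * (1 / (p * A ^ 4) + 1 / (p' * A' ^ 4)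
      + 4 * (1 / (A ^ 4 * A' ^ 4))) = p' * A' ^ 4 + p * A ^ 4 + 4 * (p * p') := by field_simp
  have hs : 0 ≤ 1 / (p * A ^ 4) + 1 / (p' * A' ^ 4) + 4 * (1 / (A ^ 4 * A' ^ 4)) := by positivity
  have := mul_le_mul_of_nonneg_right (dd_ge h h') hs
  rw [e] at this
  have h1 := mul_le_mul_of_nonneg_left h.p_le hp.le
  have h2 := mul_le_mul_of_nonneg_left h'.p_le hp'.le
  have h3 := mul_le_mul_of_nonneg_right h.ρ_le hp'.le
  have h4 := mul_le_mul_of_nonneg_right h'.ρ_le hp.le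
  nlinarith [sq_nonneg (p - p')]

/-- The basic bound of the square of a matrix entry. -/
lemma core (h : WeightData ρ T p γ A d) (h' : WeightData ρ T p' γ' A' d') {D S x y yb : ℝ}
    (hD0 : 0 ≤ D) (hS0 : 0 ≤ S) (hD : D ≤ A ^ 4 + A' ^ 4)
    (hS : S ≤ 2 * (A ^ 4 + A' ^ 4) ∨ (S ≤ p + p' ∧ yb = y)) :
    (D * x + S * y) ^ 2 ≤ 512 * (d * d') * ((1 / (p * A ^ 4) + 1 / (p' * A' ^ 4)) * (x ^ 2 + y ^ 2)
      + yb ^ 2 * (1 / (A ^ 4 * A' ^ 4))) := by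
  have hp := h.p_pos
  have hp' := h'.p_pos
  have hA := pow_pos h.A_pos 4
  have hA' := pow_pos h'.A_pos 4
  have hdd := mul_pos h.d_pos h'.d_pos
  set b := 1 / (p * A ^ 4) + 1 / (p' * A' ^ 4) with hb
  have hb0 : 0 ≤ b := by positivity
  set a := 1 / (A ^ 4 * A' ^ 4) with ha
  have ha0 : 0 ≤ a := by positivity
  have c1 := core_diff h h'
  have c2 := core_sum h h'
  rw [← hb] at c1 c2
  rw [← ha] at c2
  have hDx : (D * x) ^ 2 ≤ 64 * (d * d') * b * x ^ 2 := by
    rw [mul_pow]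
    exact mul_le_mul_of_nonneg_right ((pow_le_pow_left₀ hD0 hD 2).trans c1) (sq_nonneg _)
  have hsq : (D * x + S * y) ^ 2 ≤ 2 * (D * x) ^ 2 + 2 * (S * y) ^ 2 := by
    nlinarith [sq_nonneg (D * x - S * y)]
  have e0 : 0 ≤ d * d' * b * x ^ 2 := by positivity
  have e1 : 0 ≤ d * d' * b * y ^ 2 := by positivity
  have e2 : 0 ≤ d * d' * a * yb ^ 2 := by positivity
  -- If `S` is comparable with `A⁴ + A'⁴` the term with `yb` is not needed. Otherwise `core_sum` is
  -- used, and its mixed term is paid for by `yb`.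
  rcases hS with hS | ⟨hS, rfl⟩
  · have hSy : (S * y) ^ 2 ≤ 256 * (d * d') * b * y ^ 2 := by
      rw [mul_pow]
      refine mul_le_mul_of_nonneg_right ((pow_le_pow_left₀ hS0 hS 2).trans ?_) (sq_nonneg _)
      linarith
    linarith
  · have hSy : (S * yb) ^ 2 ≤ 32 * (d * d') * (b + 4 * a) * yb ^ 2 := by
      rw [mul_pow]
      exact mul_le_mul_of_nonneg_right ((pow_le_pow_left₀ hS0 hS 2).trans c2) (sq_nonneg _)
    linarith

/-- Replacing the product by a sum separates the indices, the form required by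
`tsum_tsum_kernel_le`. -/
lemma prod_inv_le (a b : ℝ) :
    1 / (a ^ 4 * b ^ 4) ≤ 1 / a ^ 8 + 1 / b ^ 8 := by
  have e : ∀ c : ℝ, 1 / c ^ 8 = (1 / c ^ 4) ^ 2 := fun c => by rw [div_pow, ← pow_mul, one_pow]
  rw [← one_div_mul_one_div, e, e]
  nlinarith [sq_nonneg (1 / a ^ 4 - 1 / b ^ 4), sq_nonneg (1 / a ^ 4), sq_nonneg (1 / b ^ 4)]

lemma prod_inv_le' {a b : ℝ} (ha : 0 < a) (hb : 0 < b) :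
    a ^ 2 * (1 / (a ^ 4 * b ^ 4)) ≤ 1 / a ^ 6 + 1 / b ^ 6 := by
  have e : a ^ 2 * (1 / (a ^ 4 * b ^ 4)) = 1 / (a ^ 2 * b ^ 4) := by field_simp
  rw [e]
  rcases le_total a b with h | h
  · refine le_add_of_le_of_nonneg (one_div_le_one_div_of_le (by positivity) ?_) (by positivity)
    calc a ^ 6 = a ^ 2 * a ^ 4 := by ring
      _ ≤ a ^ 2 * b ^ 4 := by gcongr
  · refine le_add_of_nonneg_of_le (by positivity) (one_div_le_one_div_of_le (by positivity) ?_)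
    calc b ^ 6 = b ^ 2 * b ^ 4 := by ring
      _ ≤ a ^ 2 * b ^ 4 := by gcongr

/-- Bound of matrix entries used for the Hilbert–Schmidt norm. -/
lemma entry_sq_le (h : WeightData ρ T p γ A d) (h' : WeightData ρ T p' γ' A' d') {D S x y yb : ℝ}
    (hD0 : 0 ≤ D) (hS0 : 0 ≤ S) (hD : D ≤ A ^ 4 + A' ^ 4)
    (hS : S ≤ 2 * (A ^ 4 + A' ^ 4) ∨ (S ≤ p + p' ∧ yb = y)) :
    (D * x + S * y) ^ 2 / (d * d') ≤ 512 * ((x ^ 2 / ρ ^ 3 + (y ^ 2 / ρ ^ 3 + yb ^ 2 / T ^ 3))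
      * (1 / γ ^ 5 + 1 / γ' ^ 5)) := by
  have hdd := mul_pos h.d_pos h'.d_pos
  rw [div_le_iff₀ hdd]
  refine (core h h' hD0 hS0 hD hS).trans ?_
  have h1 : 1 / (p * A ^ 4) + 1 / (p' * A' ^ 4) ≤ 1 / ρ ^ 3 * (1 / γ ^ 5 + 1 / γ' ^ 5) := by
    rw [mul_add]; exact add_le_add h.inv_le h'.inv_le
  have h2 : 1 / (A ^ 4 * A' ^ 4) ≤ 1 / T ^ 3 * (1 / γ ^ 5 + 1 / γ' ^ 5) := by
    rw [mul_add]
    exact (prod_inv_le A A').trans (add_le_add h.inv_pow_eight_le h'.inv_pow_eight_le)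
  have h3 := mul_le_mul_of_nonneg_right h1 (by positivity : 0 ≤ x ^ 2 + y ^ 2)
  have h4 := mul_le_mul_of_nonneg_left h2 (sq_nonneg yb)
  calc _ ≤ 512 * (d * d') * (1 / ρ ^ 3 * (1 / γ ^ 5 + 1 / γ' ^ 5) * (x ^ 2 + y ^ 2)
        + yb ^ 2 * (1 / T ^ 3 * (1 / γ ^ 5 + 1 / γ' ^ 5))) := by
        exact mul_le_mul_of_nonneg_left (add_le_add h3 h4) (by positivity)
    _ = _ := by ring

/-- Weighted bound of matrix entries. -/
lemma entry_sq_mul_le (h : WeightData ρ T p γ A d) (h' : WeightData ρ T p' γ' A' d') {D S x y : ℝ}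
    (hD0 : 0 ≤ D) (hS0 : 0 ≤ S) (hD : D ≤ A ^ 4 + A' ^ 4)
    (hS : S ≤ 2 * (A ^ 4 + A' ^ 4) ∨ S ≤ p + p') :
    min (A ^ 2) (ρ ^ 2) * ((D * x + S * y) ^ 2 / (d * d'))
      ≤ 1536 * ((x ^ 2 / T + y ^ 2 / T) * (1 / γ ^ 5 + 1 / γ' ^ 5)) := by
  have hdd := mul_pos h.d_pos h'.d_pos
  have hρ := h.ρ_pos
  have hT := h.T_pos
  have hγ := h.γ_pos
  have hγ' := h'.γ_pos
  have hc := core h h' (x := x) (y := y) (yb := y) hD0 hS0 hD (hS.imp_right fun h => ⟨h, rfl⟩)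
  have hc' : (D * x + S * y) ^ 2 / (d * d') ≤ 512 * ((1 / (p * A ^ 4) + 1 / (p' * A' ^ 4))
      * (x ^ 2 + y ^ 2) + y ^ 2 * (1 / (A ^ 4 * A' ^ 4))) := by
    rw [div_le_iff₀ hdd]; linarith
  have hm0 : 0 ≤ min (A ^ 2) (ρ ^ 2) := le_min (sq_nonneg _) (sq_nonneg _)
  set g := 1 / γ ^ 5 + 1 / γ' ^ 5 with hg
  have hg0 : 0 ≤ g := by positivity
  -- The minimum is used through both of its bounds: `ρ²` reduces `ρ⁻³` to `ρ⁻¹ ≤ 2/T` here, and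
  -- `A²` is absorbed by the mixed term below.
  have h1 : min (A ^ 2) (ρ ^ 2) * (1 / (p * A ^ 4) + 1 / (p' * A' ^ 4)) ≤ 2 * (1 / T * g) := by
    have hb : 1 / (p * A ^ 4) + 1 / (p' * A' ^ 4) ≤ 1 / ρ ^ 3 * g := by
      rw [hg, mul_add]; exact add_le_add h.inv_le h'.inv_le
    have hb0 : 0 ≤ 1 / (p * A ^ 4) + 1 / (p' * A' ^ 4) := by
      have := h.p_pos
      have := h'.p_pos
      have := h.A_pos
      have := h'.A_pos
      positivity
    calc _ ≤ ρ ^ 2 * (1 / ρ ^ 3 * g) := mul_le_mul (min_le_right _ _) hb hb0 (sq_nonneg _)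
      _ = 1 / ρ * g := by field_simp
      _ ≤ (2 * (1 / T)) * g := by
        refine mul_le_mul_of_nonneg_right ?_ hg0
        rw [mul_one_div, div_le_div_iff₀ hρ hT]
        linarith [h.T_le']
      _ = _ := by ring
  have h2 : min (A ^ 2) (ρ ^ 2) * (1 / (A ^ 4 * A' ^ 4)) ≤ 1 / T * g := by
    have ha0 : 0 ≤ 1 / (A ^ 4 * A' ^ 4) := by
      have := h.A_pos
      have := h'.A_pos
      positivity
    refine (mul_le_mul_of_nonneg_right (min_le_left _ _) ha0).trans ?_
    refine (prod_inv_le' h.A_pos h'.A_pos).trans ?_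
    rw [hg, mul_add]
    exact add_le_add h.inv_pow_six_le h'.inv_pow_six_le
  have h3 := mul_le_mul_of_nonneg_right h1 (by positivity : 0 ≤ x ^ 2 + y ^ 2)
  have h4 := mul_le_mul_of_nonneg_left h2 (sq_nonneg y)
  have h5 : 0 ≤ x ^ 2 * (1 / T * g) := by positivity
  have h6 := mul_le_mul_of_nonneg_left hc' hm0
  refine h6.trans ?_
  have e : 1536 * ((x ^ 2 / T + y ^ 2 / T) * g) = 1536 * (x ^ 2 * (1 / T * g))
    + 1536 * (y ^ 2 * (1 / T * g)) := by ring
  rw [e]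
  linarith

/-- The second factor of a weighted Cauchy–Schwarz inequality: after division by the weight the
terms `1/d` are still summable, with sum of order `1/(r T)`. -/
lemma one_div_weight_le (h : WeightData ρ T p γ A d) :
    1 / (min (A ^ 2) (ρ ^ 2) * d) ≤ 12 * (1 / (ρ ^ 4 * T) * (1 / γ ^ 5)) := by
  have hρ := h.ρ_pos
  have hT := h.T_pos
  have hγ := h.γ_pos
  have hA := h.A_pos
  have hp := h.p_pos
  have hd := h.d_pos
  have h1 : 1 / d ≤ 4 * (1 / (p * A ^ 4)) := by
    rw [mul_one_div, div_le_div_iff₀ hd (by positivity)]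
    linarith [h.le_d]
  have hmin : 1 / min (A ^ 2) (ρ ^ 2) ≤ 1 / A ^ 2 + 1 / ρ ^ 2 := by
    rcases min_cases (A ^ 2) (ρ ^ 2) with ⟨e, _⟩ | ⟨e, _⟩ <;> rw [e]
    · exact le_add_of_nonneg_right (by positivity)
    · exact le_add_of_nonneg_left (by positivity)
  have h2 : 1 / A ^ 2 * (1 / (p * A ^ 4)) ≤ 1 / (ρ ^ 4 * T) * (1 / γ ^ 5) := by
    calc 1 / A ^ 2 * (1 / (p * A ^ 4)) = 1 / p * (1 / A ^ 6) := by field_simp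
      _ ≤ 1 / ρ ^ 4 * (1 / T * (1 / γ ^ 5)) :=
        mul_le_mul (one_div_le_one_div_of_le (by positivity) h.ρ_le) h.inv_pow_six_le
          (by positivity) (by positivity)
      _ = _ := by field_simp
  have h3 : 1 / ρ ^ 2 * (1 / (p * A ^ 4)) ≤ 2 * (1 / (ρ ^ 4 * T) * (1 / γ ^ 5)) := by
    calc 1 / ρ ^ 2 * (1 / (p * A ^ 4)) ≤ 1 / ρ ^ 2 * (1 / ρ ^ 3 * (1 / γ ^ 5)) :=
          mul_le_mul_of_nonneg_left h.inv_le (by positivity)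
      _ = (1 / ρ) * (1 / ρ ^ 4 * (1 / γ ^ 5)) := by field_simp
      _ ≤ (2 / T) * (1 / ρ ^ 4 * (1 / γ ^ 5)) := by
        refine mul_le_mul_of_nonneg_right ?_ (by positivity)
        rw [div_le_div_iff₀ hρ hT]; linarith [h.T_le']
      _ = _ := by field_simp
  rw [← one_div_mul_one_div]
  calc 1 / min (A ^ 2) (ρ ^ 2) * (1 / d) ≤ (1 / A ^ 2 + 1 / ρ ^ 2) * (4 * (1 / (p * A ^ 4))) :=
        mul_le_mul hmin h1 (by positivity) (by positivity)
    _ ≤ _ := by linarith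

end WeightData

/-! ### Weights on the circles `|z| = (m + 1/2)²` -/

/-- The square root of the radius of the contour of order `m`. -/
def rad (m : ℕ) : ℝ := m + 1 / 2

lemma rad_pos (m : ℕ) : 0 < rad m := by
  unfold rad; positivity

lemma half_le_rad (m : ℕ) : 1 / 2 ≤ rad m := by
  unfold rad
  have : (0 : ℝ) ≤ m := Nat.cast_nonneg m
  linarith

/-- The fourth root. -/
def qrt (x : ℝ) : ℝ := x ^ (1 / 4 : ℝ)

lemma qrt_pow {x : ℝ} (hx : 0 ≤ x) : qrt x ^ 4 = x := by
  rw [qrt, ← Real.rpow_natCast, ← Real.rpow_mul hx]; norm_num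

lemma qrt_pos {x : ℝ} (hx : 0 < x) : 0 < qrt x := Real.rpow_pos_of_pos hx _

lemma qrt_le {x y : ℝ} (hx : 0 ≤ x) (h : x ≤ y) : qrt x ≤ qrt y :=
  Real.rpow_le_rpow hx h (by norm_num)

/-- The normalized distance of a point of the circle to the positive half-axis. -/
def offs (m : ℕ) (z : ℂ) : ℝ := ‖z - (rad m : ℂ) ^ 2‖ / (2 * rad m)

lemma offs_nonneg (m : ℕ) (z : ℂ) : 0 ≤ offs m z :=
  div_nonneg (norm_nonneg _) (by linarith [rad_pos m])

lemma norm_rad_sq (m : ℕ) : ‖(rad m : ℂ) ^ 2‖ = rad m ^ 2 := by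
  rw [norm_pow, Complex.norm_real, Real.norm_of_nonneg (rad_pos m).le]

lemma offs_le {m : ℕ} {z : ℂ} (hz : ‖z‖ = rad m ^ 2) : offs m z ≤ rad m := by
  have hr := rad_pos m
  rw [offs, div_le_iff₀ (by linarith)]
  refine (norm_sub_le _ _).trans ?_
  rw [hz, norm_rad_sq]
  linarith

lemma half_le_abs_sub_rad (m j : ℕ) : 1 / 2 ≤ |(j : ℝ) - rad m| := by
  unfold rad
  rcases Nat.lt_or_ge m j with h | h
  · have : (m : ℝ) + 1 ≤ j := by exact_mod_cast h
    rw [abs_of_nonneg] <;> linarith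
  · have : (j : ℝ) ≤ m := by exact_mod_cast h
    rw [abs_of_nonpos] <;> linarith

lemma mul_abs_sub_rad_le {m : ℕ} {z : ℂ} (hz : ‖z‖ = rad m ^ 2) (j : ℕ) :
    (j + rad m) * |(j : ℝ) - rad m| ≤ ‖(j : ℂ) ^ 2 - z‖ := by
  have hr := rad_pos m
  have h := abs_norm_sub_norm_le ((j : ℂ) ^ 2) z
  rw [hz, norm_pow, Complex.norm_natCast] at h
  refine le_trans (le_of_eq ?_) h
  rw [sq_sub_sq, abs_mul, abs_of_nonneg (by positivity : (0 : ℝ) ≤ j + rad m)]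

/-- The reverse triangle inequality gives `|j² - r²| ≤ |j² - z|` on the circle, hence `|z - r²| ≤ 2
|j² - z|`. -/
lemma rad_mul_offs_le {m : ℕ} {z : ℂ} (hz : ‖z‖ = rad m ^ 2) (j : ℕ) :
    rad m * offs m z ≤ ‖(j : ℂ) ^ 2 - z‖ := by
  have hr := rad_pos m
  have h1 : ‖(j : ℂ) ^ 2 - (rad m : ℂ) ^ 2‖ ≤ ‖(j : ℂ) ^ 2 - z‖ := by
    refine le_trans (le_of_eq ?_) (mul_abs_sub_rad_le hz j)
    rw [show (j : ℂ) ^ 2 - (rad m : ℂ) ^ 2 = (((j + rad m) * (j - rad m) : ℝ) : ℂ) by push_cast; ring,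
      Complex.norm_real, Real.norm_eq_abs, abs_mul,
      abs_of_nonneg (by positivity : (0 : ℝ) ≤ j + rad m)]
  have h2 : ‖z - (rad m : ℂ) ^ 2‖ ≤ ‖(j : ℂ) ^ 2 - z‖ + ‖(j : ℂ) ^ 2 - (rad m : ℂ) ^ 2‖ := by
    rw [← norm_neg ((j : ℂ) ^ 2 - z)]
    refine le_trans (le_of_eq ?_) (norm_add_le _ _)
    congr 1; ring
  have e : rad m * offs m z = ‖z - (rad m : ℂ) ^ 2‖ / 2 := by
    rw [offs]; field_simp
  rw [e]; linarith

/-- The weights of a point of the circle satisfy the required size relations. -/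
lemma weightData {m : ℕ} {z : ℂ} (hz : ‖z‖ = rad m ^ 2) (j : ℕ) :
    WeightData (qrt (rad m)) (qrt (offs m z + 1 / 2)) (j + rad m) (qrt |(j : ℝ) - rad m|)
      (qrt (|(j : ℝ) - rad m| + offs m z)) ‖(j : ℂ) ^ 2 - z‖ := by
  have hr := rad_pos m
  have hr2 := half_le_rad m
  have ht := offs_nonneg m z
  have ht' := offs_le hz
  have hd := half_le_abs_sub_rad m j
  have hj : (0 : ℝ) ≤ j := Nat.cast_nonneg j
  have h0 : 0 ≤ |(j : ℝ) - rad m| := abs_nonneg _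
  have hle : |(j : ℝ) - rad m| ≤ j + rad m := by
    rw [abs_le]; constructor <;> linarith
  have e1 := qrt_pow hr.le
  have e2 := qrt_pow h0
  have e3 := qrt_pow (by linarith : 0 ≤ |(j : ℝ) - rad m| + offs m z)
  refine ⟨qrt_pos hr, qrt_pos (by linarith), qrt_pos (by linarith), qrt_le h0 (by linarith),
    qrt_le (by linarith) (by linarith), ?_, ?_, ?_, ?_, ?_, ?_⟩
  · rw [e1]; linarith
  · rw [e2]; exact hle
  · rw [e3]; linarith
  · rw [e3, e1]
    have := neg_abs_le ((j : ℝ) - rad m)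
    have := le_abs_self ((j : ℝ) - rad m)
    linarith
  · rw [e3]
    have h1 := mul_abs_sub_rad_le hz j
    have h2 := rad_mul_offs_le hz j
    -- For `j ≤ 2r` one has `j + r ≤ 3r` and `rad_mul_offs_le` controls the offset. For `j ≥ 2r` the
    -- offset, at most `r`, is dominated by `|j - r|`.
    rcases le_total (j : ℝ) (2 * rad m) with h | h
    · have : (j + rad m) * offs m z ≤ 3 * (rad m * offs m z) := by nlinarith
      linarith
    · have : offs m z ≤ |(j : ℝ) - rad m| := by
        have := le_abs_self ((j : ℝ) - rad m); linarith
      have := mul_le_mul_of_nonneg_left this (by linarith : 0 ≤ (j : ℝ) + rad m)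
      nlinarith [norm_nonneg ((j : ℂ) ^ 2 - z)]
  -- The offset plus `1/2` is at most `2r`; the cruder bound `16 r` is used for the sake of its
  -- fourth root.
  · have h16 : qrt 16 = 2 := by
      rw [qrt, show (16 : ℝ) = 2 ^ (4 : ℝ) by norm_num, ← Real.rpow_mul (by norm_num)]; norm_num
    rw [← h16, qrt, qrt, qrt, ← Real.mul_rpow (by norm_num) hr.le]
    exact Real.rpow_le_rpow (by linarith) (by linarith) (by norm_num)

lemma dist_le_weights {m : ℕ} {z : ℂ} (j k : ℕ) :
    (Nat.dist j k : ℝ) ≤ qrt (|(j : ℝ) - rad m| + offs m z) ^ 4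
      + qrt (|(k : ℝ) - rad m| + offs m z) ^ 4 := by
  have ht := offs_nonneg m z
  rw [qrt_pow (by positivity), qrt_pow (by positivity)]
  have : (Nat.dist j k : ℝ) = |(j : ℝ) - k| := by
    rcases le_total j k with h | h
    · rw [Nat.dist_eq_sub_of_le h, Nat.cast_sub h, abs_of_nonpos]
      · ring
      · have : (j : ℝ) ≤ k := by exact_mod_cast h
        linarith
    · rw [Nat.dist_eq_sub_of_le_right h, Nat.cast_sub h, abs_of_nonneg]
      have : (k : ℝ) ≤ j := by exact_mod_cast h
      linarith
  rw [this]
  have := abs_sub_le (j : ℝ) (rad m) k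
  rw [abs_sub_comm (rad m) (k : ℝ)] at this
  linarith

/-- If `j + k ≤ m`, both indices lie to the left of `r`, and their distances to it add up to `2m + 1
- (j + k) > m`. -/
lemma add_le_weights {m : ℕ} {z : ℂ} {j k : ℕ} (h : j + k ≤ m) :
    ((j + k : ℕ) : ℝ) ≤ 2 * (qrt (|(j : ℝ) - rad m| + offs m z) ^ 4
      + qrt (|(k : ℝ) - rad m| + offs m z) ^ 4) := by
  have ht := offs_nonneg m z
  rw [qrt_pow (by positivity), qrt_pow (by positivity)]
  have h1 : ((j + k : ℕ) : ℝ) ≤ m := by exact_mod_cast h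
  push_cast at h1 ⊢
  have := neg_abs_le ((j : ℝ) - rad m)
  have := neg_abs_le ((k : ℝ) - rad m)
  have : rad m = m + 1 / 2 := rfl
  have : (0 : ℝ) ≤ j := Nat.cast_nonneg j
  have : (0 : ℝ) ≤ k := Nat.cast_nonneg k
  linarith

/-! ### Sums over the indices -/

/-- The sum of `|k - r|^{-5/4}` over the indices on one side of `r`. -/
def gsum : ℝ≥0∞ := ∑' i : ℕ, ENNReal.ofReal (1 / qrt (i + 1 / 2) ^ 5)

lemma gsum_ne_top : gsum ≠ ⊤ := by
  have h := (Real.summable_one_div_nat_add_rpow (1 / 2) (5 / 4)).2 (by norm_num)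
  have e : ∀ i : ℕ, 1 / qrt (i + 1 / 2) ^ 5 = 1 / |(i : ℝ) + 1 / 2| ^ (5 / 4 : ℝ) := by
    intro i
    have hi : (0 : ℝ) ≤ i + 1 / 2 := by positivity
    rw [qrt, ← Real.rpow_natCast, ← Real.rpow_mul hi, abs_of_nonneg hi]
    norm_num
  unfold gsum
  simp only [e]
  exact h.tsum_ofReal_ne_top

lemma tsum_inv_le (m : ℕ) :
    ∑' k : ℕ, ENNReal.ofReal (1 / qrt |(k : ℝ) - rad m| ^ 5) ≤ 2 * gsum :=
  tsum_dist_half_le (fun x => ENNReal.ofReal (1 / qrt x ^ 5)) m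

/-- The majorant of the matrix of the potential in the sine basis. -/
def qmaj (a : ℕ → ℝ) (j k : ℕ) : ℝ := Nat.dist j k * a (Nat.dist j k) + (j + k : ℕ) * a (j + k)

lemma qmaj_nonneg {a : ℕ → ℝ} (ha : ∀ n, 0 ≤ a n) (j k : ℕ) : 0 ≤ qmaj a j k :=
  add_nonneg (mul_nonneg (Nat.cast_nonneg _) (ha _)) (mul_nonneg (Nat.cast_nonneg _) (ha _))

lemma qmaj_comm (a : ℕ → ℝ) (j k : ℕ) : qmaj a j k = qmaj a k j := by
  rw [qmaj, qmaj, Nat.dist_comm, Nat.add_comm]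

/-- The sum of squares. -/
def sqSum (a : ℕ → ℝ) : ℝ≥0∞ := ∑' n, ENNReal.ofReal (a n ^ 2)

/-- The tail of a sequence after the index `m`. -/
def tailSeq (a : ℕ → ℝ) (m n : ℕ) : ℝ := if m < n then a n else 0

lemma tsum_ofReal_sq_div (a : ℕ → ℝ) {c : ℝ} (hc : 0 < c) :
    ∑' n, ENNReal.ofReal (a n ^ 2 / c) = ENNReal.ofReal (1 / c) * sqSum a := by
  rw [sqSum, ← ENNReal.tsum_mul_left]
  refine tsum_congr fun n => ?_
  rw [← ENNReal.ofReal_mul (by positivity)]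
  congr 1; ring

/-- Hilbert–Schmidt bound for the majorant. -/
lemma tsum_entry_sq_le {m : ℕ} {z : ℂ} (hz : ‖z‖ = rad m ^ 2) (a : ℕ → ℝ) :
    ∑' k, ∑' j, ENNReal.ofReal (qmaj a j k ^ 2 / (‖(j : ℂ) ^ 2 - z‖ * ‖(k : ℂ) ^ 2 - z‖))
      ≤ 6144 * gsum * (ENNReal.ofReal (1 / qrt (rad m) ^ 3) * sqSum a
        + ENNReal.ofReal (1 / qrt (offs m z + 1 / 2) ^ 3) * sqSum (tailSeq a m)) := by
  have hρ := (weightData hz 0).ρ_pos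
  have hT := (weightData hz 0).T_pos
  set ρ := qrt (rad m)
  set T := qrt (offs m z + 1 / 2)
  let g : ℕ → ℝ≥0∞ := fun j => ENNReal.ofReal (1 / qrt |(j : ℝ) - rad m| ^ 5)
  let ψ : ℕ → ℝ≥0∞ := fun n => ENNReal.ofReal (a n ^ 2 / ρ ^ 3)
  let χ : ℕ → ℝ≥0∞ := fun n => ENNReal.ofReal (a n ^ 2 / ρ ^ 3)
    + ENNReal.ofReal (tailSeq a m n ^ 2 / T ^ 3)
  have key : ∀ j k, ENNReal.ofReal (qmaj a j k ^ 2 / (‖(j : ℂ) ^ 2 - z‖ * ‖(k : ℂ) ^ 2 - z‖))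
      ≤ 512 * ((ψ (Nat.dist j k) + χ (j + k)) * (g j + g k)) := by
    intro j k
    have hj := weightData hz j
    have hk := weightData hz k
    have h := WeightData.entry_sq_le hj hk (D := Nat.dist j k) (S := (j + k : ℕ))
      (x := a (Nat.dist j k)) (y := a (j + k)) (yb := tailSeq a m (j + k))
      (Nat.cast_nonneg _) (Nat.cast_nonneg _) (dist_le_weights j k) (by
        -- For `m < j + k` the coefficient of index `j + k` belongs to the tail, which is small for
        -- large `m`; otherwise `add_le_weights` makes a tail term unnecessary.
        rcases Nat.lt_or_ge m (j + k) with h | h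
        · right
          refine ⟨?_, if_pos h⟩
          have := rad_pos m
          push_cast; linarith
        · left; exact add_le_weights h)
    have hγ := hj.γ_pos
    have hγ' := hk.γ_pos
    refine (ENNReal.ofReal_le_ofReal h).trans (le_of_eq ?_)
    rw [ENNReal.ofReal_mul (by norm_num), ENNReal.ofReal_mul (by positivity),
      ENNReal.ofReal_add (by positivity) (by positivity),
      ENNReal.ofReal_add (by positivity) (by positivity),
      ENNReal.ofReal_add (by positivity) (by positivity)]
    norm_num [g, ψ, χ]
    rfl
  have hψ : ∑' n, ψ n = ENNReal.ofReal (1 / ρ ^ 3) * sqSum a := tsum_ofReal_sq_div a (by positivity)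
  have hχ : ∑' n, χ n = ENNReal.ofReal (1 / ρ ^ 3) * sqSum a
      + ENNReal.ofReal (1 / T ^ 3) * sqSum (tailSeq a m) := by
    rw [ENNReal.tsum_add, tsum_ofReal_sq_div a (by positivity),
      tsum_ofReal_sq_div (tailSeq a m) (by positivity)]
  calc _ ≤ ∑' k, ∑' j, 512 * ((ψ (Nat.dist j k) + χ (j + k)) * (g j + g k)) :=
        ENNReal.tsum_le_tsum fun k => ENNReal.tsum_le_tsum fun j => key j k
    _ = 512 * ∑' k, ∑' j, ((ψ (Nat.dist j k) + χ (j + k)) * (g j + g k)) := by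
        simp only [ENNReal.tsum_mul_left]
    _ ≤ 512 * ((4 * ∑' n, ψ n + 2 * ∑' n, χ n) * ∑' n, g n) := by
        gcongr; exact tsum_tsum_kernel_le ψ χ g
    _ ≤ 512 * ((4 * ∑' n, ψ n + 2 * ∑' n, χ n) * (2 * gsum)) := by
        gcongr; exact tsum_inv_le m
    _ = 1024 * gsum * (6 * (ENNReal.ofReal (1 / ρ ^ 3) * sqSum a)
          + 2 * (ENNReal.ofReal (1 / T ^ 3) * sqSum (tailSeq a m))) := by
        rw [hψ, hχ]; ring
    _ ≤ 1024 * gsum * (6 * (ENNReal.ofReal (1 / ρ ^ 3) * sqSum a)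
          + 6 * (ENNReal.ofReal (1 / T ^ 3) * sqSum (tailSeq a m))) := by
        gcongr; norm_num
    _ = _ := by ring

/-- Bound of the column sums of the majorant. -/
lemma tsum_column_sq_le {m : ℕ} {z : ℂ} (hz : ‖z‖ = rad m ^ 2) {a : ℕ → ℝ} (ha : ∀ n, 0 ≤ a n) :
    ∑' k, (∑' j, ENNReal.ofReal (qmaj a j k / (‖(j : ℂ) ^ 2 - z‖ * √‖(k : ℂ) ^ 2 - z‖))) ^ 2
      ≤ 442368 * gsum ^ 2 * sqSum a
        * ENNReal.ofReal (1 / (rad m * qrt (offs m z + 1 / 2) ^ 2)) := by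
  have hρ := (weightData hz 0).ρ_pos
  have hT := (weightData hz 0).T_pos
  have eρ : qrt (rad m) ^ 4 = rad m := qrt_pow (rad_pos m).le
  set ρ := qrt (rad m)
  set T := qrt (offs m z + 1 / 2)
  let A : ℕ → ℝ := fun j => qrt (|(j : ℝ) - rad m| + offs m z)
  let d : ℕ → ℝ := fun j => ‖(j : ℂ) ^ 2 - z‖
  -- The weight for Cauchy–Schwarz in `j`, the smaller of `√(|j - r| + t)` and `√r`, `t` being the
  -- offset. It is weak enough for the double series of squared entries to converge and strong
  -- enough to make `1/(w d)` summable.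
  let w : ℕ → ℝ := fun j => min (A j ^ 2) (ρ ^ 2)
  have hd : ∀ j, 0 < d j := fun j => (weightData hz j).d_pos
  have hw : ∀ j, 0 < w j := fun j => lt_min (pow_pos (weightData hz j).A_pos 2) (by positivity)
  let g : ℕ → ℝ≥0∞ := fun j => ENNReal.ofReal (1 / qrt |(j : ℝ) - rad m| ^ 5)
  let ψ : ℕ → ℝ≥0∞ := fun n => ENNReal.ofReal (a n ^ 2 / T)
  have key : ∀ j k, ENNReal.ofReal (w j * (qmaj a j k ^ 2 / (d j * d k)))
      ≤ 1536 * ((ψ (Nat.dist j k) + ψ (j + k)) * (g j + g k)) := by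
    intro j k
    have hj := weightData hz j
    have hk := weightData hz k
    have h := WeightData.entry_sq_mul_le hj hk (D := Nat.dist j k) (S := (j + k : ℕ))
      (x := a (Nat.dist j k)) (y := a (j + k))
      (Nat.cast_nonneg _) (Nat.cast_nonneg _) (dist_le_weights j k) (by
        right
        have := rad_pos m
        push_cast; linarith)
    have hγ := hj.γ_pos
    have hγ' := hk.γ_pos
    refine (ENNReal.ofReal_le_ofReal h).trans (le_of_eq ?_)
    rw [ENNReal.ofReal_mul (by norm_num), ENNReal.ofReal_mul (by positivity),
      ENNReal.ofReal_add (by positivity) (by positivity),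
      ENNReal.ofReal_add (by positivity) (by positivity)]
    norm_num [g, ψ]
    rfl
  have key2 : ∑' j, ENNReal.ofReal (1 / (w j * d j))
      ≤ 12 * ENNReal.ofReal (1 / (rad m * T)) * (2 * gsum) := by
    calc _ ≤ ∑' j, 12 * ENNReal.ofReal (1 / (rad m * T)) * g j := by
          refine ENNReal.tsum_le_tsum fun j => ?_
          refine (ENNReal.ofReal_le_ofReal (weightData hz j).one_div_weight_le).trans (le_of_eq ?_)
          rw [eρ, ENNReal.ofReal_mul (by norm_num), ENNReal.ofReal_mul (by
            have := rad_pos m; positivity), mul_assoc]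
          norm_num [g]
          rfl
      _ = 12 * ENNReal.ofReal (1 / (rad m * T)) * ∑' j, g j := ENNReal.tsum_mul_left
      _ ≤ _ := by gcongr; exact tsum_inv_le m
  have cs : ∀ k, (∑' j, ENNReal.ofReal (qmaj a j k / (d j * √(d k)))) ^ 2
      ≤ (∑' j, ENNReal.ofReal (w j * (qmaj a j k ^ 2 / (d j * d k))))
        * (12 * ENNReal.ofReal (1 / (rad m * T)) * (2 * gsum)) := by
    intro k
    have e : ∀ j, ENNReal.ofReal (qmaj a j k / (d j * √(d k)))
        = ENNReal.ofReal (√(w j) * (qmaj a j k / (√(d j) * √(d k))))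
          * ENNReal.ofReal (1 / (√(w j) * √(d j))) := by
      intro j
      have h1 := Real.sqrt_pos.2 (hw j)
      have h2 := Real.sqrt_pos.2 (hd j)
      have h3 := Real.sqrt_pos.2 (hd k)
      rw [← ENNReal.ofReal_mul (by have := qmaj_nonneg ha j k; positivity)]
      congr 1
      conv_lhs => rw [← Real.mul_self_sqrt (hd j).le]
      field_simp
    simp only [e]
    refine (ennreal_cauchy_schwarz _ _).trans ?_
    refine mul_le_mul' (le_of_eq (tsum_congr fun j => ?_)) (le_trans (le_of_eq (tsum_congr fun j => ?_)) key2)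
    · rw [← ENNReal.ofReal_pow (by have := qmaj_nonneg ha j k; positivity)]
      congr 1
      rw [mul_pow, div_pow, mul_pow, Real.sq_sqrt (hw j).le, Real.sq_sqrt (hd j).le,
        Real.sq_sqrt (hd k).le]
    · rw [← ENNReal.ofReal_pow (by positivity)]
      congr 1
      rw [div_pow, mul_pow, Real.sq_sqrt (hw j).le, Real.sq_sqrt (hd j).le, one_pow]
  have hψ : ∑' n, ψ n = ENNReal.ofReal (1 / T) * sqSum a := tsum_ofReal_sq_div a hT
  calc _ ≤ ∑' k, (∑' j, ENNReal.ofReal (w j * (qmaj a j k ^ 2 / (d j * d k))))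
        * (12 * ENNReal.ofReal (1 / (rad m * T)) * (2 * gsum)) := ENNReal.tsum_le_tsum cs
    _ ≤ (∑' k, ∑' j, 1536 * ((ψ (Nat.dist j k) + ψ (j + k)) * (g j + g k)))
        * (12 * ENNReal.ofReal (1 / (rad m * T)) * (2 * gsum)) := by
        rw [ENNReal.tsum_mul_right]
        gcongr
        exact key _ _
    _ = (1536 * ∑' k, ∑' j, ((ψ (Nat.dist j k) + ψ (j + k)) * (g j + g k)))
        * (12 * ENNReal.ofReal (1 / (rad m * T)) * (2 * gsum)) := by
        simp only [ENNReal.tsum_mul_left]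
    _ ≤ (1536 * ((4 * ∑' n, ψ n + 2 * ∑' n, ψ n) * (2 * gsum)))
        * (12 * ENNReal.ofReal (1 / (rad m * T)) * (2 * gsum)) := by
        gcongr
        refine (tsum_tsum_kernel_le ψ ψ g).trans ?_
        gcongr
        exact tsum_inv_le m
    -- The constant is `1536 · (6 · 2) · (12 · 2)`.
    _ = 442368 * gsum ^ 2 * sqSum a * (ENNReal.ofReal (1 / T) * ENNReal.ofReal (1 / (rad m * T))) := by
        rw [hψ]; ring
    _ = _ := by
        rw [← ENNReal.ofReal_mul (by positivity)]
        congr 2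
        have := rad_pos m
        field_simp

/-! ### Solving the resolvent equation in the sine basis -/

lemma tsum_sq_apply_le (K : ℕ → ℕ → ℝ≥0∞) (h : ℕ → ℝ≥0∞) :
    ∑' k, (∑' j, K j k * h j) ^ 2 ≤ (∑' k, ∑' j, K j k ^ 2) * ∑' j, h j ^ 2 := by
  rw [← ENNReal.tsum_mul_right]
  exact ENNReal.tsum_le_tsum fun k => ennreal_cauchy_schwarz _ _

lemma ennreal_add_sq_le (a b : ℝ≥0∞) : (a + b) ^ 2 ≤ 2 * a ^ 2 + 2 * b ^ 2 := by
  by_cases ha : a = ⊤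
  · simp [ha]
  by_cases hb : b = ⊤
  · simp [hb]
  lift a to NNReal using ha
  lift b to NNReal using hb
  have h2 : (a + b) ^ 2 ≤ 2 * a ^ 2 + 2 * b ^ 2 := by
    calc (a + b) ^ 2 = a ^ 2 + b ^ 2 + 2 * a * b := by ring
      _ ≤ a ^ 2 + b ^ 2 + (a ^ 2 + b ^ 2) := by gcongr; exact two_mul_le_add_sq a b
      _ = _ := by ring
  exact_mod_cast h2

/-- Absorption: squaring gives `H ≤ H/2 + 2F`, and the assumed finiteness of `H` permits
subtraction. -/
lemma tsum_sq_le_of_le_add {K : ℕ → ℕ → ℝ≥0∞} {h F : ℕ → ℝ≥0∞}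
    (hle : ∀ k, h k ≤ ∑' j, K j k * h j + F k) (hK : ∑' k, ∑' j, K j k ^ 2 ≤ 1 / 4)
    (hfin : ∑' k, h k ^ 2 ≠ ⊤) : ∑' k, h k ^ 2 ≤ 4 * ∑' k, F k ^ 2 := by
  set H := ∑' k, h k ^ 2 with hH
  set F2 := ∑' k, F k ^ 2
  have h1 : H ≤ 2 * (1 / 4 * H) + 2 * F2 := by
    calc H ≤ ∑' k, (2 * (∑' j, K j k * h j) ^ 2 + 2 * F k ^ 2) :=
          ENNReal.tsum_le_tsum fun k => (pow_le_pow_left' (hle k) 2).trans (ennreal_add_sq_le _ _)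
      _ = 2 * ∑' k, (∑' j, K j k * h j) ^ 2 + 2 * F2 := by
          rw [ENNReal.tsum_add, ENNReal.tsum_mul_left, ENNReal.tsum_mul_left]
      _ ≤ 2 * (1 / 4 * H) + 2 * F2 := by
          gcongr
          refine (tsum_sq_apply_le K h).trans ?_
          gcongr
  by_cases hF : F2 = ⊤
  · rw [hF]; simp
  lift H to NNReal using hfin with H' hH'
  lift F2 to NNReal using hF with F'
  have h14 : (1 / 4 : ℝ≥0∞) = ((1 / 4 : NNReal) : ℝ≥0∞) := by
    rw [ENNReal.coe_div (by norm_num)]; norm_num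
  rw [h14] at h1
  have h2 : H' ≤ 2 * (1 / 4 * H') + 2 * F' := by exact_mod_cast h1
  have h3 : H' ≤ 4 * F' := by
    have h4 : (H' : ℝ) ≤ 2 * (1 / 4 * H') + 2 * F' := by exact_mod_cast h2
    have : (H' : ℝ) ≤ 4 * F' := by linarith
    exact_mod_cast this
  exact_mod_cast h3

lemma ofReal_norm_tsum_le (f : ℕ → ℂ) :
    ENNReal.ofReal ‖∑' n, f n‖ ≤ ∑' n, ENNReal.ofReal ‖f n‖ := by
  simp only [ofReal_norm]
  exact enorm_tsum_le_tsum_enorm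

lemma summable_of_tsum_ofReal_ne_top {f : ℕ → ℂ} (h : ∑' n, ENNReal.ofReal ‖f n‖ ≠ ⊤) :
    Summable f := by
  refine Summable.of_norm ?_
  simpa [ENNReal.toReal_ofReal (norm_nonneg _)] using ENNReal.summable_toReal h

/-- The absolute values of the sine coefficients. -/
def coeffAbs (u : ℝ → ℂ) (n : ℕ) : ℝ := ‖sineCoeff u n‖

lemma coeffAbs_nonneg (u : ℝ → ℂ) (n : ℕ) : 0 ≤ coeffAbs u n := norm_nonneg _

lemma norm_qmat_le_qmaj {u : ℝ → ℂ} (hu : MemL2 u) (j k : ℕ) :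
    ‖qmat u j k‖ ≤ qmaj (coeffAbs u) j k := norm_qmat_le hu j k

lemma sqSum_coeffAbs {f : ℝ → ℂ} (hf : MemL2 f) :
    sqSum (coeffAbs f) = ENNReal.ofReal (normL2 f ^ 2) := by
  have h := hasSum_sq_sin hf
  rw [← h.tsum_eq, ENNReal.ofReal_tsum_of_nonneg (fun _ => by positivity) h.summable]
  simp only [sqSum, coeffAbs, sineCoeff_eq]

lemma coeffAbs_le {f : ℝ → ℂ} (hf : MemL2 f) (n : ℕ) : coeffAbs f n ≤ normL2 f := by
  have h := hasSum_sq_sin hf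
  have := le_hasSum h n fun _ _ => by positivity
  rw [← sineCoeff_eq] at this
  exact le_of_sq_le_sq this (normL2_nonneg f)

lemma sineCoeff_mul_add {y f : ℝ → ℂ} (hy : MemL2 y) (hf : MemL2 f) (z : ℂ) (n : ℕ) :
    sineCoeff (fun x => z * y x + f x) n = z * sineCoeff y n + sineCoeff f n := by
  simp only [sineCoeff_eq, inn_sinFun]
  have hs : ContinuousOn (fun x : ℝ => ((Real.sin (n * x) : ℝ) : ℂ)) (Icc 0 Real.pi) := by fun_prop
  have i1 := (MemL2.mul_integrable (memL2_of_continuousOn hs) hy)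
  have i2 := (MemL2.mul_integrable (memL2_of_continuousOn hs) hf)
  have e : ∀ x : ℝ, ((Real.sin (n * x) : ℝ) : ℂ) * (z * y x + f x)
      = z * (((Real.sin (n * x) : ℝ) : ℂ) * y x) + ((Real.sin (n * x) : ℝ) : ℂ) * f x := fun x => by ring
  simp only [e]
  rw [intervalIntegral.integral_add (i1.const_mul z) i2, intervalIntegral.integral_const_mul]
  ring

section Resolvent

variable {u f y y₁ : ℝ → ℂ} {m : ℕ} {z : ℂ}

/-- The resolvent equation in the sine basis. -/
lemma QuasiDiff.resolvent_coeff (hu : MemL2 u) (hf : MemL2 f)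
    (hy : QuasiDiff u y y₁ (fun x => z * y x + f x)) (h0 : y 0 = 0) (hπ : y Real.pi = 0) (k : ℕ) :
    HasSum (fun j => sineCoeff y j * qmat u j k)
      (sineCoeff f k - ((k : ℂ) ^ 2 - z) * sineCoeff y k) := by
  have hyL := memL2_of_continuousOn hy.cont
  have h := hy.weak hu ((hyL.const_mul z).add hf) h0 hπ k
  rw [sineCoeff_mul_add hyL hf] at h
  convert! h using 1
  ring

/-- The qualitative finiteness without which the absorption argument would be empty. It comes from
the square summability of `k y_k`. -/
lemma QuasiDiff.tsum_weighted_sq_ne_top (hu : MemL2 u) {g : ℝ → ℂ}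
    (hy : QuasiDiff u y y₁ g) (h0 : y 0 = 0) (hπ : y Real.pi = 0) (z : ℂ) :
    ∑' k : ℕ, ENNReal.ofReal (√‖(k : ℂ) ^ 2 - z‖ * coeffAbs y k) ^ 2 ≠ ⊤ := by
  have hs := (hy.summable_sq hu h0 hπ).mul_left (1 + ‖z‖)
  have hs' : Summable fun k : ℕ => (√‖(k : ℂ) ^ 2 - z‖ * coeffAbs y k) ^ 2 := by
    refine hs.of_nonneg_of_le (fun _ => by positivity) fun k => ?_
    rw [mul_pow, Real.sq_sqrt (norm_nonneg _), mul_pow, ← mul_assoc]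
    rcases Nat.eq_zero_or_pos k with rfl | hk
    · simp [coeffAbs, sineCoeff_zero]
    · refine mul_le_mul_of_nonneg_right ?_ (by positivity)
      have hk1 : (1 : ℝ) ≤ (k : ℝ) ^ 2 := one_le_pow₀ (by exact_mod_cast hk)
      have := norm_sub_le ((k : ℂ) ^ 2) z
      rw [norm_pow, Complex.norm_natCast] at this
      nlinarith [norm_nonneg z]
  have := hs'.tsum_ofReal_ne_top
  simpa only [ENNReal.ofReal_pow (mul_nonneg (Real.sqrt_nonneg _) (coeffAbs_nonneg y _))] using this

/-- The Hilbert–Schmidt norm of the potential with respect to the free resolvent. -/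
def hsNorm (u : ℝ → ℂ) (z : ℂ) : ℝ≥0∞ :=
  ∑' k : ℕ, ∑' j : ℕ, ENNReal.ofReal
    (qmaj (coeffAbs u) j k ^ 2 / (‖(j : ℂ) ^ 2 - z‖ * ‖(k : ℂ) ^ 2 - z‖))

/-- An entry of the symmetrized matrix of the potential. -/
def symEntry (u : ℝ → ℂ) (z : ℂ) (j k : ℕ) : ℝ≥0∞ :=
  ENNReal.ofReal (qmaj (coeffAbs u) j k / (√‖(j : ℂ) ^ 2 - z‖ * √‖(k : ℂ) ^ 2 - z‖))

lemma tsum_symEntry_sq (u : ℝ → ℂ) (z : ℂ) :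
    ∑' k, ∑' j, symEntry u z j k ^ 2 = hsNorm u z := by
  refine tsum_congr fun k => tsum_congr fun j => ?_
  have := qmaj_nonneg (coeffAbs_nonneg u) j k
  rw [symEntry, ← ENNReal.ofReal_pow (by positivity), div_pow, mul_pow,
    Real.sq_sqrt (norm_nonneg _), Real.sq_sqrt (norm_nonneg _)]

lemma norm_sub_pos (hz : ‖z‖ = rad m ^ 2) (j : ℕ) : 0 < ‖(j : ℂ) ^ 2 - z‖ :=
  (weightData hz j).d_pos

lemma sub_ne_zero_of_circle (hz : ‖z‖ = rad m ^ 2) (j : ℕ) : (j : ℂ) ^ 2 - z ≠ 0 :=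
  norm_pos_iff.1 (norm_sub_pos hz j)

/-- Every `|k² - z|` is at least a quarter of `r (t + 1/2)`, where `t` is the offset, because `|k -
r| ≥ 1/2`. -/
lemma tsum_sq_free_le (hz : ‖z‖ = rad m ^ 2) (hf : MemL2 f) :
    ∑' k : ℕ, ENNReal.ofReal (coeffAbs f k / √‖(k : ℂ) ^ 2 - z‖) ^ 2
      ≤ ENNReal.ofReal (4 / (rad m * (offs m z + 1 / 2))) * ENNReal.ofReal (normL2 f ^ 2) := by
  rw [← sqSum_coeffAbs hf, sqSum, ← ENNReal.tsum_mul_left]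
  refine ENNReal.tsum_le_tsum fun k => ?_
  have hr := rad_pos m
  have ho := offs_nonneg m z
  have hd := norm_sub_pos hz k
  have hc := coeffAbs_nonneg f k
  rw [← ENNReal.ofReal_pow (by positivity), ← ENNReal.ofReal_mul (by positivity)]
  refine ENNReal.ofReal_le_ofReal ?_
  rw [div_pow, Real.sq_sqrt hd.le, div_mul_eq_mul_div, div_le_div_iff₀ hd (by positivity)]
  have hw := weightData hz k
  have h1 := hw.le_d
  rw [qrt_pow (by positivity)] at h1
  have h2 : rad m * (offs m z + 1 / 2) ≤ (k + rad m) * (|(k : ℝ) - rad m| + offs m z) := by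
    have h3 := half_le_abs_sub_rad m k
    have : (0 : ℝ) ≤ k := Nat.cast_nonneg k
    exact mul_le_mul (by linarith) (by linarith) (by positivity) (by positivity)
  have := mul_le_mul_of_nonneg_left (h2.trans h1) (sq_nonneg (coeffAbs f k))
  linarith

/-- The equation divided by `k² - z`, with the square roots distributed so that the symmetrized
matrix acts on the weighted coefficients `√|j² - z| y_j`. -/
lemma QuasiDiff.coeff_error_le (hu : MemL2 u) (hf : MemL2 f)
    (hy : QuasiDiff u y y₁ (fun x => z * y x + f x)) (h0 : y 0 = 0) (hπ : y Real.pi = 0)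
    (hz : ‖z‖ = rad m ^ 2) (k : ℕ) :
    ENNReal.ofReal ‖sineCoeff y k - sineCoeff f k / ((k : ℂ) ^ 2 - z)‖
      ≤ ENNReal.ofReal (1 / √‖(k : ℂ) ^ 2 - z‖)
        * ∑' j, symEntry u z j k * ENNReal.ofReal (√‖(j : ℂ) ^ 2 - z‖ * coeffAbs y j) := by
  have hne := sub_ne_zero_of_circle hz k
  have hd := norm_sub_pos hz k
  have hS := hy.resolvent_coeff hu hf h0 hπ k
  have e : sineCoeff y k - sineCoeff f k / ((k : ℂ) ^ 2 - z)
      = -(∑' j, sineCoeff y j * qmat u j k) / ((k : ℂ) ^ 2 - z) := by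
    rw [hS.tsum_eq]; field_simp; ring
  rw [e, norm_div, norm_neg, div_eq_mul_one_div, ENNReal.ofReal_mul (norm_nonneg _)]
  calc _ ≤ (∑' j, ENNReal.ofReal ‖sineCoeff y j * qmat u j k‖)
        * ENNReal.ofReal (1 / ‖(k : ℂ) ^ 2 - z‖) := by gcongr; exact ofReal_norm_tsum_le _
    _ ≤ _ := by
      rw [← ENNReal.tsum_mul_right, ← ENNReal.tsum_mul_left]
      refine ENNReal.tsum_le_tsum fun j => ?_
      have hdj := norm_sub_pos hz j
      have hq := qmaj_nonneg (coeffAbs_nonneg u) j k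
      have hc := coeffAbs_nonneg y j
      rw [symEntry, ← ENNReal.ofReal_mul (by positivity), ← ENNReal.ofReal_mul (by positivity),
        ← ENNReal.ofReal_mul (by positivity)]
      refine ENNReal.ofReal_le_ofReal ?_
      have s1 := Real.sqrt_pos.2 hdj
      have s2 := Real.sqrt_pos.2 hd
      have e2 : 1 / √‖(k : ℂ) ^ 2 - z‖ * (qmaj (coeffAbs u) j k /
          (√‖(j : ℂ) ^ 2 - z‖ * √‖(k : ℂ) ^ 2 - z‖) * (√‖(j : ℂ) ^ 2 - z‖ * coeffAbs y j))
          = coeffAbs y j * qmaj (coeffAbs u) j k * (1 / ‖(k : ℂ) ^ 2 - z‖) := by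
        conv_rhs => rw [← Real.mul_self_sqrt hd.le]
        field_simp
      rw [e2, norm_mul]
      have := norm_qmat_le_qmaj hu j k
      gcongr
      exact le_rfl

/-- A priori bound for the solution of the resolvent equation. -/
lemma QuasiDiff.tsum_weighted_sq_le (hu : MemL2 u) (hf : MemL2 f)
    (hy : QuasiDiff u y y₁ (fun x => z * y x + f x)) (h0 : y 0 = 0) (hπ : y Real.pi = 0)
    (hz : ‖z‖ = rad m ^ 2) (hK : hsNorm u z ≤ 1 / 4) :
    ∑' k : ℕ, ENNReal.ofReal (√‖(k : ℂ) ^ 2 - z‖ * coeffAbs y k) ^ 2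
      ≤ 4 * (ENNReal.ofReal (4 / (rad m * (offs m z + 1 / 2))) * ENNReal.ofReal (normL2 f ^ 2)) := by
  refine (tsum_sq_le_of_le_add (K := symEntry u z)
    (F := fun k => ENNReal.ofReal (coeffAbs f k / √‖(k : ℂ) ^ 2 - z‖)) (fun k => ?_)
    (by rwa [tsum_symEntry_sq]) (hy.tsum_weighted_sq_ne_top hu h0 hπ z)).trans
    (mul_le_mul' le_rfl (tsum_sq_free_le hz hf))
  have hd := norm_sub_pos hz k
  have s2 := Real.sqrt_pos.2 hd
  have h1 := hy.coeff_error_le hu hf h0 hπ hz k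
  have h2 := mul_le_mul' (le_refl (ENNReal.ofReal √‖(k : ℂ) ^ 2 - z‖)) h1
  rw [← mul_assoc, ← ENNReal.ofReal_mul s2.le, ← ENNReal.ofReal_mul s2.le,
    mul_one_div_cancel s2.ne', ENNReal.ofReal_one, one_mul] at h2
  refine le_trans ?_ (add_le_add h2 le_rfl)
  have hc := coeffAbs_nonneg f k
  rw [← ENNReal.ofReal_add (by positivity) (by positivity)]
  refine ENNReal.ofReal_le_ofReal ?_
  have h3 : coeffAbs y k ≤ ‖sineCoeff y k - sineCoeff f k / ((k : ℂ) ^ 2 - z)‖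
      + coeffAbs f k / ‖(k : ℂ) ^ 2 - z‖ := by
    rw [coeffAbs, coeffAbs, ← norm_div]
    have h5 := norm_add_le (sineCoeff y k - sineCoeff f k / ((k : ℂ) ^ 2 - z))
      (sineCoeff f k / ((k : ℂ) ^ 2 - z))
    rwa [sub_add_cancel] at h5
  have h4 := mul_le_mul_of_nonneg_left h3 s2.le
  have e : √‖(k : ℂ) ^ 2 - z‖ * (coeffAbs f k / ‖(k : ℂ) ^ 2 - z‖)
      = coeffAbs f k / √‖(k : ℂ) ^ 2 - z‖ := by
    rw [mul_div_left_comm, mul_comm, Real.sqrt_div_self', one_div_mul_eq_div]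
  linarith

/-- The column sums of the matrix of the potential. -/
def colSum (u : ℝ → ℂ) (z : ℂ) (k : ℕ) : ℝ≥0∞ :=
  ∑' j : ℕ, ENNReal.ofReal (qmaj (coeffAbs u) j k / (‖(j : ℂ) ^ 2 - z‖ * √‖(k : ℂ) ^ 2 - z‖))

/-- Absolute convergence of the first order term of the resolvent. -/
lemma tsum_first_order_le (u f : ℝ → ℂ) (hz : ‖z‖ = rad m ^ 2) :
    (∑' k : ℕ, ∑' j : ℕ, ENNReal.ofReal (qmaj (coeffAbs u) j k * coeffAbs f j
      / (‖(j : ℂ) ^ 2 - z‖ * ‖(k : ℂ) ^ 2 - z‖))) ^ 2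
      ≤ (∑' k, colSum u z k ^ 2)
        * ∑' k : ℕ, ENNReal.ofReal (coeffAbs f k / √‖(k : ℂ) ^ 2 - z‖) ^ 2 := by
  -- Summing over the output index first turns the matrix into `colSum`, by symmetry of the
  -- majorant; Cauchy–Schwarz then pairs it with the weighted coefficients of `f`.
  rw [ENNReal.tsum_comm]
  refine le_trans (le_of_eq ?_) (ennreal_cauchy_schwarz _ _)
  congr 1
  refine tsum_congr fun j => ?_
  rw [colSum, ← ENNReal.tsum_mul_right]
  refine tsum_congr fun k => ?_
  have hq := qmaj_nonneg (coeffAbs_nonneg u) k j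
  have hdj := norm_sub_pos hz j
  have hdk := norm_sub_pos hz k
  have s1 := Real.sqrt_pos.2 hdj
  rw [← ENNReal.ofReal_mul (by positivity), qmaj_comm]
  congr 1
  conv_lhs => rw [← Real.mul_self_sqrt hdj.le]
  field_simp

/-- The remainder of order two in the expansion of a coefficient of the resolvent. -/
def coeffRemainder (u f y : ℝ → ℂ) (z : ℂ) (k : ℕ) : ℂ :=
  sineCoeff y k - sineCoeff f k / ((k : ℂ) ^ 2 - z)
    + ∑' j, qmat u j k * sineCoeff f j / (((j : ℂ) ^ 2 - z) * ((k : ℂ) ^ 2 - z))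

lemma tsum_colSum_sq_le (u : ℝ → ℂ) (hz : ‖z‖ = rad m ^ 2) :
    ∑' k, colSum u z k ^ 2 ≤ 442368 * gsum ^ 2 * sqSum (coeffAbs u)
        * ENNReal.ofReal (1 / (rad m * qrt (offs m z + 1 / 2) ^ 2)) :=
  tsum_column_sq_le hz (coeffAbs_nonneg u)

/-- Absolute convergence of the double series, which later justifies summing it over pairs and
integrating it term by term. -/
lemma tsum_first_order_ne_top (hu : MemL2 u) (hf : MemL2 f) (hz : ‖z‖ = rad m ^ 2) :
    ∑' k : ℕ, ∑' j : ℕ, ENNReal.ofReal (qmaj (coeffAbs u) j k * coeffAbs f j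
      / (‖(j : ℂ) ^ 2 - z‖ * ‖(k : ℂ) ^ 2 - z‖)) ≠ ⊤ := by
  have h := (tsum_first_order_le u f hz).trans
    (mul_le_mul' (tsum_colSum_sq_le u hz) (tsum_sq_free_le hz hf))
  rw [sqSum_coeffAbs hu] at h
  intro htop
  rw [htop] at h
  have : (442368 * gsum ^ 2 * ENNReal.ofReal (normL2 u ^ 2)
        * ENNReal.ofReal (1 / (rad m * qrt (offs m z + 1 / 2) ^ 2)))
      * (ENNReal.ofReal (4 / (rad m * (offs m z + 1 / 2))) * ENNReal.ofReal (normL2 f ^ 2)) < ⊤ := by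
    have := gsum_ne_top.lt_top
    finiteness
  exact absurd h (by simpa using this.ne)

lemma summable_first_order (hu : MemL2 u) (hf : MemL2 f) (hz : ‖z‖ = rad m ^ 2) (k : ℕ) :
    Summable fun j => qmat u j k * sineCoeff f j / (((j : ℂ) ^ 2 - z) * ((k : ℂ) ^ 2 - z)) := by
  refine summable_of_tsum_ofReal_ne_top (ne_top_of_le_ne_top
    (ENNReal.ne_top_of_tsum_ne_top (tsum_first_order_ne_top hu hf hz) k)
    (ENNReal.tsum_le_tsum fun j => ENNReal.ofReal_le_ofReal ?_))
  rw [norm_div, norm_mul, norm_mul]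
  exact div_le_div_of_nonneg_right (mul_le_mul_of_nonneg_right (norm_qmat_le_qmaj hu j k)
    (norm_nonneg _)) (by positivity)

/-- By the equation, the remainder is minus the matrix applied once more to the error `y_j - f_j/(j²
- z)`, which `QuasiDiff.coeff_error_le` bounds. The `ℓ¹` norm is chosen because it controls the
uniform norm of the sine series. -/
lemma QuasiDiff.tsum_remainder_sq_le (hu : MemL2 u) (hf : MemL2 f)
    (hy : QuasiDiff u y y₁ (fun x => z * y x + f x)) (h0 : y 0 = 0) (hπ : y Real.pi = 0)
    (hz : ‖z‖ = rad m ^ 2) :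
    (∑' k, ENNReal.ofReal ‖coeffRemainder u f y z k‖) ^ 2 ≤ (∑' k, colSum u z k ^ 2)
      * (hsNorm u z * ∑' k : ℕ, ENNReal.ofReal (√‖(k : ℂ) ^ 2 - z‖ * coeffAbs y k) ^ 2) := by
  set M : ℕ → ℝ≥0∞ := fun j =>
    ∑' i, symEntry u z i j * ENNReal.ofReal (√‖(i : ℂ) ^ 2 - z‖ * coeffAbs y i) with hM
  have hterm : ∀ k, ENNReal.ofReal ‖coeffRemainder u f y z k‖
      ≤ ∑' j, ENNReal.ofReal (qmaj (coeffAbs u) k j / (‖(k : ℂ) ^ 2 - z‖ * √‖(j : ℂ) ^ 2 - z‖))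
        * M j := by
    intro k
    have hne := sub_ne_zero_of_circle hz k
    have hd := norm_sub_pos hz k
    have hS := (hy.resolvent_coeff hu hf h0 hπ k)
    have hS' := hS.mul_right (1 / ((k : ℂ) ^ 2 - z))
    have e : coeffRemainder u f y z k
        = ∑' j, -(qmat u j k / ((k : ℂ) ^ 2 - z) *
          (sineCoeff y j - sineCoeff f j / ((j : ℂ) ^ 2 - z))) := by
      have h1 : sineCoeff y k - sineCoeff f k / ((k : ℂ) ^ 2 - z)
          = -∑' j, sineCoeff y j * qmat u j k * (1 / ((k : ℂ) ^ 2 - z)) := by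
        rw [hS'.tsum_eq]; field_simp; ring
      rw [coeffRemainder, h1, ← tsum_neg, ← hS'.summable.neg.tsum_add (summable_first_order hu hf hz k)]
      refine tsum_congr fun j => ?_
      have hnj := sub_ne_zero_of_circle hz j
      field_simp
      ring
    rw [e]
    refine (ofReal_norm_tsum_le _).trans (ENNReal.tsum_le_tsum fun j => ?_)
    have hdj := norm_sub_pos hz j
    have s1 := Real.sqrt_pos.2 hdj
    have hq := qmaj_nonneg (coeffAbs_nonneg u) k j
    rw [norm_neg, norm_mul, ENNReal.ofReal_mul (norm_nonneg _), norm_div]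
    have hc := hy.coeff_error_le hu hf h0 hπ hz j
    calc _ ≤ ENNReal.ofReal (qmaj (coeffAbs u) k j / ‖(k : ℂ) ^ 2 - z‖)
          * (ENNReal.ofReal (1 / √‖(j : ℂ) ^ 2 - z‖) * M j) := by
          refine mul_le_mul' (ENNReal.ofReal_le_ofReal ?_) hc
          rw [qmaj_comm]
          have := norm_qmat_le_qmaj hu j k
          gcongr
      _ = _ := by
          rw [← mul_assoc, ← ENNReal.ofReal_mul (by positivity), div_mul_div_comm, mul_one]
  calc (∑' k, ENNReal.ofReal ‖coeffRemainder u f y z k‖) ^ 2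
      ≤ (∑' k : ℕ, ∑' j : ℕ, ENNReal.ofReal
          (qmaj (coeffAbs u) k j / (‖(k : ℂ) ^ 2 - z‖ * √‖(j : ℂ) ^ 2 - z‖)) * M j) ^ 2 :=
        pow_le_pow_left' (ENNReal.tsum_le_tsum hterm) 2
    _ = (∑' j, colSum u z j * M j) ^ 2 := by
        rw [ENNReal.tsum_comm]
        simp only [ENNReal.tsum_mul_right, colSum]
    _ ≤ (∑' k, colSum u z k ^ 2) * ∑' j, M j ^ 2 := ennreal_cauchy_schwarz _ _
    _ ≤ _ := by
        refine mul_le_mul' le_rfl ?_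
        refine (tsum_sq_apply_le _ _).trans ?_
        rw [tsum_symEntry_sq]

end Resolvent

/-! ### The terms of order at least two -/

lemma sqSum_tailSeq (a : ℕ → ℝ) (m : ℕ) :
    sqSum (tailSeq a m) = ∑' n, ENNReal.ofReal (a (n + (m + 1)) ^ 2) := by
  have h := Summable.sum_add_tsum_nat_add' (f := fun n => ENNReal.ofReal (tailSeq a m n ^ 2))
    (k := m + 1) ENNReal.summable
  rw [sqSum, ← h, Finset.sum_eq_zero, zero_add]
  · refine tsum_congr fun n => ?_
    rw [tailSeq, if_pos (by omega)]
  · intro n hn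
    have := Finset.mem_range.1 hn
    rw [tailSeq, if_neg (by omega)]
    simp

lemma tendsto_sqSum_tailSeq {a : ℕ → ℝ} (ha : sqSum a ≠ ⊤) :
    Tendsto (fun m => sqSum (tailSeq a m)) atTop (𝓝 0) := by
  simp only [sqSum_tailSeq]
  exact (ENNReal.tendsto_sum_nat_add (fun n => ENNReal.ofReal (a n ^ 2)) ha).comp
    (tendsto_add_atTop_nat 1)

lemma sqSum_coeffAbs_ne_top {u : ℝ → ℂ} (hu : MemL2 u) : sqSum (coeffAbs u) ≠ ⊤ := by
  rw [sqSum_coeffAbs hu]; exact ENNReal.ofReal_ne_top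

/-- The quantity controlling the size of the potential near the circle of order `m`. -/
def smallness (u : ℝ → ℂ) (m : ℕ) : ℝ≥0∞ :=
  ENNReal.ofReal (8 / √(qrt (rad m))) * sqSum (coeffAbs u)
    + 2 * sqSum (tailSeq (coeffAbs u) m)

lemma tendsto_rad : Tendsto rad atTop atTop :=
  tendsto_atTop_add_const_right _ _ tendsto_natCast_atTop_atTop

lemma tendsto_smallness {u : ℝ → ℂ} (hu : MemL2 u) :
    Tendsto (smallness u) atTop (𝓝 0) := by
  have h1 : Tendsto (fun m => 8 / √(qrt (rad m))) atTop (𝓝 0) := by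
    refine Tendsto.const_div_atTop ?_ 8
    refine Real.tendsto_sqrt_atTop.comp ?_
    exact (tendsto_rpow_atTop (by norm_num : (0 : ℝ) < 1 / 4)).comp tendsto_rad
  have h2 := ENNReal.Tendsto.mul_const (ENNReal.tendsto_ofReal h1)
    (Or.inr (sqSum_coeffAbs_ne_top hu))
  have h3 := ENNReal.Tendsto.const_mul (a := 2) (tendsto_sqSum_tailSeq (sqSum_coeffAbs_ne_top hu))
    (Or.inr (by norm_num))
  have h4 := h2.add h3
  rw [ENNReal.ofReal_zero, zero_mul, mul_zero, add_zero] at h4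
  exact h4

section

variable {u : ℝ → ℂ} {m : ℕ} {z : ℂ}

/-- Both parts of the Hilbert–Schmidt bound are brought to the common decay `T^{-5/2} = τ^{-5/8}`,
`τ = T⁴`. The inequality `T ≤ 2ρ` saves `r^{-1/8}` in the first part; the second keeps the tail as
its small factor. The exponent `5/8` is what makes the final exponent exceed one. -/
lemma hsNorm_le (u : ℝ → ℂ) (hz : ‖z‖ = rad m ^ 2) :
    hsNorm u z ≤ 6144 * gsum * smallness u m
      * ENNReal.ofReal (1 / (qrt (offs m z + 1 / 2) ^ 2 * √(qrt (offs m z + 1 / 2)))) := by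
  refine (tsum_entry_sq_le hz (coeffAbs u)).trans ?_
  have hw := weightData hz 0
  have hρ := hw.ρ_pos
  have hT := hw.T_pos
  have hTρ := hw.T_le'
  have hT4 : 1 / 2 ≤ qrt (offs m z + 1 / 2) ^ 4 := by
    have := offs_nonneg m z
    rw [qrt_pow (by linarith)]; linarith
  rw [mul_assoc (6144 * gsum)]
  refine mul_le_mul' le_rfl ?_
  rw [smallness, add_mul]
  set ρ := qrt (rad m)
  set T := qrt (offs m z + 1 / 2)
  have sρ := Real.sqrt_pos.2 hρ
  have sT := Real.sqrt_pos.2 hT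
  have h1 : 1 / ρ ^ 3 ≤ 8 / √ρ * (1 / (T ^ 2 * √T)) := by
    rw [div_mul_div_comm, mul_one, div_le_div_iff₀ (by positivity) (by positivity), one_mul]
    have hs : √T ≤ 2 * √ρ := by
      rw [Real.sqrt_le_left (by positivity), mul_pow, Real.sq_sqrt hρ.le]; linarith
    calc √ρ * (T ^ 2 * √T) ≤ √ρ * ((2 * ρ) ^ 2 * (2 * √ρ)) := by gcongr
      _ = 8 * ρ ^ 2 * (√ρ * √ρ) := by ring
      _ = 8 * ρ ^ 3 := by rw [Real.mul_self_sqrt hρ.le]; ring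
  have h2 : 1 / T ^ 3 ≤ 2 * (1 / (T ^ 2 * √T)) := by
    have hT' : 1 / 4 ≤ T := by
      by_contra! hlt
      have := pow_lt_pow_left₀ hlt hT.le (n := 4) (by norm_num)
      norm_num at this
      linarith
    have hs : 1 / 2 ≤ √T := by
      rw [Real.le_sqrt (by norm_num) hT.le]; linarith
    rw [mul_one_div, div_le_div_iff₀ (by positivity) (by positivity), one_mul]
    calc T ^ 2 * √T ≤ T ^ 2 * (2 * (√T * √T)) := by gcongr; nlinarith
      _ = 2 * T ^ 3 := by rw [Real.mul_self_sqrt hT.le]; ring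
  refine add_le_add ?_ ?_
  · calc _ ≤ ENNReal.ofReal (8 / √ρ * (1 / (T ^ 2 * √T))) * sqSum (coeffAbs u) := by gcongr
      _ = _ := by rw [ENNReal.ofReal_mul (by positivity)]; ring
  · calc _ ≤ ENNReal.ofReal (2 * (1 / (T ^ 2 * √T))) * sqSum (tailSeq (coeffAbs u) m) := by gcongr
      _ = _ := by
        rw [ENNReal.ofReal_mul (by positivity), ENNReal.ofReal_ofNat]; ring

/-- On circles of large order the potential is small with respect to the free resolvent. -/
lemma eventually_hsNorm_le (hu : MemL2 u) :
    ∀ᶠ m in atTop, ∀ z : ℂ, ‖z‖ = rad m ^ 2 → hsNorm u z ≤ 1 / 4 := by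
  have h := ENNReal.Tendsto.const_mul (a := 6144 * gsum * 64) (tendsto_smallness hu)
    (Or.inr (by have := gsum_ne_top.lt_top; finiteness))
  rw [mul_zero] at h
  filter_upwards [h.eventually (gt_mem_nhds (by norm_num : (0 : ℝ≥0∞) < 1 / 4))] with m hm z hz
  refine (hsNorm_le u hz).trans (le_trans ?_ hm.le)
  have hT4 : 1 / 2 ≤ qrt (offs m z + 1 / 2) ^ 4 := by
    have := offs_nonneg m z
    rw [qrt_pow (by linarith)]; linarith
  have hT := (weightData hz 0).T_pos
  set T := qrt (offs m z + 1 / 2)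
  have hT' : 1 / 4 ≤ T := by
    by_contra! hlt
    have := pow_lt_pow_left₀ hlt hT.le (n := 4) (by norm_num)
    norm_num at this
    linarith
  have hs : 1 / 2 ≤ √T := by
    rw [Real.le_sqrt (by norm_num) hT.le]; linarith
  have h64 : ENNReal.ofReal (1 / (T ^ 2 * √T)) ≤ 64 := by
    rw [← ENNReal.ofReal_ofNat]
    refine ENNReal.ofReal_le_ofReal ?_
    rw [div_le_iff₀ (by positivity)]
    nlinarith [mul_le_mul (pow_le_pow_left₀ (by norm_num) hT' 2) hs (by norm_num) (by positivity)]
  calc _ ≤ 6144 * gsum * smallness u m * 64 := by gcongr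
    _ = _ := by ring

/-- The coefficient of the bound of the terms of order at least two. -/
def remConst (u : ℝ → ℂ) (m : ℕ) : ℝ≥0∞ :=
  442368 * gsum ^ 2 * sqSum (coeffAbs u) * (6144 * gsum * smallness u m) * 16

lemma tendsto_remConst (hu : MemL2 u) : Tendsto (remConst u) atTop (𝓝 0) := by
  have h := ENNReal.Tendsto.const_mul
    (a := 442368 * gsum ^ 2 * sqSum (coeffAbs u) * (6144 * gsum) * 16) (tendsto_smallness hu)
    (Or.inr (by
      have := gsum_ne_top.lt_top
      have := (sqSum_coeffAbs_ne_top hu).lt_top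
      finiteness))
  rw [mul_zero] at h
  refine h.congr fun m => ?_
  rw [remConst]; ring

lemma smallness_ne_top (hu : MemL2 u) (m : ℕ) : smallness u m ≠ ⊤ := by
  have h1 := (sqSum_coeffAbs_ne_top hu).lt_top
  have h2 : sqSum (tailSeq (coeffAbs u) m) < ⊤ := by
    refine lt_of_le_of_lt (ENNReal.tsum_le_tsum fun n => ENNReal.ofReal_le_ofReal ?_) h1
    rw [tailSeq]; split_ifs
    · exact le_rfl
    · simpa using sq_nonneg (coeffAbs u n)
  unfold smallness
  finiteness

lemma remConst_ne_top (hu : MemL2 u) (m : ℕ) : remConst u m ≠ ⊤ := by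
  have := (smallness_ne_top hu m).lt_top
  have := (sqSum_coeffAbs_ne_top hu).lt_top
  have := gsum_ne_top.lt_top
  unfold remConst
  finiteness

/-- In terms of `τ`, the offset plus `1/2`, the three factors of the squared norm decay like
`τ^{-1/2}` (columns), `τ^{-5/8}` (Hilbert–Schmidt) and `τ^{-1}` (a priori bound). The square root
gives `τ^{-17/16}`, integrable along the circle. -/
lemma QuasiDiff.tsum_remainder_le (hu : MemL2 u) {f y y₁ : ℝ → ℂ} (hf : MemL2 f)
    (hy : QuasiDiff u y y₁ (fun x => z * y x + f x)) (h0 : y 0 = 0) (hπ : y Real.pi = 0)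
    (hz : ‖z‖ = rad m ^ 2) (hK : hsNorm u z ≤ 1 / 4) :
    ∑' k, ENNReal.ofReal ‖coeffRemainder u f y z k‖ ≤ ENNReal.ofReal
      (√(remConst u m).toReal * normL2 f / (rad m * (offs m z + 1 / 2) ^ (17 / 16 : ℝ))) := by
  have hr := rad_pos m
  have ho := offs_nonneg m z
  have hτ : 0 < offs m z + 1 / 2 := by linarith
  have hT := qrt_pos hτ
  have hT4 := qrt_pow hτ.le
  have hN := normL2_nonneg f
  have hmain : (∑' k, ENNReal.ofReal ‖coeffRemainder u f y z k‖) ^ 2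
      ≤ remConst u m * ENNReal.ofReal (normL2 f ^ 2 *
        (1 / (rad m * (offs m z + 1 / 2) ^ (17 / 16 : ℝ)) ^ 2)) := by
    refine (hy.tsum_remainder_sq_le hu hf h0 hπ hz).trans ?_
    refine (mul_le_mul' (tsum_colSum_sq_le u hz) (mul_le_mul' (hsNorm_le u hz)
      (hy.tsum_weighted_sq_le hu hf h0 hπ hz hK))).trans (le_of_eq ?_)
    rw [remConst]
    have e : normL2 f ^ 2 * (1 / (rad m * (offs m z + 1 / 2) ^ (17 / 16 : ℝ)) ^ 2)
        = 1 / (rad m * qrt (offs m z + 1 / 2) ^ 2)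
          * (1 / (qrt (offs m z + 1 / 2) ^ 2 * √(qrt (offs m z + 1 / 2))))
          * ((1 / (rad m * (offs m z + 1 / 2))) * normL2 f ^ 2) := by
      have e1 : ((offs m z + 1 / 2) ^ (17 / 16 : ℝ)) ^ 2
          = qrt (offs m z + 1 / 2) ^ 4 * √(qrt (offs m z + 1 / 2)) * (offs m z + 1 / 2) := by
        rw [hT4, qrt, Real.sqrt_eq_rpow, ← Real.rpow_mul hτ.le, ← Real.rpow_natCast,
          ← Real.rpow_mul hτ.le]
        nth_rw 2 [← Real.rpow_one (offs m z + 1 / 2)]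
        nth_rw 4 [← Real.rpow_one (offs m z + 1 / 2)]
        rw [← Real.rpow_add hτ, ← Real.rpow_add hτ]
        norm_num
      have sT := Real.sqrt_pos.2 hT
      rw [mul_pow, e1]
      field_simp
    rw [e, ENNReal.ofReal_mul (by positivity), ENNReal.ofReal_mul (by positivity),
      ENNReal.ofReal_mul (by positivity), show (4 : ℝ) / (rad m * (offs m z + 1 / 2))
        = 4 * (1 / (rad m * (offs m z + 1 / 2))) by ring, ENNReal.ofReal_mul (p := 4) (by norm_num),
      ENNReal.ofReal_ofNat]
    ring
  have hc : remConst u m = ENNReal.ofReal (remConst u m).toReal :=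
    (ENNReal.ofReal_toReal (remConst_ne_top hu m)).symm
  rw [hc, ← ENNReal.ofReal_mul ENNReal.toReal_nonneg] at hmain
  have e2 : (remConst u m).toReal * (normL2 f ^ 2 *
        (1 / (rad m * (offs m z + 1 / 2) ^ (17 / 16 : ℝ)) ^ 2))
      = (√(remConst u m).toReal * normL2 f / (rad m * (offs m z + 1 / 2) ^ (17 / 16 : ℝ))) ^ 2 := by
    rw [div_pow, mul_pow (√_), Real.sq_sqrt ENNReal.toReal_nonneg]; ring
  rw [e2, ENNReal.ofReal_pow (by positivity)] at hmain
  exact (ENNReal.pow_le_pow_left_iff (by norm_num)).1 hmain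

/-- On circles of large order there are no eigenvalues. -/
lemma QuasiDiff.eq_zero_of_circle (hu : MemL2 u) {y y₁ : ℝ → ℂ}
    (hy : QuasiDiff u y y₁ (fun x => z * y x)) (h0 : y 0 = 0) (hπ : y Real.pi = 0)
    (hz : ‖z‖ = rad m ^ 2) (hK : hsNorm u z ≤ 1 / 4) {x : ℝ} (hx : x ∈ Icc 0 Real.pi) : y x = 0 := by
  have hf : MemL2 (fun _ : ℝ => (0 : ℂ)) := memL2_of_continuousOn continuousOn_const
  have hy' : QuasiDiff u y y₁ (fun x => z * y x + (fun _ : ℝ => (0 : ℂ)) x) := by simpa using hy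
  have h := hy'.tsum_weighted_sq_le hu hf h0 hπ hz hK
  have hn : normL2 (fun _ : ℝ => (0 : ℂ)) = 0 := by simp [normL2]
  rw [hn] at h
  simp only [ne_eq, OfNat.ofNat_ne_zero, not_false_eq_true, zero_pow, ENNReal.ofReal_zero, mul_zero,
    nonpos_iff_eq_zero, ENNReal.tsum_eq_zero, pow_eq_zero_iff, ENNReal.ofReal_eq_zero] at h
  have hc : ∀ k, sineCoeff y k = 0 := by
    intro k
    have h1 := h k
    have hd := Real.sqrt_pos.2 (norm_sub_pos hz k)
    have h2 : coeffAbs y k ≤ 0 := by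
      by_contra! hpos
      exact absurd (mul_pos hd hpos) (not_lt.2 h1)
    exact norm_le_zero_iff.1 h2
  have hs := hy.hasSum_sine hu h0 hπ hx
  simp only [hc, zero_mul] at hs
  exact hs.unique hasSum_zero

end

/-! ### The term of first order -/

/-- A discrete form of `∫₀^∞ √γ / (√s (s + γ)) ds < ∞`. -/
lemma tsum_sqrt_div_le {γ : ℝ} (hγ : 0 < γ) :
    ∑' n : ℕ, ENNReal.ofReal (√γ / (√(n + 1) * (n + 1 + γ))) ≤ 4 := by
  refine ENNReal.tsum_le_of_sum_range_le fun N => ?_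
  rw [← ENNReal.ofReal_sum_of_nonneg (fun n _ => by positivity), ← ENNReal.ofReal_ofNat]
  refine ENNReal.ofReal_le_ofReal ?_
  have hg := Real.sqrt_pos.2 hγ
  -- A telescoping majorant: the increments of `4 √N / (√N + √γ)` dominate the terms, and its values
  -- stay below `4` whatever `γ` is.
  have key : ∑ n ∈ Finset.range N, √γ / (√(n + 1) * (n + 1 + γ)) ≤ 4 * (√N / (√N + √γ)) := by
    induction N with
    | zero => simp
    | succ n ih =>
      rw [Finset.sum_range_succ]
      refine (add_le_add ih le_rfl).trans ?_
      have hx := Real.sqrt_nonneg (n : ℝ)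
      have hy : 0 < √((n : ℝ) + 1) := Real.sqrt_pos.2 (by positivity)
      have hxx : √(n : ℝ) ^ 2 = n := Real.sq_sqrt (by positivity)
      have hyy : √((n : ℝ) + 1) ^ 2 = n + 1 := Real.sq_sqrt (by positivity)
      have hgg : √γ ^ 2 = γ := Real.sq_sqrt hγ.le
      have hxy : √(n : ℝ) ≤ √((n : ℝ) + 1) := Real.sqrt_le_sqrt (by linarith)
      push_cast
      set x := √(n : ℝ)
      set y := √((n : ℝ) + 1)
      set g := √γ
      have e : (n : ℝ) + 1 + γ = y ^ 2 + g ^ 2 := by rw [hyy, hgg]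
      rw [e]
      have hdiff : 4 * (y / (y + g)) - 4 * (x / (x + g)) = 4 * (g * (y - x)) / ((y + g) * (x + g)) := by
        field_simp; ring
      have h1 : 1 ≤ 2 * y * (y - x) := by nlinarith
      have h2 : g / (y * (y ^ 2 + g ^ 2)) ≤ 4 * (g * (y - x)) / ((y + g) * (x + g)) := by
        rw [div_le_div_iff₀ (by positivity) (by positivity)]
        have h3 : (y + g) * (x + g) ≤ 2 * (y ^ 2 + g ^ 2) := by nlinarith [sq_nonneg (y - g)]
        calc g * ((y + g) * (x + g)) ≤ g * (2 * (y ^ 2 + g ^ 2)) := by gcongr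
          _ = 2 * g * (y ^ 2 + g ^ 2) * 1 := by ring
          _ ≤ 2 * g * (y ^ 2 + g ^ 2) * (2 * y * (y - x)) := by gcongr
          _ = _ := by ring
      linarith
  refine key.trans ?_
  have : √(N : ℝ) / (√N + √γ) ≤ 1 := by
    rw [div_le_one (by positivity)]; linarith
  linarith

/-- Telescoping, since `(n + m)(n + m + 1) ≤ (n + m + 1/2)²`. -/
lemma tsum_one_div_add_rad_sq_le {m : ℕ} (hm : 1 ≤ m) :
    ∑' k : ℕ, ENNReal.ofReal (1 / (k + rad m) ^ 2) ≤ ENNReal.ofReal (1 / m) := by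
  refine ENNReal.tsum_le_of_sum_range_le fun N => ?_
  rw [← ENNReal.ofReal_sum_of_nonneg (fun n _ => by positivity)]
  refine ENNReal.ofReal_le_ofReal ?_
  have hm' : (1 : ℝ) ≤ m := by exact_mod_cast hm
  have key : ∑ k ∈ Finset.range N, 1 / ((k : ℝ) + rad m) ^ 2
      ≤ 1 / (m : ℝ) - 1 / (N + m) := by
    induction N with
    | zero => simp
    | succ n ih =>
      rw [Finset.sum_range_succ]
      have h1 : 1 / ((n : ℝ) + rad m) ^ 2 ≤ 1 / (n + m) - 1 / (n + 1 + m) := by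
        have hn : (0 : ℝ) ≤ n := Nat.cast_nonneg n
        rw [div_sub_div _ _ (by positivity) (by positivity), div_le_div_iff₀ (by
          have := rad_pos m; positivity) (by positivity), rad]
        nlinarith
      push_cast
      linarith
  refine key.trans ?_
  have : 0 ≤ 1 / ((N : ℝ) + m) := by positivity
  linarith

/-- The indices `j` and `k` are on different sides of `m + 1/2`. -/
def Opp (m j k : ℕ) : Prop := (j ≤ m ∧ m < k) ∨ (k ≤ m ∧ m < j)

instance (m j k : ℕ) : Decidable (Opp m j k) := by unfold Opp; infer_instance

/-- For `j = m - i` the distances to the indices `k > m` run through `i + 1, i + 2, …`, so each `j`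
contributes a tail of `b`. -/
lemma tsum_right_le (b : ℕ → ℝ≥0∞) (m : ℕ) :
    ∑' j, ∑' k, (if j ≤ m ∧ m < k then b (Nat.dist j k) else 0)
      ≤ ∑ i ∈ Finset.range (m + 1), ∑' n, b (n + (i + 1)) := by
  have h1 : ∀ j ≤ m, ∑' k, (if j ≤ m ∧ m < k then b (Nat.dist j k) else 0)
      = ∑' n, b (n + (m - j + 1)) := by
    intro j hj
    rw [← Summable.sum_add_tsum_nat_add' (k := m + 1) ENNReal.summable, Finset.sum_eq_zero, zero_add]
    · refine tsum_congr fun n => ?_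
      rw [if_pos ⟨hj, by omega⟩]
      congr 1
      rw [Nat.dist]; omega
    · intro k hk
      have := Finset.mem_range.1 hk
      rw [if_neg (by omega)]
  rw [← Summable.sum_add_tsum_nat_add' (k := m + 1) ENNReal.summable]
  have h2 : ∑' j : ℕ, ∑' k, (if j + (m + 1) ≤ m ∧ m < k then b (Nat.dist (j + (m + 1)) k) else 0) = 0 := by
    simp only [ENNReal.tsum_eq_zero]
    intro j k
    rw [if_neg (by omega)]
  rw [h2, add_zero, ← Finset.sum_range_reflect]
  refine le_of_eq (Finset.sum_congr rfl fun i hi => ?_)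
  have hi' : i ≤ m := Nat.lt_succ_iff.1 (Finset.mem_range.1 hi)
  rw [h1 _ (by omega)]
  congr 1
  funext n
  congr 1
  omega

lemma tsum_opp_le (b : ℕ → ℝ≥0∞) (m : ℕ) :
    ∑' j, ∑' k, (if Opp m j k then b (Nat.dist j k) else 0)
      ≤ 2 * ∑ i ∈ Finset.range (m + 1), ∑' n, b (n + (i + 1)) := by
  have h1 := tsum_right_le b m
  have h2 : ∑' j, ∑' k, (if k ≤ m ∧ m < j then b (Nat.dist j k) else 0)
      ≤ ∑ i ∈ Finset.range (m + 1), ∑' n, b (n + (i + 1)) := by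
    rw [ENNReal.tsum_comm]
    simpa only [Nat.dist_comm] using h1
  rw [two_mul]
  refine le_trans ?_ (add_le_add h1 h2)
  rw [← ENNReal.tsum_add]
  refine ENNReal.tsum_le_tsum fun j => ?_
  rw [← ENNReal.tsum_add]
  refine ENNReal.tsum_le_tsum fun k => ?_
  by_cases h3 : j ≤ m ∧ m < k
  · rw [if_pos (show Opp m j k from Or.inl h3), if_pos h3]
    exact le_self_add
  · by_cases h4 : k ≤ m ∧ m < j
    · rw [if_pos (show Opp m j k from Or.inr h4), if_pos h4]
      exact le_add_self
    · rw [if_neg (show ¬Opp m j k from not_or.2 ⟨h3, h4⟩)]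
      exact zero_le

/-- The mean of the tails of a sequence. -/
def meanTail (a : ℕ → ℝ) (m : ℕ) : ℝ≥0∞ :=
  ENNReal.ofReal (1 / m) * ∑ i ∈ Finset.range (m + 1), ∑' n, ENNReal.ofReal (a (n + (i + 1)) ^ 2)

/-- Cesàro means of the tails of a convergent series tend to zero; a factor `2` covers the change
from `1/m` to `1/(m + 1)`. -/
lemma tendsto_meanTail {a : ℕ → ℝ} (ha : sqSum a ≠ ⊤) : Tendsto (meanTail a) atTop (𝓝 0) := by
  have hle : ∀ i, ∑' n, ENNReal.ofReal (a (n + (i + 1)) ^ 2) ≤ sqSum a := fun i =>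
    ENNReal.tsum_comp_le_tsum_of_injective (f := fun n => n + (i + 1))
      (fun a b h => by simpa using h) (fun n => ENNReal.ofReal (a n ^ 2))
  have hfin : ∀ i, ∑' n, ENNReal.ofReal (a (n + (i + 1)) ^ 2) ≠ ⊤ := fun i =>
    ne_top_of_le_ne_top ha (hle i)
  have ht : Tendsto (fun i => (∑' n, ENNReal.ofReal (a (n + (i + 1)) ^ 2)).toReal) atTop (𝓝 0) := by
    have h1 := (ENNReal.tendsto_sum_nat_add (fun n => ENNReal.ofReal (a n ^ 2)) ha).comp
      (tendsto_add_atTop_nat 1)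
    exact (ENNReal.tendsto_toReal ENNReal.zero_ne_top).comp h1
  have hc := (ht.cesaro).comp (tendsto_add_atTop_nat 1)
  have h2 : Tendsto (fun m : ℕ => 2 * (((m + 1 : ℕ) : ℝ)⁻¹ *
      ∑ i ∈ Finset.range (m + 1), (∑' n, ENNReal.ofReal (a (n + (i + 1)) ^ 2)).toReal)) atTop (𝓝 0) := by
    simpa using hc.const_mul 2
  have h3 := ENNReal.tendsto_ofReal h2
  rw [ENNReal.ofReal_zero] at h3
  refine tendsto_of_tendsto_of_tendsto_of_le_of_le' tendsto_const_nhds h3 (by simp) ?_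
  filter_upwards [eventually_ge_atTop 1] with m hm
  have hm' : (1 : ℝ) ≤ m := by exact_mod_cast hm
  rw [meanTail, ← mul_assoc, ENNReal.ofReal_mul (by positivity),
    ENNReal.ofReal_sum_of_nonneg (fun _ _ => ENNReal.toReal_nonneg)]
  simp only [ENNReal.ofReal_toReal (hfin _)]
  gcongr
  push_cast
  rw [← div_eq_mul_inv, div_le_div_iff₀ (by positivity) (by positivity)]
  linarith

/-- Division by `|j - k| (j + k)` reduces the first summand of the majorant to `a_{|j-k|}/(j + k)`.
For indices on different sides `j + k ≥ m + 1`, so `j + k` is at least half of `k + r`, and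
Cauchy–Schwarz in `k` gains `1/m`. -/
lemma tsum_opp_diff_le (a : ℕ → ℝ) (ha : ∀ n, 0 ≤ a n) {m : ℕ} (hm : 1 ≤ m) :
    ∑' j, (∑' k, if Opp m j k then ENNReal.ofReal (a (Nat.dist j k) / (j + k : ℕ)) else 0) ^ 2
      ≤ 8 * meanTail a m := by
  have hr := rad_pos m
  have h1 : ∀ j, (∑' k, if Opp m j k then ENNReal.ofReal (a (Nat.dist j k) / (j + k : ℕ)) else 0) ^ 2
      ≤ (∑' k, if Opp m j k then ENNReal.ofReal (a (Nat.dist j k) ^ 2) else 0)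
        * (4 * ENNReal.ofReal (1 / m)) := by
    intro j
    calc _ ≤ (∑' k, (if Opp m j k then ENNReal.ofReal (a (Nat.dist j k)) else 0)
          * ENNReal.ofReal (2 * (1 / (k + rad m)))) ^ 2 := by
          gcongr with k
          split_ifs with h
          · rw [← ENNReal.ofReal_mul (ha _)]
            refine ENNReal.ofReal_le_ofReal ?_
            rw [div_eq_mul_one_div]
            refine mul_le_mul_of_nonneg_left ?_ (ha _)
            have hjk : (m : ℝ) + 1 ≤ (j + k : ℕ) := by
              have : m + 1 ≤ j + k := by unfold Opp at h; omega
              exact_mod_cast this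
            rw [mul_one_div, div_le_div_iff₀ (by linarith) (by positivity)]
            have hk : (k : ℝ) ≤ (j + k : ℕ) := by exact_mod_cast Nat.le_add_left k j
            have : rad m = m + 1 / 2 := rfl
            linarith
          · simp
      _ ≤ _ := by
          refine (ennreal_cauchy_schwarz _ _).trans (mul_le_mul' (le_of_eq ?_) ?_)
          · refine tsum_congr fun k => ?_
            split_ifs
            · rw [ENNReal.ofReal_pow (ha _)]
            · simp
          · calc _ = 4 * ∑' k : ℕ, ENNReal.ofReal (1 / (k + rad m) ^ 2) := by
                  rw [← ENNReal.tsum_mul_left]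
                  refine tsum_congr fun k => ?_
                  rw [← ENNReal.ofReal_pow (by positivity), ← ENNReal.ofReal_ofNat,
                    ← ENNReal.ofReal_mul (by norm_num)]
                  congr 1
                  rw [mul_pow, div_pow]; norm_num
              _ ≤ _ := by gcongr; exact tsum_one_div_add_rad_sq_le hm
  calc _ ≤ ∑' j, (∑' k, if Opp m j k then ENNReal.ofReal (a (Nat.dist j k) ^ 2) else 0)
        * (4 * ENNReal.ofReal (1 / m)) := ENNReal.tsum_le_tsum h1
    _ ≤ (2 * ∑ i ∈ Finset.range (m + 1), ∑' n, ENNReal.ofReal (a (n + (i + 1)) ^ 2))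
        * (4 * ENNReal.ofReal (1 / m)) := by
        rw [ENNReal.tsum_mul_right]
        gcongr
        exact tsum_opp_le (fun n => ENNReal.ofReal (a n ^ 2)) m
    _ = _ := by rw [meanTail]; ring

/-- On different sides `|j - k| = |j - r| + |k - r|`, which dominates each of the three summands on
the left. -/
lemma dist_ge_of_opp {m j k : ℕ} (h : Opp m j k) :
    (Nat.dist (j + k) (2 * m + 1) : ℝ) + 1 + |(j : ℝ) - rad m| ≤ 3 * Nat.dist j k := by
  unfold rad
  rcases h with ⟨h1, h2⟩ | ⟨h1, h2⟩
  · have e1 : (j : ℝ) ≤ m := by exact_mod_cast h1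
    have e2 : (m : ℝ) + 1 ≤ k := by exact_mod_cast h2
    have e3 : (Nat.dist j k : ℝ) = k - j := by
      rw [Nat.dist_eq_sub_of_le (by omega), Nat.cast_sub (by omega)]
    rw [abs_of_nonpos (by linarith), e3]
    rcases le_total (j + k) (2 * m + 1) with h | h
    · rw [Nat.dist_eq_sub_of_le h, Nat.cast_sub h]; push_cast; linarith
    · rw [Nat.dist_eq_sub_of_le_right h, Nat.cast_sub h]; push_cast; linarith
  · have e1 : (k : ℝ) ≤ m := by exact_mod_cast h1
    have e2 : (m : ℝ) + 1 ≤ j := by exact_mod_cast h2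
    have e3 : (Nat.dist j k : ℝ) = j - k := by
      rw [Nat.dist_eq_sub_of_le_right (by omega), Nat.cast_sub (by omega)]
    rw [abs_of_nonneg (by linarith), e3]
    rcases le_total (j + k) (2 * m + 1) with h | h
    · rw [Nat.dist_eq_sub_of_le h, Nat.cast_sub h]; push_cast; linarith
    · rw [Nat.dist_eq_sub_of_le_right h, Nat.cast_sub h]; push_cast; linarith

/-- Only the tail occurs, since `j + k > m`. By `dist_ge_of_opp` the factor `1/|j - k|` is bounded
by a Hilbert-type kernel in `|j - r|` and `|j + k - 2r|`, to which a Schur test applies. -/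
lemma tsum_opp_sum_le (a : ℕ → ℝ) (ha : ∀ n, 0 ≤ a n) (m : ℕ) :
    ∑' j, (∑' k, if Opp m j k then ENNReal.ofReal (a (j + k) / Nat.dist j k) else 0) ^ 2
      ≤ 2304 * sqSum (tailSeq a m) := by
  let c := tailSeq a m
  have hc : ∀ n, 0 ≤ c n := fun n => by
    simp only [c, tailSeq]; split_ifs
    · exact ha n
    · exact le_rfl
  let e : ℕ → ℕ := fun s => Nat.dist s (2 * m + 1)
  let β : ℕ → ℝ := fun j => |(j : ℝ) - rad m|
  have hβ : ∀ j, 0 < β j := fun j => by linarith [half_le_abs_sub_rad m j]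
  -- Schur weights whose product is `(n + 1 + γ)⁻²`. The weight `w` is summed over `k`; `v` is `w`
  -- with the roles of `γ` and `n + 1` exchanged and is summed over `j`.
  let w : ℝ → ℕ → ℝ := fun γ n => √γ / (√(n + 1) * (n + 1 + γ))
  let v : ℝ → ℕ → ℝ := fun γ n => √(n + 1) / (√γ * (n + 1 + γ))
  have hw1 : ∀ j, ∑' k, ENNReal.ofReal (w (β j) (e (j + k))) ≤ 8 := by
    intro j
    refine (tsum_add_le (fun s => ENNReal.ofReal (w (β j) (e s))) j).trans ?_
    have h2 := tsum_natDist_le (fun n => ENNReal.ofReal (w (β j) n)) (2 * m + 1)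
    simp only [Nat.dist_comm (2 * m + 1)] at h2
    refine h2.trans ?_
    calc _ ≤ (2 : ℝ≥0∞) * 4 := by gcongr; exact tsum_sqrt_div_le (hβ j)
      _ = 8 := by norm_num
  have hv : ∀ n : ℕ, ∑' j, ENNReal.ofReal (v (β j) n) ≤ 32 := by
    intro n
    refine (tsum_dist_half_le (fun x => ENNReal.ofReal (v x n)) m).trans ?_
    have hn : (0 : ℝ) < n + 1 := by positivity
    calc _ ≤ 2 * ∑' i : ℕ, 4 * ENNReal.ofReal (w (n + 1) i) := by
          gcongr with i
          rw [← ENNReal.ofReal_ofNat, ← ENNReal.ofReal_mul (by norm_num)]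
          refine ENNReal.ofReal_le_ofReal ?_
          simp only [v, w]
          have hi : (0 : ℝ) ≤ i := Nat.cast_nonneg i
          have s1 : √((i : ℝ) + 1) ≤ 2 * √((i : ℝ) + 1 / 2) := by
            rw [Real.sqrt_le_left (by positivity), mul_pow, Real.sq_sqrt (by positivity)]; linarith
          have s0 : 0 < √((i : ℝ) + 1) := Real.sqrt_pos.2 (by positivity)
          have s2 : 0 < √((i : ℝ) + 1 / 2) := Real.sqrt_pos.2 (by positivity)
          rw [mul_div_assoc', div_le_div_iff₀ (by positivity) (by positivity)]
          have h3 : √((i : ℝ) + 1) * (i + 1 + (n + 1)) ≤ (2 * √((i : ℝ) + 1 / 2)) * (2 * (n + 1 + (i + 1 / 2))) :=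
            mul_le_mul s1 (by linarith) (by positivity) (by positivity)
          have := mul_le_mul_of_nonneg_left h3 (Real.sqrt_nonneg ((n : ℝ) + 1))
          linarith
      _ ≤ 2 * (4 * 4) := by
          rw [ENNReal.tsum_mul_left]
          gcongr
          exact tsum_sqrt_div_le hn
      _ = 32 := by norm_num
  have h1 : ∀ j, (∑' k, if Opp m j k then ENNReal.ofReal (a (j + k) / Nat.dist j k) else 0) ^ 2
      ≤ (∑' k, 9 * ENNReal.ofReal (c (j + k) ^ 2 * v (β j) (e (j + k)))) * 8 := by
    intro j
    have hb := hβ j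
    have hsb := Real.sqrt_pos.2 hb
    have hvp : ∀ n, 0 ≤ v (β j) n := fun n => by simp only [v]; positivity
    have hwp : ∀ n, 0 ≤ w (β j) n := fun n => by simp only [w]; positivity
    have hvw : ∀ n : ℕ, √(v (β j) n) * √(w (β j) n) = 1 / (n + 1 + β j) := by
      intro n
      rw [← Real.sqrt_mul (hvp n)]
      have hn : 0 < √((n : ℝ) + 1) := Real.sqrt_pos.2 (by positivity)
      rw [show v (β j) n * w (β j) n = (1 / (n + 1 + β j)) ^ 2 by simp only [v, w]; field_simp]
      exact Real.sqrt_sq (by positivity)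
    calc _ ≤ (∑' k, ENNReal.ofReal (3 * c (j + k) * √(v (β j) (e (j + k))))
          * ENNReal.ofReal (√(w (β j) (e (j + k))))) ^ 2 := by
          gcongr with k
          split_ifs with h
          · have hck := hc (j + k)
            rw [← ENNReal.ofReal_mul (by positivity)]
            refine ENNReal.ofReal_le_ofReal ?_
            rw [mul_assoc, hvw]
            have hce : c (j + k) = a (j + k) := by
              simp only [c, tailSeq]
              rw [if_pos (by unfold Opp at h; omega)]
            rw [hce, mul_one_div]
            have hd := dist_ge_of_opp h
            have hdp : (0 : ℝ) < Nat.dist j k := by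
              have : 0 < (e (j + k) : ℝ) + 1 + β j := by positivity
              have h9 : 0 < 3 * (Nat.dist j k : ℝ) := this.trans_le hd
              linarith
            rw [div_le_div_iff₀ hdp (by positivity)]
            have := mul_le_mul_of_nonneg_left hd (ha (j + k))
            simp only [e, β]
            linarith
          · simp
      _ ≤ _ := by
          refine (ennreal_cauchy_schwarz _ _).trans (mul_le_mul' (le_of_eq ?_) ?_)
          · refine tsum_congr fun k => ?_
            have hck := hc (j + k)
            rw [← ENNReal.ofReal_pow (by positivity), mul_pow, mul_pow, Real.sq_sqrt (hvp _),
              mul_assoc, ENNReal.ofReal_mul (by norm_num)]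
            norm_num
          · refine le_trans (le_of_eq (tsum_congr fun k => ?_)) (hw1 j)
            rw [← ENNReal.ofReal_pow (by positivity), Real.sq_sqrt (hwp _)]
  calc _ ≤ ∑' j, (∑' k, 9 * ENNReal.ofReal (c (j + k) ^ 2 * v (β j) (e (j + k)))) * 8 :=
        ENNReal.tsum_le_tsum h1
    _ ≤ (∑' j, ∑' s, 9 * ENNReal.ofReal (c s ^ 2 * v (β j) (e s))) * 8 := by
        rw [ENNReal.tsum_mul_right]
        refine mul_le_mul' (ENNReal.tsum_le_tsum fun j => ?_) le_rfl
        exact tsum_add_le (fun s => 9 * ENNReal.ofReal (c s ^ 2 * v (β j) (e s))) j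
    _ = (9 * ∑' s, ENNReal.ofReal (c s ^ 2) * ∑' j, ENNReal.ofReal (v (β j) (e s))) * 8 := by
        rw [ENNReal.tsum_comm, ← ENNReal.tsum_mul_left]
        congr 1
        refine tsum_congr fun s => ?_
        rw [← ENNReal.tsum_mul_left, ← ENNReal.tsum_mul_left]
        refine tsum_congr fun j => ?_
        rw [ENNReal.ofReal_mul (sq_nonneg _)]
    _ ≤ (9 * ∑' s, ENNReal.ofReal (c s ^ 2) * 32) * 8 := by
        gcongr with s
        exact hv _
    _ = _ := by
        rw [ENNReal.tsum_mul_right, sqSum]; ring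

/-- The coefficient of the bound of the term of first order. -/
def firstConst (u : ℝ → ℂ) (m : ℕ) : ℝ≥0∞ :=
  2 * (8 * meanTail (coeffAbs u) m) + 2 * (2304 * sqSum (tailSeq (coeffAbs u) m))

lemma tendsto_firstConst {u : ℝ → ℂ} (hu : MemL2 u) : Tendsto (firstConst u) atTop (𝓝 0) := by
  have h1 := ENNReal.Tendsto.const_mul (a := 2) (ENNReal.Tendsto.const_mul (a := 8)
    (tendsto_meanTail (sqSum_coeffAbs_ne_top hu)) (Or.inr (by norm_num))) (Or.inr (by norm_num))
  have h2 := ENNReal.Tendsto.const_mul (a := 2) (ENNReal.Tendsto.const_mul (a := 2304)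
    (tendsto_sqSum_tailSeq (sqSum_coeffAbs_ne_top hu)) (Or.inr (by norm_num))) (Or.inr (by norm_num))
  have h3 := h1.add h2
  rw [mul_zero, mul_zero, mul_zero, mul_zero, add_zero] at h3
  exact h3

/-- For each `j` the sum over `k` splits according to the two summands of the majorant;
Cauchy–Schwarz in `j` then separates the potential from `f`. -/
lemma tsum_opp_first_order_sq_le {u f : ℝ → ℂ} (hf : MemL2 f) {m : ℕ} (hm : 1 ≤ m) :
    (∑' k, ∑' j, if Opp m j k then ENNReal.ofReal (qmaj (coeffAbs u) j k * coeffAbs f j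
      / (Nat.dist j k * (j + k : ℕ))) else 0) ^ 2
      ≤ firstConst u m * ENNReal.ofReal (normL2 f ^ 2) := by
  set a := coeffAbs u with ha
  have ha0 : ∀ n, 0 ≤ a n := coeffAbs_nonneg u
  let X : ℕ → ℝ≥0∞ := fun j =>
    ∑' k, if Opp m j k then ENNReal.ofReal (a (Nat.dist j k) / (j + k : ℕ)) else 0
  let Y : ℕ → ℝ≥0∞ := fun j =>
    ∑' k, if Opp m j k then ENNReal.ofReal (a (j + k) / Nat.dist j k) else 0
  have h1 : ∀ j, ∑' k, (if Opp m j k then ENNReal.ofReal (qmaj a j k * coeffAbs f j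
      / (Nat.dist j k * (j + k : ℕ))) else 0) = (X j + Y j) * ENNReal.ofReal (coeffAbs f j) := by
    intro j
    rw [← ENNReal.tsum_add, ← ENNReal.tsum_mul_right]
    refine tsum_congr fun k => ?_
    split_ifs with h
    · have h2 : Nat.dist j k ≠ 0 := by unfold Opp at h; unfold Nat.dist; omega
      have h3 : j + k ≠ 0 := by unfold Opp at h; omega
      have h2' : (Nat.dist j k : ℝ) ≠ 0 := by exact_mod_cast h2
      have h3' : ((j + k : ℕ) : ℝ) ≠ 0 := by exact_mod_cast h3
      rw [← ENNReal.ofReal_add (div_nonneg (ha0 _) (Nat.cast_nonneg _))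
        (div_nonneg (ha0 _) (Nat.cast_nonneg _)), ← ENNReal.ofReal_mul (add_nonneg
        (div_nonneg (ha0 _) (Nat.cast_nonneg _)) (div_nonneg (ha0 _) (Nat.cast_nonneg _)))]
      congr 1
      rw [qmaj]
      field_simp
    · simp
  rw [ENNReal.tsum_comm]
  simp only [h1]
  refine (ennreal_cauchy_schwarz _ _).trans (mul_le_mul' ?_ (le_of_eq ?_))
  · calc ∑' j, (X j + Y j) ^ 2 ≤ ∑' j, (2 * X j ^ 2 + 2 * Y j ^ 2) :=
          ENNReal.tsum_le_tsum fun j => ennreal_add_sq_le _ _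
      _ = 2 * ∑' j, X j ^ 2 + 2 * ∑' j, Y j ^ 2 := by
          rw [ENNReal.tsum_add, ENNReal.tsum_mul_left, ENNReal.tsum_mul_left]
      _ ≤ _ := by
          rw [firstConst]
          exact add_le_add (mul_le_mul' le_rfl (tsum_opp_diff_le a ha0 hm))
            (mul_le_mul' le_rfl (tsum_opp_sum_le a ha0 m))
  · rw [← sqSum_coeffAbs hf, sqSum]
    exact tsum_congr fun j => (ENNReal.ofReal_pow (coeffAbs_nonneg f j) 2).symm

/-! ### Contour integrals -/

lemma hasSum_circleIntegral {ι : Type*} [Countable ι] {R : ℝ} (hR : 0 ≤ R) {g : ι → ℂ → ℂ}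
    {B : ι → ℝ} (hB : Summable B) (hg : ∀ i, ContinuousOn (g i) (Metric.sphere 0 R))
    (hle : ∀ i, ∀ z ∈ Metric.sphere (0 : ℂ) R, ‖g i z‖ ≤ B i) :
    HasSum (fun i => ∮ z in C(0, R), g i z) (∮ z in C(0, R), ∑' i, g i z) := by
  have hmem : ∀ θ : ℝ, circleMap 0 R θ ∈ Metric.sphere (0 : ℂ) R := circleMap_mem_sphere 0 hR
  refine intervalIntegral.hasSum_integral_of_dominated_convergence (fun i _ => R * B i) ?_ ?_ ?_ ?_ ?_
  · intro i
    exact ((hg i).circleIntegrable hR).out.aestronglyMeasurable_restrict_uIoc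
  · refine fun i => Eventually.of_forall fun θ _ => ?_
    rw [norm_smul, deriv_circleMap]
    simp only [norm_mul, norm_circleMap_zero, Complex.norm_I, mul_one, abs_of_nonneg hR]
    exact mul_le_mul_of_nonneg_left (hle i _ (hmem θ)) hR
  · exact Eventually.of_forall fun θ _ => hB.mul_left R
  · exact intervalIntegrable_const
  · refine Eventually.of_forall fun θ _ => ?_
    have hs : Summable fun i => g i (circleMap 0 R θ) :=
      Summable.of_norm_bounded hB fun i => hle i _ (hmem θ)
    exact hs.hasSum.const_smul _

lemma circleIntegral_inv_of_lt {R : ℝ} {a : ℂ} (ha : ‖a‖ < R) :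
    ∮ z in C(0, R), (a - z)⁻¹ = -(2 * Real.pi * Complex.I) := by
  have h := circleIntegral.integral_sub_inv_of_mem_ball (c := 0) (w := a) (R := R) (by simpa using ha)
  rw [← h, ← neg_one_mul, ← circleIntegral.integral_const_mul]
  refine congrArg (fun F : ℂ → ℂ => circleIntegral F 0 R) (funext fun z => ?_)
  rw [← neg_sub z a, inv_neg, neg_one_mul]

lemma circleIntegral_inv_of_gt {R : ℝ} (hR : 0 ≤ R) {a : ℂ} (ha : R < ‖a‖) :
    ∮ z in C(0, R), (a - z)⁻¹ = 0 := by
  have hne : ∀ z ∈ Metric.closedBall (0 : ℂ) R, a - z ≠ 0 := by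
    intro z hz h
    rw [sub_eq_zero] at h
    rw [← h] at hz
    simp at hz
    linarith
  refine Complex.circleIntegral_eq_zero_of_differentiable_on_off_countable hR countable_empty ?_ ?_
  · exact (continuousOn_const.sub continuousOn_id).inv₀ hne
  · intro z hz
    have := hne z (Metric.ball_subset_closedBall hz.1)
    have h2 : DifferentiableAt ℂ (fun z : ℂ => a - z) z := by fun_prop
    exact h2.inv this

lemma circleIntegral_inv_sq (R : ℝ) (a : ℂ) :
    ∮ z in C(0, R), ((a - z) * (a - z))⁻¹ = 0 := by
  have h := circleIntegral.integral_sub_zpow_of_ne (n := -2) (by norm_num) 0 a R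
  refine Eq.trans ?_ h
  refine congrArg (fun F : ℂ → ℂ => circleIntegral F 0 R) (funext fun z => ?_)
  rw [zpow_neg, ← neg_sub z a, neg_mul_neg]
  congr 1
  rw [← sq]; norm_cast

lemma circleIntegral_inv_mul {R : ℝ} (hR : 0 ≤ R) {a b : ℂ} (hab : a ≠ b) (ha : ‖a‖ ≠ R)
    (hb : ‖b‖ ≠ R) : ∮ z in C(0, R), ((a - z) * (b - z))⁻¹
      = (b - a)⁻¹ * ((∮ z in C(0, R), (a - z)⁻¹) - ∮ z in C(0, R), (b - z)⁻¹) := by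
  have hne : ∀ {c : ℂ}, ‖c‖ ≠ R → ∀ z ∈ Metric.sphere (0 : ℂ) R, c - z ≠ 0 := by
    intro c hc z hz h
    rw [sub_eq_zero] at h
    rw [← h] at hz
    exact hc (by simpa using hz)
  have hci : ∀ {c : ℂ}, ‖c‖ ≠ R → CircleIntegrable (fun z => (c - z)⁻¹) 0 R := fun hc =>
    ((continuousOn_const.sub continuousOn_id).inv₀ (hne hc)).circleIntegrable hR
  rw [← circleIntegral.integral_sub (hci ha) (hci hb), ← circleIntegral.integral_const_mul]
  refine circleIntegral.integral_congr hR fun z hz => ?_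
  have h1 := hne ha z hz
  have h2 := hne hb z hz
  have h3 : b - a ≠ 0 := sub_ne_zero.2 hab.symm
  field_simp
  ring

lemma norm_sq_lt_iff (m j : ℕ) : ‖(j : ℂ) ^ 2‖ < rad m ^ 2 ↔ j ≤ m := by
  rw [norm_pow, Complex.norm_natCast, pow_lt_pow_iff_left₀ (by positivity) (rad_pos m).le (by norm_num),
    rad]
  constructor
  · intro h
    by_contra! hlt
    have : (m : ℝ) + 1 ≤ j := by exact_mod_cast hlt
    linarith
  · intro h
    have : (j : ℝ) ≤ m := by exact_mod_cast h
    linarith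

lemma norm_sq_gt_of_lt {m j : ℕ} (h : m < j) : rad m ^ 2 < ‖(j : ℂ) ^ 2‖ := by
  rw [norm_pow, Complex.norm_natCast]
  refine pow_lt_pow_left₀ ?_ (rad_pos m).le (by norm_num)
  have : (m : ℝ) + 1 ≤ j := by exact_mod_cast h
  rw [rad]; linarith

lemma norm_sq_ne (m j : ℕ) : ‖(j : ℂ) ^ 2‖ ≠ rad m ^ 2 := by
  rcases le_or_gt j m with h | h
  · exact ((norm_sq_lt_iff m j).2 h).ne
  · exact (norm_sq_gt_of_lt h).ne'

lemma circleIntegral_free (m j : ℕ) :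
    ∮ z in C(0, rad m ^ 2), ((j : ℂ) ^ 2 - z)⁻¹
      = if j ≤ m then -(2 * Real.pi * Complex.I) else 0 := by
  split_ifs with h
  · exact circleIntegral_inv_of_lt ((norm_sq_lt_iff m j).2 h)
  · exact circleIntegral_inv_of_gt (by positivity) (norm_sq_gt_of_lt (not_le.1 h))

lemma norm_two_pi_I_eq : ‖-(2 * Real.pi * Complex.I)‖ = 2 * Real.pi := by
  rw [norm_neg, norm_mul, norm_mul, Complex.norm_I, mul_one, Complex.norm_real,
    Real.norm_of_nonneg Real.pi_pos.le]
  norm_num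

/-- Partial fractions give the difference of two free integrals divided by `k² - j²`. They cancel
unless exactly one of the two poles is inside the circle; for `j = k` the double pole has no
residue. -/
lemma norm_circleIntegral_free_mul_le (m j k : ℕ) :
    ‖∮ z in C(0, rad m ^ 2), (((j : ℂ) ^ 2 - z) * ((k : ℂ) ^ 2 - z))⁻¹‖
      ≤ if Opp m j k then 2 * Real.pi / (Nat.dist j k * (j + k : ℕ)) else 0 := by
  by_cases hjk : j = k
  · subst hjk
    rw [circleIntegral_inv_sq, norm_zero]
    split_ifs <;> positivity
  have hne : (j : ℂ) ^ 2 ≠ (k : ℂ) ^ 2 := by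
    intro h
    have : j ^ 2 = k ^ 2 := by exact_mod_cast h
    exact hjk (Nat.pow_left_injective (n := 2) (by norm_num) this)
  rw [circleIntegral_inv_mul (by positivity) hne (norm_sq_ne m j) (norm_sq_ne m k),
    circleIntegral_free, circleIntegral_free, norm_mul, norm_inv]
  have hd : ‖(k : ℂ) ^ 2 - (j : ℂ) ^ 2‖ = Nat.dist j k * (j + k : ℕ) := by
    rw [show (k : ℂ) ^ 2 - (j : ℂ) ^ 2 = ((k : ℂ) - j) * (j + k) by ring, norm_mul]
    congr 1
    · rcases le_total j k with h | h
      · rw [Nat.dist_eq_sub_of_le h, ← Nat.cast_sub h, Complex.norm_natCast]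
      · rw [Nat.dist_eq_sub_of_le_right h, norm_sub_rev, ← Nat.cast_sub h, Complex.norm_natCast]
    · rw [← Nat.cast_add, Complex.norm_natCast]
  rw [hd]
  by_cases h1 : j ≤ m <;> by_cases h2 : k ≤ m
  · rw [if_pos h1, if_pos h2, if_neg (by unfold Opp; omega)]; simp
  · rw [if_pos h1, if_neg h2, if_pos (by unfold Opp; omega), sub_zero, norm_two_pi_I_eq,
      inv_mul_eq_div]
  · rw [if_neg h1, if_pos h2, if_pos (by unfold Opp; omega), zero_sub, norm_neg, norm_two_pi_I_eq,
      inv_mul_eq_div]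
  · rw [if_neg h1, if_neg h2, if_neg (by unfold Opp; omega)]; simp

/-! ### The integral of the remainder over the circle -/

lemma offs_circleMap (m : ℕ) (θ : ℝ) :
    offs m (circleMap 0 (rad m ^ 2) θ) = rad m * |Real.sin (θ / 2)| := by
  have hr := rad_pos m
  have e : circleMap 0 (rad m ^ 2) θ - (rad m : ℂ) ^ 2
      = (rad m : ℂ) ^ 2 * (Complex.exp (Complex.I * θ) - 1) := by
    rw [circleMap, zero_add, mul_comm (θ : ℂ)]; push_cast; ring
  rw [offs, e, norm_mul, norm_rad_sq, Complex.norm_exp_I_mul_ofReal_sub_one, norm_mul,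
    Real.norm_eq_abs, Real.norm_eq_abs]
  norm_num
  field_simp

/-- After rescaling, the exponent below `-1` makes the integral bounded independently of `r`: it is
at most `16 π (1/2)^{-1/16}`. -/
lemma integral_weight_le {r : ℝ} (hr : 0 < r) :
    ∫ θ in (0 : ℝ)..2 * Real.pi, r * (r / Real.pi * θ + 1 / 2) ^ (-(17 / 16) : ℝ) ≤ 32 * Real.pi := by
  have hπ := Real.pi_pos
  have hc : r / Real.pi ≠ 0 := by positivity
  rw [intervalIntegral.integral_const_mul,
    intervalIntegral.integral_comp_mul_add (fun x => x ^ (-(17 / 16) : ℝ)) hc,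
    integral_rpow (Or.inr ⟨by norm_num, ?_⟩)]
  · rw [smul_eq_mul]
    have e : (r / Real.pi * 0 + 1 / 2 : ℝ) = 1 / 2 := by ring
    rw [e]
    have h1 : 0 ≤ (r / Real.pi * (2 * Real.pi) + 1 / 2) ^ (-(17 / 16) + 1 : ℝ) := by positivity
    have h2 : (1 / 2 : ℝ) ^ (-(17 / 16) + 1 : ℝ) ≤ 2 := by
      rw [one_div, Real.inv_rpow (by norm_num), ← Real.rpow_neg (by norm_num)]
      calc (2 : ℝ) ^ (-(-(17 / 16) + 1) : ℝ) ≤ 2 ^ (1 : ℝ) :=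
            Real.rpow_le_rpow_of_exponent_le (by norm_num) (by norm_num)
        _ = 2 := by norm_num
    set X := (r / Real.pi * (2 * Real.pi) + 1 / 2) ^ (-(17 / 16) + 1 : ℝ)
    set Y := (1 / 2 : ℝ) ^ (-(17 / 16) + 1 : ℝ)
    have e2 : r * ((r / Real.pi)⁻¹ * ((X - Y) / (-(17 / 16) + 1))) = Real.pi * (16 * (Y - X)) := by
      field_simp
      ring
    rw [e2]
    nlinarith
  · rw [uIcc_of_le (by have : 0 ≤ r / Real.pi * (2 * Real.pi) := by positivity
                       linarith)]
    intro h
    have := h.1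
    linarith

lemma continuous_weight {r : ℝ} (hr : 0 < r) :
    ContinuousOn (fun θ : ℝ => r * (r / Real.pi * θ + 1 / 2) ^ (-(17 / 16) : ℝ))
      (uIcc 0 (2 * Real.pi)) := by
  have hπ := Real.pi_pos
  rw [uIcc_of_le (by positivity)]
  refine continuousOn_const.mul (ContinuousOn.rpow_const (by fun_prop) fun θ hθ => Or.inl ?_)
  have : 0 ≤ r / Real.pi * θ := mul_nonneg (by positivity) hθ.1
  linarith

/-- Jordan's inequality bounds the sine from below by a linear function on each half of the circle;
the two summands serve `θ ≤ π` and `θ ≥ π`. -/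
lemma weight_le {r θ : ℝ} (hr : 0 < r) (hθ : θ ∈ Ioc 0 (2 * Real.pi)) :
    r * (r * |Real.sin (θ / 2)| + 1 / 2) ^ (-(17 / 16) : ℝ)
      ≤ r * (r / Real.pi * θ + 1 / 2) ^ (-(17 / 16) : ℝ)
        + r * (r / Real.pi * (2 * Real.pi - θ) + 1 / 2) ^ (-(17 / 16) : ℝ) := by
  have hπ := Real.pi_pos
  have key : ∀ t : ℝ, 0 ≤ t → t ≤ Real.pi → t / Real.pi ≤ |Real.sin (t / 2)| := by
    intro t h0 h1
    have := Real.mul_le_sin (x := t / 2) (by linarith) (by linarith)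
    refine le_trans (le_of_eq ?_) (this.trans (le_abs_self _))
    field_simp
  have h1 : 0 ≤ (r / Real.pi * θ + 1 / 2) ^ (-(17 / 16) : ℝ) := by
    have : 0 ≤ r / Real.pi * θ := mul_nonneg (by positivity) hθ.1.le
    positivity
  have h2 : 0 ≤ (r / Real.pi * (2 * Real.pi - θ) + 1 / 2) ^ (-(17 / 16) : ℝ) := by
    have : 0 ≤ r / Real.pi * (2 * Real.pi - θ) := mul_nonneg (by positivity) (by linarith [hθ.2])
    positivity
  rw [← mul_add]
  refine mul_le_mul_of_nonneg_left ?_ hr.le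
  have mono : ∀ t : ℝ, 0 ≤ t → t / Real.pi ≤ |Real.sin (θ / 2)| →
      (r * |Real.sin (θ / 2)| + 1 / 2) ^ (-(17 / 16) : ℝ) ≤ (r / Real.pi * t + 1 / 2) ^ (-(17 / 16) : ℝ) := by
    intro t ht hle
    have h3 : 0 ≤ r / Real.pi * t := by positivity
    refine Real.rpow_le_rpow_of_nonpos (by linarith) ?_ (by norm_num)
    have := mul_le_mul_of_nonneg_left hle hr.le
    have e : r / Real.pi * t = r * (t / Real.pi) := by ring
    linarith
  rcases le_total θ Real.pi with h | h
  · exact le_add_of_le_of_nonneg (mono θ hθ.1.le (key θ hθ.1.le h)) h2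
  · refine le_add_of_nonneg_of_le h1 (mono _ (by linarith [hθ.2]) ?_)
    have h3 := key (2 * Real.pi - θ) (by linarith [hθ.2]) (by linarith)
    rwa [show (2 * Real.pi - θ) / 2 = Real.pi - θ / 2 by ring, Real.sin_pi_sub] at h3

/-- A contour integral of a function bounded by `B / (r τ^{17/16})`. -/
lemma norm_circleIntegral_le_of_weight {m : ℕ} {F : ℂ → ℂ} {B : ℝ} (hB : 0 ≤ B)
    (hF : ∀ z : ℂ, ‖z‖ = rad m ^ 2 → ‖F z‖ ≤ B / (rad m * (offs m z + 1 / 2) ^ (17 / 16 : ℝ))) :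
    ‖∮ z in C(0, rad m ^ 2), F z‖ ≤ 64 * Real.pi * B := by
  have hr := rad_pos m
  have hπ := Real.pi_pos
  set g : ℝ → ℝ := fun θ => rad m * (rad m / Real.pi * θ + 1 / 2) ^ (-(17 / 16) : ℝ) with hg
  have i1 : IntervalIntegrable g volume 0 (2 * Real.pi) := (continuous_weight hr).intervalIntegrable
  have i2 : IntervalIntegrable (fun θ => g (2 * Real.pi - θ)) volume 0 (2 * Real.pi) := by
    have := i1.comp_sub_left (2 * Real.pi)
    simpa using this.symm
  calc ‖∮ z in C(0, rad m ^ 2), F z‖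
      ≤ ∫ θ in (0 : ℝ)..2 * Real.pi, B * (g θ + g (2 * Real.pi - θ)) := by
        refine intervalIntegral.norm_integral_le_of_norm_le (by positivity)
          (Eventually.of_forall fun θ hθ => ?_) ((i1.add i2).const_mul B)
        have hz : ‖circleMap 0 (rad m ^ 2) θ‖ = rad m ^ 2 := by
          rw [norm_circleMap_zero, abs_of_nonneg (by positivity)]
        have h1 := hF _ hz
        rw [norm_smul, deriv_circleMap, norm_mul, Complex.norm_I, mul_one, hz]
        refine (mul_le_mul_of_nonneg_left h1 (by positivity)).trans ?_
        rw [offs_circleMap]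
        have hτ : 0 ≤ rad m * |Real.sin (θ / 2)| + 1 / 2 := by positivity
        have e : rad m ^ 2 * (B / (rad m * (rad m * |Real.sin (θ / 2)| + 1 / 2) ^ (17 / 16 : ℝ)))
            = B * (rad m * (rad m * |Real.sin (θ / 2)| + 1 / 2) ^ (-(17 / 16) : ℝ)) := by
          rw [Real.rpow_neg hτ]; field_simp
        rw [e]
        exact mul_le_mul_of_nonneg_left (weight_le hr hθ) hB
    _ = B * ((∫ θ in (0 : ℝ)..2 * Real.pi, g θ) + ∫ θ in (0 : ℝ)..2 * Real.pi, g (2 * Real.pi - θ)) := by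
        rw [intervalIntegral.integral_const_mul, intervalIntegral.integral_add i1 i2]
    _ = B * ((∫ θ in (0 : ℝ)..2 * Real.pi, g θ) + ∫ θ in (0 : ℝ)..2 * Real.pi, g θ) := by
        rw [intervalIntegral.integral_comp_sub_left]; simp
    _ ≤ B * (32 * Real.pi + 32 * Real.pi) := by
        have := integral_weight_le hr
        gcongr
    _ = _ := by ring

/-! ### The resolvent and the Riesz projections -/

lemma eq_zero_of_integral_eq_zero {φ : ℝ → ℂ} (hφ : Continuous φ)
    (h : ∀ x ∈ Icc (0 : ℝ) Real.pi, ∫ t in (0 : ℝ)..x, φ t = 0) {x : ℝ}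
    (hx : x ∈ Icc (0 : ℝ) Real.pi) : φ x = 0 := by
  have hin : ∀ y ∈ Ioo (0 : ℝ) Real.pi, φ y = 0 := by
    intro y hy
    have h1 := intervalIntegral.integral_hasDerivAt_right (hφ.intervalIntegrable 0 y)
      (hφ.stronglyMeasurableAtFilter _ _) hφ.continuousAt
    have h2 : (fun x => ∫ t in (0 : ℝ)..x, φ t) =ᶠ[𝓝 y] fun _ => 0 := by
      filter_upwards [Icc_mem_nhds hy.1 hy.2] with x hx using h x hx
    exact h1.unique ((hasDerivAt_const y (0 : ℂ)).congr_of_eventuallyEq h2)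
  have hcl : IsClosed {x | φ x = 0} := isClosed_eq hφ continuous_const
  have h3 : closure (Ioo (0 : ℝ) Real.pi) ⊆ {x | φ x = 0} := closure_minimal hin hcl
  rw [closure_Ioo Real.pi_pos.ne] at h3
  exact h3 hx

/-! ### The characteristic function `ω(π, z)`, the resolvent and its contour integrals -/

variable {u : ℝ → ℂ}

/-- If `y = 0`, the first equation says that every primitive of `y^[1]` vanishes. A nonzero solution
pair therefore has a nonzero first component. -/
lemma fst_eq_zero_imp {u : ℝ → ℂ} {Y : CI2} {g : ℝ → ℂ}
    (hq : QuasiDiff u (ext Y.1) (ext Y.2) g) (h : Y.1 = 0) : Y.2 = 0 := by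
  have h0 : ∀ x, ext Y.1 x = 0 := fun x => by rw [h]; rfl
  ext x
  rw [← ext_coe]
  refine eq_zero_of_integral_eq_zero (continuous_ext Y.2) (fun x hx => ?_) x.2
  have := hq.eq x hx
  simpa [h0] using this.symm

/-- The initial data `y(0) = 0`, `y^[1](0) = 1`. -/
def unitData : CI2 := (0, 1)

/-- Evaluation of the first component at `π`. -/
def evPi : CI2 →L[ℂ] ℂ :=
  (ContinuousMap.evalCLM ℂ (⟨Real.pi, pi_mem_I⟩ : Icc (0 : ℝ) Real.pi)).comp
    (ContinuousLinearMap.fst ℂ CI CI)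

lemma evPi_apply (Y : CI2) : evPi Y = ext Y.1 Real.pi := (ext_of_mem Y.1 pi_mem_I).symm

/-- The pair `(ω(·, z), ω^[1](·, z))`. -/
def omegaV (hu : MemL2 u) (z : ℂ) : CI2 := solOp hu z unitData

/-- The characteristic function `ω(π, z)`. -/
def charFun (hu : MemL2 u) (z : ℂ) : ℂ := evPi (omegaV hu z)

lemma initData_eq (b : ℂ) (h : ℝ → ℂ) (hh : IntervalIntegrable h volume 0 Real.pi) :
    initData 0 0 h hh + b • unitData = initData 0 b h hh := by
  refine Prod.ext ?_ ?_
  · ext x; simp [initData, unitData]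
  · ext x; simp [initData, unitData]; ring

lemma zero_integrable : IntervalIntegrable (fun _ : ℝ => (0 : ℂ)) volume 0 Real.pi :=
  intervalIntegrable_const

lemma unitData_eq : unitData = initData 0 1 (fun _ => 0) zero_integrable := by
  refine Prod.ext ?_ ?_
  · ext x; simp [initData, unitData]
  · ext x; simp [initData, unitData, intOp_one_apply]

lemma omegaV_spec (hu : MemL2 u) (z : ℂ) :
    ext (omegaV hu z).1 0 = 0 ∧ ext (omegaV hu z).2 0 = 1 ∧
      QuasiDiff u (ext (omegaV hu z).1) (ext (omegaV hu z).2) (fun x => z * ext (omegaV hu z).1 x) := by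
  have h := sol_spec hu z 0 1 (fun _ => 0) zero_integrable
  rw [sol, ← unitData_eq] at h
  simp only [add_zero] at h
  exact h

lemma charFun_ne_zero_of_circle (hu : MemL2 u) {m : ℕ} {z : ℂ} (hz : ‖z‖ = rad m ^ 2)
    (hK : hsNorm u z ≤ 1 / 4) : charFun hu z ≠ 0 := by
  intro h
  obtain ⟨h0, h1, hq⟩ := omegaV_spec hu z
  rw [charFun, evPi_apply] at h
  have hzero : (omegaV hu z).1 = 0 := by
    ext x
    rw [← ext_coe]
    exact hq.eq_zero_of_circle hu h0 h hz hK x.2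
  have h2 := fst_eq_zero_imp hq hzero
  rw [h2] at h1
  exact zero_ne_one h1

/-- The resolvent, as an operator on the data of the integral equation. -/
def resOp (hu : MemL2 u) (z : ℂ) : CI2 →L[ℂ] CI2 :=
  -- The multiple of `ω` restores the condition at `π` without disturbing the one at `0`. It
  -- introduces poles only at zeros of the characteristic function.
  solOp hu z - (charFun hu z)⁻¹ • ((evPi.comp (solOp hu z)).smulRight (omegaV hu z))

lemma resOp_apply (hu : MemL2 u) (z : ℂ) (Y : CI2) :
    resOp hu z Y = solOp hu z Y - ((charFun hu z)⁻¹ * evPi (solOp hu z Y)) • omegaV hu z := by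
  rw [mul_smul]; rfl

lemma evPi_resOp (hu : MemL2 u) {z : ℂ} (hz : charFun hu z ≠ 0) (Y : CI2) :
    evPi (resOp hu z Y) = 0 := by
  rw [resOp_apply, map_sub, map_smul, smul_eq_mul, ← charFun]
  field_simp
  ring

lemma sub_smul_eq {E : Type*} [AddCommGroup E] [Module ℂ E] (a e : E) (c : ℂ) :
    a - c • e = a + (-c) • e := by rw [neg_smul, sub_eq_add_neg]

lemma resOp_spec (hu : MemL2 u) {z : ℂ} (hz : charFun hu z ≠ 0) {f : ℝ → ℂ}
    (hf : IntervalIntegrable f volume 0 Real.pi) :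
    ext (resOp hu z (initData 0 0 f hf)).1 0 = 0 ∧
    ext (resOp hu z (initData 0 0 f hf)).1 Real.pi = 0 ∧
    QuasiDiff u (ext (resOp hu z (initData 0 0 f hf)).1) (ext (resOp hu z (initData 0 0 f hf)).2)
      (fun x => z * ext (resOp hu z (initData 0 0 f hf)).1 x + f x) := by
  have h : sysOp hu z (resOp hu z (initData 0 0 f hf)) = initData 0
      (-((charFun hu z)⁻¹ * evPi (solOp hu z (initData 0 0 f hf)))) f hf := by
    rw [resOp_apply, map_sub, map_smul, omegaV, sysOp_solOp, sysOp_solOp,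
      ← initData_eq (-_) f hf]
    exact sub_smul_eq (E := CI2) _ _ _
  obtain ⟨h1, -, h3⟩ := quasiDiff_of_sysOp hu hf h
  refine ⟨h1, ?_, h3⟩
  rw [← evPi_apply, evPi_resOp hu hz]

lemma clm_comp_smul_differentiable {E : Type*} [NormedAddCommGroup E] [NormedSpace ℂ E]
    {S : ℂ → E →L[ℂ] E} (hS : Differentiable ℂ S) (ev : E →L[ℂ] ℂ) (e : E) {z : ℂ}
    (hz : ev (S z e) ≠ 0) :
    DifferentiableAt ℂ (fun z => S z - (ev (S z e))⁻¹ • ((ev.comp (S z)).smulRight (S z e))) z := by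
  have h1 : DifferentiableAt ℂ (fun z => S z e) z := (hS z).clm_apply (differentiableAt_const e)
  have h2 : DifferentiableAt ℂ (fun z => ev (S z e)) z := ev.differentiableAt.comp z h1
  have h3 : DifferentiableAt ℂ (fun z => ev.comp (S z)) z :=
    (differentiableAt_const ev).clm_comp (hS z)
  have h4 : DifferentiableAt ℂ (fun z => (ev.comp (S z)).smulRight (S z e)) z :=
    ((ContinuousLinearMap.smulRightL ℂ E E).differentiableAt.comp z h3).clm_apply h1
  exact (hS z).sub ((h2.inv hz).smul h4)

lemma differentiableAt_resOp (hu : MemL2 u) {z : ℂ} (hz : charFun hu z ≠ 0) :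
    DifferentiableAt ℂ (resOp hu) z :=
  clm_comp_smul_differentiable (differentiable_solOp hu) evPi unitData hz

lemma circleIntegral_clm_apply {E F : Type*} [NormedAddCommGroup E] [NormedSpace ℂ E]
    [NormedAddCommGroup F] [NormedSpace ℂ F] [CompleteSpace F] {A : ℂ → E →L[ℂ] F} {c : ℂ} {R : ℝ}
    (hA : CircleIntegrable A c R) (v : E) (ℓ : F →L[ℂ] ℂ) :
    ℓ ((∮ z in C(c, R), A z) v) = ∮ z in C(c, R), ℓ (A z v) := by
  let T : (E →L[ℂ] F) →L[ℂ] ℂ := ℓ.comp (ContinuousLinearMap.apply ℂ F v)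
  have h := ContinuousLinearMap.intervalIntegral_comp_comm T hA.out
  have e : ℓ ((∮ z in C(c, R), A z) v) = T (∮ z in C(c, R), A z) := rfl
  rw [e, circleIntegral, ← h, circleIntegral]
  refine intervalIntegral.integral_congr fun θ _ => ?_
  simp [T]

/-- The projection onto the root subspaces of the eigenvalues inside a circle. -/
def projOp (hu : MemL2 u) (c : ℂ) (R : ℝ) : CI2 →L[ℂ] CI2 :=
  -- The sign belongs to the convention `(L - z)⁻¹`, whose residues are minus projections in the
  -- semisimple case.
  (-(2 * Real.pi * Complex.I))⁻¹ • ∮ z in C(c, R), resOp hu z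

lemma circleIntegrable_resOp (hu : MemL2 u) {c : ℂ} {R : ℝ} (hR : 0 ≤ R)
    (h : ∀ z ∈ Metric.sphere c R, charFun hu z ≠ 0) : CircleIntegrable (resOp hu) c R :=
  ContinuousOn.circleIntegrable hR fun z hz =>
    (differentiableAt_resOp hu (h z hz)).continuousAt.continuousWithinAt

lemma clm_projOp (hu : MemL2 u) {c : ℂ} {R : ℝ} (hR : 0 ≤ R)
    (h : ∀ z ∈ Metric.sphere c R, charFun hu z ≠ 0) (ℓ : CI2 →L[ℂ] ℂ) (Y : CI2) :
    ℓ (projOp hu c R Y)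
      = (-(2 * Real.pi * Complex.I))⁻¹ * ∮ z in C(c, R), ℓ (resOp hu z Y) := by
  rw [← circleIntegral_clm_apply (circleIntegrable_resOp hu hR h), ← smul_eq_mul, ← map_smul]
  rfl

/-- Evaluation of the first component at a point. -/
def evAt (x : Icc (0 : ℝ) Real.pi) : CI2 →L[ℂ] ℂ :=
  (ContinuousMap.evalCLM ℂ x).comp (ContinuousLinearMap.fst ℂ CI CI)

lemma evAt_apply (x : Icc (0 : ℝ) Real.pi) (Y : CI2) : evAt x Y = ext Y.1 x := (ext_coe Y.1 x).symm

lemma mem_sphere_rad {m : ℕ} {z : ℂ} : z ∈ Metric.sphere (0 : ℂ) (rad m ^ 2) ↔ ‖z‖ = rad m ^ 2 := by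
  simp

/-- Among all points of the circle, `r²` is closest to every `j²`; majorants evaluated there hold on
the whole circle. -/
lemma norm_sub_rad_sq_le {m : ℕ} {z : ℂ} (hz : ‖z‖ = rad m ^ 2) (j : ℕ) :
    ‖(j : ℂ) ^ 2 - (rad m : ℂ) ^ 2‖ ≤ ‖(j : ℂ) ^ 2 - z‖ := by
  refine le_trans (le_of_eq ?_) (mul_abs_sub_rad_le hz j)
  have hr := rad_pos m
  rw [show (j : ℂ) ^ 2 - (rad m : ℂ) ^ 2 = (((j + rad m) * (j - rad m) : ℝ) : ℂ) by push_cast; ring,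
    Complex.norm_real, Real.norm_eq_abs, abs_mul,
    abs_of_nonneg (by positivity : (0 : ℝ) ≤ j + rad m)]

lemma summable_inv_norm_sub {m : ℕ} {z : ℂ} (hz : ‖z‖ = rad m ^ 2) :
    Summable fun k : ℕ => 1 / ‖(k : ℂ) ^ 2 - z‖ := by
  have hs : Summable fun k : ℕ => 1 / qrt |(k : ℝ) - rad m| ^ 5 := by
    have h1 : ∑' k : ℕ, ENNReal.ofReal (1 / qrt |(k : ℝ) - rad m| ^ 5) ≠ ⊤ :=
      ne_top_of_le_ne_top (by have := gsum_ne_top.lt_top; finiteness) (tsum_inv_le m)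
    refine (ENNReal.summable_toReal h1).congr fun k => ?_
    have := (weightData hz k).γ_pos
    exact ENNReal.toReal_ofReal (by positivity)
  refine (hs.mul_left (4 * (1 / qrt (rad m) ^ 3))).of_nonneg_of_le (fun _ => by positivity) fun k => ?_
  have hw := weightData hz k
  have h1 := hw.inv_le
  have h2 : 1 / ‖(k : ℂ) ^ 2 - z‖ ≤ 4 * (1 / ((k + rad m) * qrt (|(k : ℝ) - rad m| + offs m z) ^ 4)) := by
    have hp := hw.p_pos
    have hA := hw.A_pos
    rw [mul_one_div, div_le_div_iff₀ hw.d_pos (by positivity)]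
    linarith [hw.le_d]
  linarith

/-- Comparison of the Riesz projection with the partial sum of the sine series. -/
theorem norm_projOp_sub_le (hu : MemL2 u) {m : ℕ} (hm : 1 ≤ m)
    (hK : ∀ z : ℂ, ‖z‖ = rad m ^ 2 → hsNorm u z ≤ 1 / 4) (hfirst : firstConst u m ≠ ⊤)
    {f : ℝ → ℂ} (hf : MemL2 f) {x : ℝ} (hx : x ∈ Icc (0 : ℝ) Real.pi) :
    ‖ext (projOp hu 0 (rad m ^ 2) (initData 0 0 f hf.intervalIntegrable)).1 x
      - ∑ n ∈ Finset.Icc 1 m, sineCoeff f n * sinFun n x‖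
      ≤ (√(firstConst u m).toReal + 32 * √(remConst u m).toReal) * normL2 f := by
  have hπ := Real.pi_pos
  have hr := rad_pos m
  have hR : (0 : ℝ) ≤ rad m ^ 2 := by positivity
  have hN := normL2_nonneg f
  set Φ := initData 0 0 f hf.intervalIntegrable with hΦ
  have hchar : ∀ z ∈ Metric.sphere (0 : ℂ) (rad m ^ 2), charFun hu z ≠ 0 := fun z hz =>
    charFun_ne_zero_of_circle hu (mem_sphere_rad.1 hz) (hK z (mem_sphere_rad.1 hz))
  -- All series below are majorized by their values at `z₀`, which gives uniform convergence on the
  -- circle.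
  set z₀ : ℂ := (rad m : ℂ) ^ 2 with hz₀
  have hz₀' : ‖z₀‖ = rad m ^ 2 := norm_rad_sq m
  let s : ℕ → ℂ := fun k => sinFun k x
  have hs1 : ∀ k, ‖s k‖ ≤ 1 := fun k => norm_sinFun_le k x
  let Y : ℂ → ℂ := fun z => evAt ⟨x, hx⟩ (resOp hu z Φ)
  have hYc : ContinuousOn Y (Metric.sphere (0 : ℂ) (rad m ^ 2)) := by
    intro z hz
    have h1 := (differentiableAt_resOp hu (hchar z hz)).continuousAt
    have h2 : ContinuousAt (fun z => resOp hu z Φ) z := h1.clm_apply continuousAt_const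
    exact ((evAt ⟨x, hx⟩).continuous.continuousAt.comp h2).continuousWithinAt
  -- the free term
  let g₀ : ℕ → ℂ → ℂ := fun k z => sineCoeff f k * s k * ((k : ℂ) ^ 2 - z)⁻¹
  have hinv : ∀ k : ℕ, ContinuousOn (fun z : ℂ => ((k : ℂ) ^ 2 - z)⁻¹)
      (Metric.sphere (0 : ℂ) (rad m ^ 2)) := fun k =>
    (continuousOn_const.sub continuousOn_id).inv₀ fun z hz =>
      sub_ne_zero_of_circle (mem_sphere_rad.1 hz) k
  have hg₀c : ∀ k, ContinuousOn (g₀ k) (Metric.sphere (0 : ℂ) (rad m ^ 2)) := fun k =>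
    continuousOn_const.mul (hinv k)
  have hB₀ : Summable fun k : ℕ => normL2 f * (1 / ‖(k : ℂ) ^ 2 - z₀‖) :=
    (summable_inv_norm_sub hz₀').mul_left _
  have hg₀ : ∀ k, ∀ z ∈ Metric.sphere (0 : ℂ) (rad m ^ 2),
      ‖g₀ k z‖ ≤ normL2 f * (1 / ‖(k : ℂ) ^ 2 - z₀‖) := by
    intro k z hz
    have hz' := mem_sphere_rad.1 hz
    simp only [g₀]
    rw [norm_mul, norm_mul, norm_inv, ← one_div]
    refine mul_le_mul ?_ (one_div_le_one_div_of_le (norm_sub_pos hz₀' k) (norm_sub_rad_sq_le hz' k))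
      (by positivity) hN
    calc ‖sineCoeff f k‖ * ‖s k‖ ≤ normL2 f * 1 :=
          mul_le_mul (coeffAbs_le hf k) (hs1 k) (norm_nonneg _) hN
      _ = normL2 f := mul_one _
  -- the term of first order
  let g₁ : ℕ × ℕ → ℂ → ℂ := fun p z =>
    qmat u p.2 p.1 * sineCoeff f p.2 * s p.1 * (((p.2 : ℂ) ^ 2 - z) * ((p.1 : ℂ) ^ 2 - z))⁻¹
  let B₁ : ℕ × ℕ → ℝ := fun p => qmaj (coeffAbs u) p.2 p.1 * coeffAbs f p.2
      / (‖(p.2 : ℂ) ^ 2 - z₀‖ * ‖(p.1 : ℂ) ^ 2 - z₀‖)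
  have hB₁0 : ∀ p, 0 ≤ B₁ p := fun p => by
    have := qmaj_nonneg (coeffAbs_nonneg u) p.2 p.1
    have := coeffAbs_nonneg f p.2
    simp only [B₁]; positivity
  have hB₁ : Summable B₁ := by
    have h1 := tsum_first_order_ne_top hu hf hz₀'
    rw [← ENNReal.tsum_prod (f := fun k j : ℕ => ENNReal.ofReal (B₁ (k, j)))] at h1
    refine (ENNReal.summable_toReal h1).congr fun p => ?_
    exact ENNReal.toReal_ofReal (hB₁0 p)
  have hg₁c : ∀ p, ContinuousOn (g₁ p) (Metric.sphere (0 : ℂ) (rad m ^ 2)) := fun p => by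
    simp only [g₁, mul_inv]
    exact continuousOn_const.mul ((hinv p.2).mul (hinv p.1))
  have hg₁ : ∀ p, ∀ z ∈ Metric.sphere (0 : ℂ) (rad m ^ 2), ‖g₁ p z‖ ≤ B₁ p := by
    intro p z hz
    have hz' := mem_sphere_rad.1 hz
    simp only [g₁, B₁]
    have hq := norm_qmat_le_qmaj hu p.2 p.1
    have hq0 := qmaj_nonneg (coeffAbs_nonneg u) p.2 p.1
    have hc0 := coeffAbs_nonneg f p.2
    rw [norm_mul, norm_mul, norm_mul, norm_inv, norm_mul, ← div_eq_mul_inv]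
    have h1 := norm_sub_pos hz₀' p.1
    have h2 := norm_sub_pos hz₀' p.2
    refine div_le_div₀ (by positivity) ?_ (by positivity)
      (mul_le_mul (norm_sub_rad_sq_le hz' p.2) (norm_sub_rad_sq_le hz' p.1) h1.le (norm_nonneg _))
    calc ‖qmat u p.2 p.1‖ * ‖sineCoeff f p.2‖ * ‖s p.1‖
        ≤ qmaj (coeffAbs u) p.2 p.1 * coeffAbs f p.2 * 1 :=
          mul_le_mul (mul_le_mul hq le_rfl (norm_nonneg _) hq0) (hs1 p.1) (norm_nonneg _)
            (by positivity)
      _ = _ := mul_one _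
  -- the decomposition
  let A₀ : ℂ → ℂ := fun z => ∑' k, g₀ k z
  let A₁ : ℂ → ℂ := fun z => ∑' p, g₁ p z
  -- The first order term enters the resolvent with a minus sign, hence `Y = A₀ - A₁ + Rm`.
  let Rm : ℂ → ℂ := fun z => Y z - A₀ z + A₁ z
  have hA₀c : ContinuousOn A₀ (Metric.sphere (0 : ℂ) (rad m ^ 2)) := continuousOn_tsum hg₀c hB₀ hg₀
  have hA₁c : ContinuousOn A₁ (Metric.sphere (0 : ℂ) (rad m ^ 2)) := continuousOn_tsum hg₁c hB₁ hg₁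
  have hrem : ∀ z : ℂ, ‖z‖ = rad m ^ 2 → ‖Rm z‖ ≤ √(remConst u m).toReal * normL2 f
      / (rad m * (offs m z + 1 / 2) ^ (17 / 16 : ℝ)) := by
    intro z hz
    have hzs : z ∈ Metric.sphere (0 : ℂ) (rad m ^ 2) := mem_sphere_rad.2 hz
    obtain ⟨h0, hpi, hq⟩ := resOp_spec hu (hchar z hzs) hf.intervalIntegrable
    rw [← hΦ] at h0 hpi hq
    have hb := hq.tsum_remainder_le hu hf h0 hpi hz (hK z hz)
    set y := ext (resOp hu z Φ).1 with hy
    set rem := coeffRemainder u f y z with hremdef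
    have hB0 : 0 ≤ √(remConst u m).toReal * normL2 f
        / (rad m * (offs m z + 1 / 2) ^ (17 / 16 : ℝ)) := by
      have := offs_nonneg m z
      positivity
    have hrs : Summable rem := summable_of_tsum_ofReal_ne_top (ne_top_of_le_ne_top ENNReal.ofReal_ne_top hb)
    have hYs : HasSum (fun k => sineCoeff y k * s k) (Y z) := by
      have := hq.hasSum_sine hu h0 hpi hx
      simpa only [Y, evAt_apply] using this
    have hs0 : HasSum (fun k => g₀ k z) (A₀ z) :=
      (Summable.of_norm_bounded hB₀ fun k => hg₀ k z hzs).hasSum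
    have hsp : Summable fun p => g₁ p z := Summable.of_norm_bounded hB₁ fun p => hg₁ p z hzs
    have hs1' : HasSum (fun k => ∑' j, g₁ (k, j) z) (A₁ z) :=
      hsp.hasSum.prod_fiberwise fun k => (hsp.prod_factor k).hasSum
    have hR1 : HasSum (fun k => rem k * s k) (Rm z) := by
      refine ((hYs.sub hs0).add hs1').congr_fun fun k => ?_
      have e1 : ∑' j, g₁ (k, j) z = (∑' j, qmat u j k * sineCoeff f j
          / (((j : ℂ) ^ 2 - z) * ((k : ℂ) ^ 2 - z))) * s k := by
        rw [← tsum_mul_right]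
        refine tsum_congr fun j => ?_
        simp only [g₁]; ring
      rw [e1, hremdef, coeffRemainder]
      simp only [g₀]
      ring
    rw [← hR1.tsum_eq]
    have h1 : ENNReal.ofReal ‖∑' k, rem k * s k‖ ≤ ENNReal.ofReal (√(remConst u m).toReal * normL2 f
        / (rad m * (offs m z + 1 / 2) ^ (17 / 16 : ℝ))) := by
      refine (ofReal_norm_tsum_le _).trans (le_trans (ENNReal.tsum_le_tsum fun k =>
        ENNReal.ofReal_le_ofReal ?_) hb)
      rw [norm_mul]
      exact mul_le_of_le_one_right (norm_nonneg _) (hs1 k)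
    exact (ENNReal.ofReal_le_ofReal_iff hB0).1 h1
  -- integration
  set c₀ : ℂ := -(2 * Real.pi * Complex.I) with hc₀
  have hc₀n : ‖c₀‖ = 2 * Real.pi := norm_two_pi_I_eq
  have hc₀ne : c₀ ≠ 0 := by rw [← norm_pos_iff, hc₀n]; positivity
  have hI₀ : ∮ z in C(0, rad m ^ 2), A₀ z = c₀ * ∑ n ∈ Finset.Icc 1 m, sineCoeff f n * sinFun n x := by
    have h1 := hasSum_circleIntegral hR hB₀ hg₀c hg₀
    refine h1.unique ?_
    have e : ∀ k, ∮ z in C(0, rad m ^ 2), g₀ k z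
        = if k ≤ m then sineCoeff f k * s k * c₀ else 0 := by
      intro k
      simp only [g₀]
      rw [circleIntegral.integral_const_mul, circleIntegral_free]
      split_ifs <;> simp [hc₀]
    simp only [e]
    have h2 := hasSum_sum_of_ne_finset_zero (L := SummationFilter.unconditional ℕ) (f := fun k => if k ≤ m then sineCoeff f k * s k * c₀ else 0)
      (s := Finset.Icc 1 m) (fun k hk => by
        -- The index `0` also lies inside the circle, but its sine coefficient is zero.
        rw [Finset.mem_Icc, not_and_or] at hk
        rcases hk with hk | hk
        · have : k = 0 := by omega
          rw [this, sineCoeff_zero]; simp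
        · rw [if_neg hk])
    convert! h2 using 1
    rw [Finset.mul_sum]
    refine Finset.sum_congr rfl fun k hk => ?_
    rw [if_pos (Finset.mem_Icc.1 hk).2]
    simp only [s]; ring
  have hI₁ : ‖∮ z in C(0, rad m ^ 2), A₁ z‖ ≤ 2 * Real.pi * (√(firstConst u m).toReal * normL2 f) := by
    have h1 := hasSum_circleIntegral hR hB₁ hg₁c hg₁
    rw [← h1.tsum_eq]
    have hsq := tsum_opp_first_order_sq_le (u := u) hf hm
    have h2 : ∑' k, ∑' j, (if Opp m j k then ENNReal.ofReal (qmaj (coeffAbs u) j k * coeffAbs f j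
        / (Nat.dist j k * (j + k : ℕ))) else 0) ≤ ENNReal.ofReal (√(firstConst u m).toReal * normL2 f) := by
      rw [← ENNReal.ofReal_toReal hfirst, ← ENNReal.ofReal_mul ENNReal.toReal_nonneg] at hsq
      have e2 : (firstConst u m).toReal * normL2 f ^ 2 = (√(firstConst u m).toReal * normL2 f) ^ 2 := by
        rw [mul_pow, Real.sq_sqrt ENNReal.toReal_nonneg]
      rw [e2, ENNReal.ofReal_pow (by positivity)] at hsq
      exact (ENNReal.pow_le_pow_left_iff (by norm_num)).1 hsq
    have h3 : ENNReal.ofReal ‖∑' p, ∮ z in C(0, rad m ^ 2), g₁ p z‖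
        ≤ ENNReal.ofReal (2 * Real.pi * (√(firstConst u m).toReal * normL2 f)) := by
      calc _ ≤ ∑' p, ENNReal.ofReal ‖∮ z in C(0, rad m ^ 2), g₁ p z‖ := by
            simp only [ofReal_norm]
            exact enorm_tsum_le_tsum_enorm
        _ ≤ ∑' p : ℕ × ℕ, ENNReal.ofReal (2 * Real.pi) * (if Opp m p.2 p.1 then ENNReal.ofReal
              (qmaj (coeffAbs u) p.2 p.1 * coeffAbs f p.2
                / (Nat.dist p.2 p.1 * (p.2 + p.1 : ℕ))) else 0) := by
            refine ENNReal.tsum_le_tsum fun p => ?_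
            simp only [g₁]
            rw [circleIntegral.integral_const_mul, norm_mul]
            have h4 := norm_circleIntegral_free_mul_le m p.2 p.1
            have hq := norm_qmat_le_qmaj hu p.2 p.1
            have hq0 := qmaj_nonneg (coeffAbs_nonneg u) p.2 p.1
            have hc0 := coeffAbs_nonneg f p.2
            have h5 : ‖qmat u p.2 p.1 * sineCoeff f p.2 * s p.1‖
                ≤ qmaj (coeffAbs u) p.2 p.1 * coeffAbs f p.2 := by
              rw [norm_mul, norm_mul]
              calc _ ≤ qmaj (coeffAbs u) p.2 p.1 * coeffAbs f p.2 * 1 :=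
                    mul_le_mul (mul_le_mul hq le_rfl (norm_nonneg _) hq0) (hs1 p.1) (norm_nonneg _)
                      (by positivity)
                _ = _ := mul_one _
            refine (ENNReal.ofReal_le_ofReal (mul_le_mul h5 h4 (norm_nonneg _)
              (by positivity))).trans (le_of_eq ?_)
            split_ifs
            · rw [← ENNReal.ofReal_mul (by positivity)]
              congr 1; ring
            · simp
        _ = ENNReal.ofReal (2 * Real.pi) * ∑' k, ∑' j, (if Opp m j k then ENNReal.ofReal
              (qmaj (coeffAbs u) j k * coeffAbs f j / (Nat.dist j k * (j + k : ℕ))) else 0) := by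
            rw [ENNReal.tsum_mul_left, ← ENNReal.tsum_prod]
        _ ≤ ENNReal.ofReal (2 * Real.pi) * ENNReal.ofReal (√(firstConst u m).toReal * normL2 f) := by
            gcongr
        _ = _ := by rw [← ENNReal.ofReal_mul (by positivity)]
    exact (ENNReal.ofReal_le_ofReal_iff (by positivity)).1 h3
  -- The bound `64 π B`, divided by the `2π` of the projection, produces the factor `32`.
  have hIR := norm_circleIntegral_le_of_weight (F := Rm) (by positivity) hrem
  have hsplit : ∮ z in C(0, rad m ^ 2), Y z = (∮ z in C(0, rad m ^ 2), A₀ z)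
      - (∮ z in C(0, rad m ^ 2), A₁ z) + ∮ z in C(0, rad m ^ 2), Rm z := by
    have i0 := hA₀c.circleIntegrable hR
    have i1 := hA₁c.circleIntegrable hR
    have iR : CircleIntegrable Rm 0 (rad m ^ 2) := ((hYc.sub hA₀c).add hA₁c).circleIntegrable hR
    have i2 : CircleIntegrable (fun z => A₀ z - A₁ z) 0 (rad m ^ 2) := i0.sub i1
    rw [← circleIntegral.integral_sub i0 i1, ← circleIntegral.integral_add i2 iR]
    refine congrArg (fun F : ℂ → ℂ => circleIntegral F 0 (rad m ^ 2)) (funext fun z => ?_)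
    simp only [Rm]; ring
  have hP : ext (projOp hu 0 (rad m ^ 2) Φ).1 x = c₀⁻¹ * ∮ z in C(0, rad m ^ 2), Y z := by
    have h1 := clm_projOp hu hR hchar (evAt ⟨x, hx⟩) Φ
    rw [evAt_apply] at h1
    exact h1
  rw [hP, hsplit, hI₀]
  have e : c₀⁻¹ * (c₀ * (∑ n ∈ Finset.Icc 1 m, sineCoeff f n * sinFun n x)
      - (∮ z in C(0, rad m ^ 2), A₁ z) + ∮ z in C(0, rad m ^ 2), Rm z)
      - ∑ n ∈ Finset.Icc 1 m, sineCoeff f n * sinFun n x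
      = c₀⁻¹ * ((∮ z in C(0, rad m ^ 2), Rm z) - ∮ z in C(0, rad m ^ 2), A₁ z) := by
    field_simp
    ring
  rw [e, norm_mul, norm_inv, hc₀n, inv_mul_le_iff₀ (by positivity)]
  refine (norm_sub_le _ _).trans ?_
  nlinarith

/-! ### Derivatives with respect to the spectral parameter -/

section Pencil

variable {E F : Type*} [NormedAddCommGroup E] [NormedSpace ℂ E]
  [NormedAddCommGroup F] [NormedSpace ℂ F]

lemma differentiable_iteratedDeriv_of_entire [CompleteSpace E] {w : ℂ → E} (hw : Differentiable ℂ w) (j : ℕ) :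
    Differentiable ℂ (iteratedDeriv j w) :=
  (hw.contDiff (n := ⊤)).differentiable_iteratedDeriv j (by exact_mod_cast WithTop.coe_lt_top _)

lemma iteratedDeriv_clm_apply [CompleteSpace E] {w : ℂ → E} (hw : Differentiable ℂ w) (ℓ : E →L[ℂ] F) (j : ℕ) :
    iteratedDeriv j (fun s => ℓ (w s)) = fun s => ℓ (iteratedDeriv j w s) := by
  induction j with
  | zero => simp
  | succ j ih =>
    funext s
    rw [iteratedDeriv_succ, ih, iteratedDeriv_succ]
    have h := (differentiable_iteratedDeriv_of_entire hw j s).hasDerivAt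
    exact (ℓ.hasFDerivAt.comp_hasDerivAt s h).deriv

/-- Derivatives of the solution of `(A - z B) w(z) = e`. -/
lemma pencil_iteratedDeriv [CompleteSpace E] (A B : E →L[ℂ] E) {w : ℂ → E} (hw : Differentiable ℂ w) {e : E}
    (h : ∀ z, (A - z • B) (w z) = e) (j : ℕ) (z : ℂ) :
    (A - z • B) (iteratedDeriv (j + 1) w z) = ((j : ℂ) + 1) • B (iteratedDeriv j w z) := by
  have hd : ∀ j z, HasDerivAt (iteratedDeriv j w) (iteratedDeriv (j + 1) w z) z := by
    intro j z
    rw [iteratedDeriv_succ]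
    exact (differentiable_iteratedDeriv_of_entire hw j z).hasDerivAt
  have key : ∀ j z, HasDerivAt (fun z => (A - z • B) (iteratedDeriv j w z))
      ((A - z • B) (iteratedDeriv (j + 1) w z) - B (iteratedDeriv j w z)) z := by
    intro j z
    have h1 : HasDerivAt (fun z : ℂ => A - z • B) (-B) z := by
      have := ((hasDerivAt_id z).smul_const B).const_sub A
      simpa using this
    have := h1.clm_apply (hd j z)
    convert! this using 1
    simp [sub_eq_neg_add]
  induction j generalizing z with
  | zero =>
    have h1 := key 0 z
    have h2 : HasDerivAt (fun z => (A - z • B) (iteratedDeriv 0 w z)) 0 z := by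
      have : (fun z => (A - z • B) (iteratedDeriv 0 w z)) = fun _ => e := by
        funext z; rw [iteratedDeriv_zero]; exact h z
      rw [this]; exact hasDerivAt_const _ _
    have h3 := h1.unique h2
    rw [sub_eq_zero] at h3
    rw [h3]; simp
  | succ j ih =>
    have h1 := key (j + 1) z
    have h2 : HasDerivAt (fun z => (A - z • B) (iteratedDeriv (j + 1) w z))
        (((j : ℂ) + 1) • B (iteratedDeriv (j + 1) w z)) z := by
      have e1 : (fun z => (A - z • B) (iteratedDeriv (j + 1) w z))
          = fun z => ((j : ℂ) + 1) • B (iteratedDeriv j w z) := funext fun z => ih z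
      rw [e1]
      exact (B.hasFDerivAt.comp_hasDerivAt z (hd j z)).const_smul _
    have h3 := h1.unique h2
    rw [sub_eq_iff_eq_add] at h3
    rw [h3]
    push_cast
    rw [add_smul ((j : ℂ) + 1) 1, one_smul]

lemma pencil_shift (A B : E →L[ℂ] E) (z μ : ℂ) (Y : E) :
    (A - z • B) Y = (A - μ • B) Y + (μ - z) • B Y := by
  simp only [sub_apply, smul_apply, sub_smul]
  abel

/-- A chain of length `n` forces a zero of order at least `n`. -/
lemma le_order_of_chain (A B : E →L[ℂ] E) {S : ℂ → E →L[ℂ] E} (hS : Differentiable ℂ S)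
    (hinv : ∀ z Y, S z ((A - z • B) Y) = Y) (e : E) (ev : E →L[ℂ] ℂ) {X : ℕ → E} {b : ℕ → ℂ} {μ : ℂ}
    {n : ℕ} (h0 : (A - μ • B) (X 0) = b 0 • e)
    (hs : ∀ j, j + 1 < n → (A - μ • B) (X (j + 1)) = b (j + 1) • e + B (X j)) (hb : b 0 ≠ 0)
    (hev : ∀ j < n, ev (X j) = 0) : (n : ℕ∞) ≤ analyticOrderAt (fun z => ev (S z e)) μ := by
  rcases Nat.eq_zero_or_pos n with rfl | hn
  · simp
  obtain ⟨k, rfl⟩ : ∃ k, n = k + 1 := ⟨n - 1, by omega⟩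
  -- The polynomial with coefficients `X j` solves the equation with right side `β(z) e` up to an
  -- error of order `(z - μ)^n`. Applying `S z` and then `ev` removes the left side. Thus `β(z) ev
  -- (S z e)` is divisible by `(z - μ)^n`, while `β(μ) = b 0 ≠ 0`.
  let β : ℕ → ℂ → ℂ := fun k z => ∑ j ∈ Finset.range (k + 1), (z - μ) ^ j * b j
  have key : ∀ i ≤ k, ∀ z, (A - z • B) (∑ j ∈ Finset.range (i + 1), (z - μ) ^ j • X j)
      = β i z • e - (z - μ) ^ (i + 1) • B (X i) := by
    intro i
    induction i with
    | zero =>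
      intro _ z
      simp only [zero_add, Finset.sum_range_one, pow_zero, one_smul, pow_one, β, one_mul]
      rw [pencil_shift A B z μ, h0, ← neg_sub z μ, neg_smul]
      exact (sub_eq_add_neg _ _).symm
    | succ i ih =>
      intro hi z
      rw [Finset.sum_range_succ, map_add, ih (by omega) z, map_smul, pencil_shift A B z μ,
        hs i (by omega)]
      simp only [β]
      rw [Finset.sum_range_succ _ (i + 1), add_smul, smul_add, smul_add, smul_smul, smul_smul,
        ← neg_sub z μ, mul_neg, neg_smul, pow_succ _ (i + 1)]
      abel
  have hAn : AnalyticAt ℂ (fun z => ev (S z e)) μ := by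
    refine Differentiable.analyticAt ?_ μ
    exact fun z => ev.differentiableAt.comp z ((hS z).clm_apply (differentiableAt_const e))
  rw [natCast_le_analyticOrderAt hAn]
  have hβ : Differentiable ℂ (β k) := by simp only [β]; fun_prop
  have hβ0 : β k μ ≠ 0 := by
    simp only [β, sub_self]
    rw [Finset.sum_range_succ', Finset.sum_eq_zero]
    · simpa using hb
    · intro j _; simp
  have hH : Differentiable ℂ (fun z => ev (S z (B (X k)))) :=
    fun z => ev.differentiableAt.comp z ((hS z).clm_apply (differentiableAt_const _))
  refine ⟨fun z => ev (S z (B (X k))) / β k z, (hH.analyticAt μ).div (hβ.analyticAt μ) hβ0, ?_⟩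
  filter_upwards [hβ.continuous.continuousAt.eventually_ne hβ0] with z hz
  have h1 := congrArg (fun Y => ev (S z Y)) (key k le_rfl z)
  simp only [hinv, map_sum, map_smul, map_sub, smul_eq_mul] at h1
  rw [Finset.sum_eq_zero (fun j hj => by rw [hev j (Finset.mem_range.1 hj), mul_zero])] at h1
  rw [smul_eq_mul, mul_div_assoc', eq_div_iff hz]
  linear_combination -h1

end Pencil

/-! ### The derivatives of `ω` in the spectral parameter and the action of the resolvent on them -/

variable {u : ℝ → ℂ}

lemma differentiable_omegaV (hu : MemL2 u) : Differentiable ℂ (omegaV hu) :=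
  fun z => (differentiable_solOp hu z).clm_apply (differentiableAt_const unitData)

lemma differentiable_charFun (hu : MemL2 u) : Differentiable ℂ (charFun hu) :=
  fun z => evPi.differentiableAt.comp z (differentiable_omegaV hu z)

/-- The derivative of order `j` of `(ω, ω^[1])` with respect to the spectral parameter. -/
def rootV (hu : MemL2 u) (j : ℕ) (z : ℂ) : CI2 := iteratedDeriv j (omegaV hu) z

lemma rootV_zero (hu : MemL2 u) (z : ℂ) : rootV hu 0 z = omegaV hu z := by
  rw [rootV, iteratedDeriv_zero]

lemma sysOp_rootV_succ (hu : MemL2 u) (j : ℕ) (z : ℂ) :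
    sysOp hu z (rootV hu (j + 1) z) = ((j : ℂ) + 1) • spec (rootV hu j z) :=
  pencil_iteratedDeriv (1 - volt hu) spec (differentiable_omegaV hu)
    (fun z => sysOp_solOp hu z unitData) j z

lemma clm_rootV (hu : MemL2 u) (ℓ : CI2 →L[ℂ] ℂ) (j : ℕ) (z : ℂ) :
    ℓ (rootV hu j z) = iteratedDeriv j (fun s => ℓ (omegaV hu s)) z :=
  (congrFun (iteratedDeriv_clm_apply (differentiable_omegaV hu) ℓ j) z).symm

lemma evPi_rootV (hu : MemL2 u) (j : ℕ) (z : ℂ) :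
    evPi (rootV hu j z) = iteratedDeriv j (charFun hu) z := clm_rootV hu evPi j z

lemma sysOp_shift (hu : MemL2 u) (z μ : ℂ) (Y : CI2) :
    sysOp hu z Y = sysOp hu μ Y + (μ - z) • spec Y :=
  pencil_shift (1 - volt hu) spec z μ Y

lemma resOp_sysOp (hu : MemL2 u) {z : ℂ} {Y : CI2} (hY : evPi Y = 0) :
    resOp hu z (sysOp hu z Y) = Y := by
  rw [resOp_apply, solOp_sysOp, hY, mul_zero]
  have : (0 : ℂ) • omegaV hu z = 0 := zero_smul ℂ (omegaV hu z)
  rw [this, sub_zero]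

/-- Changing the initial value of the quasi-derivative only adds a multiple of `ω`, which the
boundary condition at `π` removes. -/
lemma resOp_unitData (hu : MemL2 u) {z : ℂ} (hz : charFun hu z ≠ 0) : resOp hu z unitData = 0 := by
  rw [resOp_apply]
  change omegaV hu z - ((charFun hu z)⁻¹ * charFun hu z) • omegaV hu z = 0
  rw [inv_mul_cancel₀ hz]
  have : (1 : ℂ) • omegaV hu z = omegaV hu z := one_smul ℂ (omegaV hu z)
  rw [this, sub_self]

/-- The resolvent on the root functions. -/
lemma resOp_spec_rootV (hu : MemL2 u) {z μ : ℂ} (hz : charFun hu z ≠ 0) {j : ℕ}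
    (hj : evPi (rootV hu j μ) = 0) :
    (μ - z) • resOp hu z (spec (rootV hu j μ)) + (j : ℂ) • resOp hu z (spec (rootV hu (j - 1) μ))
      = rootV hu j μ := by
  have h := resOp_sysOp hu (z := z) hj
  rw [sysOp_shift hu z μ, map_add, map_smul] at h
  have h' : resOp hu z (sysOp hu μ (rootV hu j μ))
      = (j : ℂ) • resOp hu z (spec (rootV hu (j - 1) μ)) := by
    -- For `j = 0` the truncated index `j - 1` is harmless because its coefficient is zero, and the
    -- data `unitData` is annihilated by the resolvent.
    rcases j with _ | j
    · rw [rootV_zero, omegaV, sysOp_solOp, resOp_unitData hu hz, Nat.cast_zero]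
      have : ∀ Z : CI2, (0 : ℂ) • Z = 0 := fun Z => zero_smul ℂ Z
      rw [this]
    · rw [sysOp_rootV_succ, map_smul, Nat.cast_add, Nat.cast_one, Nat.add_sub_cancel]
  rw [h'] at h
  exact (add_comm _ _).trans h

lemma spec_eq_initData (Y : CI2) :
    spec Y = initData 0 0 (ext Y.1) ((continuous_ext Y.1).intervalIntegrable _ _) := by
  rw [spec_apply]
  refine Prod.ext ?_ ?_
  · ext x; simp [initData]
  · ext x
    simp only [initData, ContinuousMap.neg_apply, ContinuousMap.sub_apply, ContinuousMap.const_apply,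
      intOp_one_apply, zero_sub]
    rw [intOp_apply]
    simp

/-! ### Eigenvalues and multiplicities -/

/-- The value `b` of the quasi-derivative at `0` stays free, since the Dirichlet problem does not
prescribe it. -/
lemma dirichletOp_of_sysOp (hu : MemL2 u) {z b : ℂ} {Y X : CI2}
    (h : sysOp hu z Y = b • unitData + spec X) (hY : evPi Y = 0) :
    DirichletOp u (ext Y.1) (fun x => z * ext Y.1 x + ext X.1 x) := by
  have hi : IntervalIntegrable (ext X.1) volume 0 Real.pi := (continuous_ext X.1).intervalIntegrable _ _
  have h' : sysOp hu z Y = initData 0 b (ext X.1) hi := by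
    rw [h, spec_eq_initData, ← initData_eq b _ hi]
    exact add_comm _ _
  obtain ⟨h1, -, h3⟩ := quasiDiff_of_sysOp hu hi h'
  refine ⟨((memL2_ext Y.1).const_mul z).add (memL2_ext X.1), h1, ?_, _, h3⟩
  rw [← evPi_apply, hY]

/-- The function of a chain and its quasi-derivative solve the integral equation. -/
lemma DirichletOp.exists_sysOp (hu : MemL2 u) {z : ℂ} {y h : ℝ → ℂ} (hh : ContinuousOn h (Icc 0 Real.pi))
    (hy : DirichletOp u y (fun x => z * y x + h x)) :
    ∃ (b : ℂ) (Y : CI2), (∀ x ∈ Icc (0 : ℝ) Real.pi, ext Y.1 x = y x) ∧ evPi Y = 0 ∧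
      sysOp hu z Y = b • unitData + spec (res h hh, 0) := by
  obtain ⟨-, h0, hπ, y₁, hq⟩ := hy
  have hi : IntervalIntegrable h volume 0 Real.pi := by
    refine ContinuousOn.intervalIntegrable ?_
    rwa [uIcc_of_le Real.pi_pos.le]
  refine ⟨y₁ 0, (res y hq.cont, res y₁ hq.cont₁), fun x hx => ext_res hq.cont hx, ?_, ?_⟩
  · rw [evPi_apply, ext_res hq.cont pi_mem_I, hπ]
  · rw [hq.sysOp_eq hu hi, h0, ← initData_eq (y₁ 0) h hi, spec_eq_initData]
    have e : initData 0 0 h hi = initData 0 0 (ext (res h hh))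
        ((continuous_ext (res h hh)).intervalIntegrable _ _) := by
      refine Prod.ext rfl ?_
      ext x
      simp only [initData, ContinuousMap.sub_apply, ContinuousMap.const_apply, intOp_one_apply]
      congr 1
      refine intervalIntegral.integral_congr fun t ht => ?_
      rw [uIcc_of_le x.2.1] at ht
      exact (ext_res hh ⟨ht.1, ht.2.trans x.2.2⟩).symm
    rw [e]
    exact add_comm _ _

lemma omegaV_fst_ne_zero (hu : MemL2 u) (z : ℂ) : (omegaV hu z).1 ≠ 0 := by
  intro h
  obtain ⟨-, h1, hq⟩ := omegaV_spec hu z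
  have h2 := fst_eq_zero_imp hq h
  rw [h2] at h1
  exact zero_ne_one h1

lemma exists_ext_ne_zero {φ : CI} (hφ : φ ≠ 0) : ∃ x ∈ Icc (0 : ℝ) Real.pi, ext φ x ≠ 0 := by
  by_contra! h
  refine hφ (ContinuousMap.ext fun x => ?_)
  rw [← ext_coe]
  exact h x x.2

lemma spec_zero : spec 0 = 0 := map_zero spec

/-- A chain gives a zero of the characteristic function. -/
lemma IsChain.le_order (hu : MemL2 u) {z : ℂ} {n : ℕ} {Y : ℕ → ℝ → ℂ} (h : IsChain u z n Y) :
    (n : ℕ∞) ≤ analyticOrderAt (charFun hu) z := by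
  have hc : ∀ j < n, ContinuousOn (Y j) (Icc 0 Real.pi) := by
    intro j hj
    rcases j with _ | j
    · obtain ⟨-, -, -, y₁, hq⟩ := h.eigen; exact hq.cont
    · obtain ⟨-, -, -, y₁, hq⟩ := h.assoc j hj; exact hq.cont
  have h0 : ∃ (b : ℂ) (X : CI2), (∀ x ∈ Icc (0 : ℝ) Real.pi, ext X.1 x = Y 0 x) ∧ evPi X = 0 ∧
      sysOp hu z X = b • unitData := by
    have he : DirichletOp u (Y 0) (fun x => z * Y 0 x + (fun _ => (0 : ℂ)) x) := by
      simpa only [add_zero] using h.eigen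
    obtain ⟨b, X, h1, h2, h3⟩ := he.exists_sysOp hu continuousOn_const
    refine ⟨b, X, h1, h2, ?_⟩
    rw [h3]
    have : spec (res (fun _ => (0 : ℂ)) continuousOn_const, 0) = 0 := spec_zero
    rw [this]
    exact add_zero _
  -- The properties are required only for `j < n`, with zero values beyond, so that whole sequences
  -- can be chosen.
  have hall : ∀ j, ∃ (b : ℂ) (X : CI2), j < n → (∀ x ∈ Icc (0 : ℝ) Real.pi, ext X.1 x = Y j x) ∧
      evPi X = 0 ∧ (j = 0 → sysOp hu z X = b • unitData) ∧
      (∀ i, j = i + 1 → ∀ hi : i < n, sysOp hu z X = b • unitData + spec (res (Y i) (hc i hi), 0)) := by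
    intro j
    by_cases hj : j < n
    · rcases j with _ | j
      · obtain ⟨b, X, h1, h2, h3⟩ := h0
        exact ⟨b, X, fun _ => ⟨h1, h2, fun _ => h3, fun i hi => by omega⟩⟩
      · obtain ⟨b, X, h1, h2, h3⟩ := (h.assoc j hj).exists_sysOp hu (hc j (by omega))
        refine ⟨b, X, fun _ => ⟨h1, h2, fun h => by omega, fun i hi hin => ?_⟩⟩
        obtain rfl : j = i := by omega
        exact h3
    · exact ⟨0, 0, fun h => absurd h hj⟩
  choose b X hX using hall
  have hpos := h.pos
  have hspec : ∀ i (hi : i < n), spec (res (Y i) (hc i hi), 0) = spec (X i) := by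
    intro i hi
    have : (X i).1 = res (Y i) (hc i hi) := by
      ext x
      rw [← ext_coe, (hX i hi).1 x x.2]; rfl
    rw [spec_apply, spec_apply, this]
  refine le_order_of_chain (1 - volt hu) spec (differentiable_solOp hu)
    (fun z Y => solOp_sysOp hu z Y) unitData evPi (X := X) (b := b)
    ((hX 0 hpos).2.2.1 rfl) (fun j hj => ?_) ?_ (fun j hj => (hX j hj).2.1)
  · have := (hX (j + 1) hj).2.2.2 j rfl (by omega)
    rw [hspec j (by omega)] at this
    exact this
  -- If `b 0` were zero, the eigenfunction would have zero initial data and would vanish by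
  -- uniqueness.
  · intro hb
    have h1 := (hX 0 hpos).2.2.1 rfl
    rw [hb] at h1
    have h2 : (0 : ℂ) • unitData = 0 := zero_smul ℂ unitData
    rw [h2] at h1
    have h3 := solOp_sysOp hu z (X 0)
    rw [h1, map_zero] at h3
    obtain ⟨x, hx, hne⟩ := h.ne_zero
    rw [← (hX 0 hpos).1 x hx, ← h3] at hne
    exact hne rfl

/-- A zero of the characteristic function gives a chain. -/
lemma isChain_of_le_order (hu : MemL2 u) {z : ℂ} {n : ℕ} (hn : 0 < n)
    (h : (n : ℕ∞) ≤ analyticOrderAt (charFun hu) z) :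
    IsChain u z n (fun j => ext (((j.factorial : ℂ)⁻¹) • rootV hu j z).1) := by
  have hz : ∀ i < n, evPi (rootV hu i z) = 0 := by
    intro i hi
    rw [evPi_rootV]
    exact (natCast_le_analyticOrderAt_iff_iteratedDeriv_eq_zero
      ((differentiable_charFun hu).analyticAt z)).1 h i hi
  have hz' : ∀ i < n, evPi (((i.factorial : ℂ)⁻¹) • rootV hu i z) = 0 := by
    intro i hi
    rw [map_smul, hz i hi, smul_zero]
  refine ⟨hn, ?_, ?_, fun j hj => ?_⟩
  · refine exists_ext_ne_zero ?_
    rw [rootV_zero, Nat.factorial_zero, Nat.cast_one, inv_one]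
    have : (1 : ℂ) • omegaV hu z = omegaV hu z := one_smul ℂ (omegaV hu z)
    rw [this]
    exact omegaV_fst_ne_zero hu z
  · have h1 : sysOp hu z ((((0 : ℕ).factorial : ℂ)⁻¹) • rootV hu 0 z) = (1 : ℂ) • unitData + spec 0 := by
      rw [spec_zero, rootV_zero, Nat.factorial_zero, Nat.cast_one, inv_one, map_smul, omegaV,
        sysOp_solOp]
      exact (add_zero _).symm
    have h2 := dirichletOp_of_sysOp hu h1 (hz' 0 hn)
    have h3 : ∀ x, ext (0 : CI2).1 x = 0 := fun x => rfl
    simpa only [h3, add_zero] using h2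
  · have h1 : sysOp hu z ((((j + 1).factorial : ℂ)⁻¹) • rootV hu (j + 1) z)
        = (0 : ℂ) • unitData + spec (((j.factorial : ℂ)⁻¹) • rootV hu j z) := by
      have e0 : (0 : ℂ) • unitData = 0 := zero_smul ℂ unitData
      rw [e0, map_smul, sysOp_rootV_succ, map_smul, smul_smul]
      -- Derivatives satisfy the chain relation with an extra factor `j + 1`; the factorials absorb
      -- it.
      have e1 : (((j + 1).factorial : ℂ)⁻¹) * ((j : ℂ) + 1) = (j.factorial : ℂ)⁻¹ := by
        have h1 : (j.factorial : ℂ) ≠ 0 := by exact_mod_cast j.factorial_ne_zero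
        have h2 : (j : ℂ) + 1 ≠ 0 := by exact_mod_cast j.succ_ne_zero
        rw [Nat.factorial_succ]
        push_cast
        field_simp
      rw [e1]
      exact (zero_add _).symm
    exact dirichletOp_of_sysOp hu h1 (hz' (j + 1) hj)

lemma isEigenvalue_iff (hu : MemL2 u) (z : ℂ) : IsEigenvalue u z ↔ charFun hu z = 0 := by
  constructor
  · rintro ⟨y, hne, hy⟩
    have hch : IsChain u z 1 (fun _ => y) := ⟨one_pos, hne, hy, fun j hj => by omega⟩
    have := hch.le_order hu
    have h2 := (natCast_le_analyticOrderAt_iff_iteratedDeriv_eq_zero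
      ((differentiable_charFun hu).analyticAt z)).1 this 0 one_pos
    rwa [iteratedDeriv_zero] at h2
  · intro h
    have h1 : ((1 : ℕ) : ℕ∞) ≤ analyticOrderAt (charFun hu) z := by
      rw [natCast_le_analyticOrderAt_iff_iteratedDeriv_eq_zero ((differentiable_charFun hu).analyticAt z)]
      intro i hi
      obtain rfl : i = 0 := by omega
      rw [iteratedDeriv_zero, h]
    have hch := isChain_of_le_order hu one_pos h1
    exact ⟨_, hch.ne_zero, hch.eigen⟩

/-- The order of a zero of the characteristic function. -/
def mult (hu : MemL2 u) (z : ℂ) : ℕ := analyticOrderNatAt (charFun hu) z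

/-- The characteristic function does not vanish identically. -/
lemma exists_charFun_ne_zero (hu : MemL2 u) : ∃ z, charFun hu z ≠ 0 := by
  obtain ⟨m, hm⟩ := (eventually_hsNorm_le hu).exists
  have hz := norm_rad_sq m
  exact ⟨_, charFun_ne_zero_of_circle hu hz (hm _ hz)⟩

lemma order_ne_top (hu : MemL2 u) (z : ℂ) : analyticOrderAt (charFun hu) z ≠ ⊤ := by
  obtain ⟨w, hw⟩ := exists_charFun_ne_zero hu
  have han : AnalyticOnNhd ℂ (charFun hu) univ := fun z _ => (differentiable_charFun hu).analyticAt z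
  refine han.analyticOrderAt_ne_top_of_isPreconnected isPreconnected_univ (mem_univ w) (mem_univ z) ?_
  rw [((differentiable_charFun hu).analyticAt w).analyticOrderAt_eq_zero.2 hw]
  exact ENat.zero_ne_top

lemma coe_mult (hu : MemL2 u) (z : ℂ) : (mult hu z : ℕ∞) = analyticOrderAt (charFun hu) z :=
  Nat.cast_analyticOrderNatAt (order_ne_top hu z)

lemma mult_pos_iff (hu : MemL2 u) (z : ℂ) : 0 < mult hu z ↔ charFun hu z = 0 := by
  rw [pos_iff_ne_zero, ← not_iff_not, not_not]
  have := ((differentiable_charFun hu).analyticAt z).analyticOrderAt_eq_zero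
  rw [← coe_mult, Nat.cast_eq_zero] at this
  exact this

lemma hasAlgMultiplicity_mult (hu : MemL2 u) {z : ℂ} (hz : charFun hu z = 0) :
    HasAlgMultiplicity u z (mult hu z) := by
  refine ⟨⟨_, isChain_of_le_order hu ((mult_pos_iff hu z).2 hz) (coe_mult hu z).le⟩, ?_⟩
  rintro n ⟨Y, hY⟩
  have := hY.le_order hu
  rw [← coe_mult] at this
  exact_mod_cast this

lemma evPi_rootV_eq_zero (hu : MemL2 u) {z : ℂ} {j : ℕ} (hj : j < mult hu z) :
    evPi (rootV hu j z) = 0 := by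
  rw [evPi_rootV]
  exact (natCast_le_analyticOrderAt_iff_iteratedDeriv_eq_zero
    ((differentiable_charFun hu).analyticAt z)).1 (coe_mult hu z).le j hj

/-! ### Contour integrals of rational expressions and residues -/

lemma circleIntegral_sub_inv_pow {μ : ℂ} {R : ℝ} (n : ℕ) (hn : n ≠ 1) :
    ∮ z in C(0, R), ((μ - z) ^ n)⁻¹ = 0 := by
  have h := circleIntegral.integral_sub_zpow_of_ne (n := -(n : ℤ)) (by omega) 0 μ R
  have e : (fun z : ℂ => ((μ - z) ^ n)⁻¹) = fun z => (-1 : ℂ) ^ n * (z - μ) ^ (-(n : ℤ)) := by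
    funext z
    rw [← neg_sub z μ, neg_pow, mul_inv, zpow_neg, zpow_natCast, ← inv_pow]
    norm_num
  rw [e, circleIntegral.integral_const_mul, h, mul_zero]

/-- Contour integrals of a chain of functions with a pole at `μ`. -/
lemma circleIntegral_chain {R : ℝ} (hR : 0 < R) {μ : ℂ} (hμ : ‖μ‖ ≠ R) {r : ℕ → ℂ → ℂ} {a : ℕ → ℂ}
    {n : ℕ} (hc : ∀ j < n, ContinuousOn (r j) (Metric.sphere 0 R))
    (h : ∀ j < n, ∀ z ∈ Metric.sphere (0 : ℂ) R, (μ - z) * r j z + j * r (j - 1) z = a j) :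
    ∀ j < n, ∮ z in C(0, R), r j z = if ‖μ‖ < R then -(2 * Real.pi * Complex.I) * a j else 0 := by
  have hne : ∀ z ∈ Metric.sphere (0 : ℂ) R, μ - z ≠ 0 := by
    intro z hz h0
    rw [mem_sphere_zero_iff_norm] at hz
    rw [sub_eq_zero] at h0
    exact hμ (h0 ▸ hz)
  have hinv : ∀ k : ℕ, ContinuousOn (fun z : ℂ => ((μ - z) ^ k)⁻¹) (Metric.sphere 0 R) := fun k =>
    ((continuousOn_const.sub continuousOn_id).pow k).inv₀ fun z hz => pow_ne_zero k (hne z hz)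
  -- The statement is strengthened by arbitrary negative powers so that the induction closes: the
  -- recurrence trades the predecessor for a higher power of the pole, and such powers have zero
  -- integral. Only the simple pole survives.
  have key : ∀ j < n, ∀ k : ℕ, ∮ z in C(0, R), ((μ - z) ^ k)⁻¹ * r j z
      = a j * ∮ z in C(0, R), ((μ - z) ^ (k + 1))⁻¹ := by
    intro j
    induction j with
    | zero =>
      intro hj k
      rw [← circleIntegral.integral_const_mul]
      refine circleIntegral.integral_congr hR.le fun z hz => ?_
      have h1 := h 0 hj z hz
      have h2 := hne z hz
      simp only [Nat.cast_zero, zero_mul, add_zero] at h1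
      simp only [← h1]
      field_simp
      ring
    | succ j ih =>
      intro hj k
      have hj' : j < n := by omega
      have e1 : ∮ z in C(0, R), ((μ - z) ^ k)⁻¹ * r (j + 1) z
          = ∮ z in C(0, R), (a (j + 1) * ((μ - z) ^ (k + 1))⁻¹
            - ((j : ℂ) + 1) * (((μ - z) ^ (k + 1))⁻¹ * r j z)) := by
        refine circleIntegral.integral_congr hR.le fun z hz => ?_
        have h1 := h (j + 1) hj z hz
        have h2 := hne z hz
        simp only [Nat.add_sub_cancel, Nat.cast_add, Nat.cast_one] at h1
        simp only [← h1]
        field_simp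
        ring
      rw [e1, circleIntegral.integral_sub, circleIntegral.integral_const_mul,
        circleIntegral.integral_const_mul, ih hj' (k + 1),
        circleIntegral_sub_inv_pow (k + 1 + 1) (by omega)]
      · simp
      · exact (continuousOn_const.mul (hinv (k + 1))).circleIntegrable hR.le
      · exact (continuousOn_const.mul ((hinv (k + 1)).mul (hc j hj'))).circleIntegrable hR.le
  intro j hj
  have h1 := key j hj 0
  simp only [pow_zero, inv_one, one_mul, zero_add, pow_one] at h1
  rw [h1]
  split_ifs with hlt
  · rw [circleIntegral_inv_of_lt hlt]; ring
  · rw [circleIntegral_inv_of_gt hR.le (lt_of_le_of_ne (not_lt.1 hlt) (Ne.symm hμ)), mul_zero]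

lemma meromorphicOrderAt_quotient_nonneg {g a Δ : ℂ → ℂ} {z : ℂ} (hg : AnalyticAt ℂ g z)
    (ha : AnalyticAt ℂ a z) (hΔ : AnalyticAt ℂ Δ z) (htop : analyticOrderAt Δ z ≠ ⊤)
    (hle : analyticOrderAt Δ z ≤ analyticOrderAt g z) :
    0 ≤ meromorphicOrderAt (fun s => g s * a s / Δ s) z := by
  obtain ⟨n, hn⟩ := ENat.ne_top_iff_exists.1 htop
  obtain ⟨Δ₁, hΔ₁, hne, he⟩ := hΔ.analyticOrderAt_eq_natCast.1 hn.symm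
  rw [← hn, natCast_le_analyticOrderAt hg] at hle
  obtain ⟨g₁, hg₁, he₁⟩ := hle
  have : (fun s => g s * a s / Δ s) =ᶠ[𝓝[≠] z] fun s => g₁ s * a s / Δ₁ s := by
    filter_upwards [he.filter_mono nhdsWithin_le_nhds, he₁.filter_mono nhdsWithin_le_nhds,
      self_mem_nhdsWithin] with s h1 h2 h3
    have h4 : s - z ≠ 0 := sub_ne_zero.2 h3
    rw [h1, h2, smul_eq_mul, smul_eq_mul, mul_assoc, mul_div_mul_left _ _ (pow_ne_zero n h4)]
  rw [meromorphicOrderAt_congr this]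
  exact ((hg₁.mul ha).div hΔ₁ hne).meromorphicOrderAt_nonneg

/-- Cauchy's theorem for a quotient without poles. -/
lemma circleIntegral_quotient_eq_zero {R : ℝ} (hR : 0 < R) {g a Δ : ℂ → ℂ} (hg : Differentiable ℂ g)
    (ha : Differentiable ℂ a) (hΔ : Differentiable ℂ Δ) (htop : ∀ z, analyticOrderAt Δ z ≠ ⊤)
    (hs : ∀ z ∈ Metric.sphere (0 : ℂ) R, Δ z ≠ 0)
    (hle : ∀ z ∈ Metric.ball (0 : ℂ) R, analyticOrderAt Δ z ≤ analyticOrderAt g z) :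
    ∮ z in C(0, R), g z * a z / Δ z = 0 := by
  set f : ℂ → ℂ := fun s => g s * a s / Δ s with hf
  have hmer : MeromorphicOn f (Metric.closedBall 0 R) := fun z _ =>
    ((hg.analyticAt z).mul (ha.analyticAt z)).meromorphicAt.div (hΔ.analyticAt z).meromorphicAt
  have hle' : ∀ z ∈ Metric.closedBall (0 : ℂ) R, 0 ≤ meromorphicOrderAt f z := by
    intro z hz
    refine meromorphicOrderAt_quotient_nonneg (hg.analyticAt z) (ha.analyticAt z) (hΔ.analyticAt z)
      (htop z) ?_
    rcases (Metric.mem_closedBall.1 hz).lt_or_eq with h | h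
    · exact hle z h
    · rw [(hΔ.analyticAt z).analyticOrderAt_eq_zero.2 (hs z h)]; exact zero_le
  -- The normal form fills in the removable singularities inside the disc and agrees with `f` on the
  -- circle.
  set F := toMeromorphicNFOn f (Metric.closedBall 0 R) with hF
  have hFan : ∀ z ∈ Metric.closedBall (0 : ℂ) R, AnalyticAt ℂ F z := by
    intro z hz
    refine (MeromorphicNFAt.meromorphicOrderAt_nonneg_iff_analyticAt
      (meromorphicNFOn_toMeromorphicNFOn f (Metric.closedBall 0 R) hz)).1 ?_
    rw [meromorphicOrderAt_toMeromorphicNFOn hmer hz]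
    exact hle' z hz
  have hFf : EqOn f F (Metric.sphere 0 R) := by
    intro z hz
    have hz' := Metric.sphere_subset_closedBall hz
    have : AnalyticAt ℂ f z :=
      ((hg.analyticAt z).mul (ha.analyticAt z)).div (hΔ.analyticAt z) (hs z hz)
    rw [hF, toMeromorphicNFOn_eq_toMeromorphicNFAt hmer hz',
      toMeromorphicNFAt_eq_self.2 this.meromorphicNFAt]
  rw [circleIntegral.integral_congr hR.le hFf]
  refine DiffContOnCl.circleIntegral_eq_zero hR.le ?_
  refine DifferentiableOn.diffContOnCl fun z hz => ?_
  rw [closure_ball _ hR.ne'] at hz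
  exact (hFan z hz).differentiableAt.differentiableWithinAt

/-- Residue formula with unspecified coefficients. -/
lemma exists_residue_formula {R : ℝ} (hR : 0 < R) {a Δ : ℂ → ℂ} 
    (ha : Differentiable ℂ a) (hΔ : Differentiable ℂ Δ) (htop : ∀ z, analyticOrderAt Δ z ≠ ⊤)
    (hs : ∀ z ∈ Metric.sphere (0 : ℂ) R, Δ z ≠ 0) {S : Finset ℂ}
    (hS : ∀ z ∈ Metric.ball (0 : ℂ) R, Δ z = 0 → z ∈ S) :
    ∃ κ : (Σ μ : S, Fin (analyticOrderNatAt Δ μ)) → ℂ, ∀ g : ℂ → ℂ, Differentiable ℂ g →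
      ∮ z in C(0, R), g z * a z / Δ z = ∑ i, κ i * iteratedDeriv i.2 g i.1 := by
  let V : Submodule ℂ (ℂ → ℂ) :=
    { carrier := {g | Differentiable ℂ g}
      add_mem' := fun h1 h2 => Differentiable.add h1 h2
      zero_mem' := differentiable_const 0
      smul_mem' := fun c _ h => Differentiable.const_smul h c }
  have hcont : ∀ g : ℂ → ℂ, Differentiable ℂ g →
      CircleIntegrable (fun z => g z * a z / Δ z) 0 R := fun g hg =>
    ((hg.continuous.mul ha.continuous).continuousOn.div hΔ.continuous.continuousOn
      hs).circleIntegrable hR.le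
  let K : V →ₗ[ℂ] ℂ :=
    { toFun := fun g => ∮ z in C(0, R), g.1 z * a z / Δ z
      map_add' := fun g₁ g₂ => by
        rw [← circleIntegral.integral_add (hcont _ g₁.2) (hcont _ g₂.2)]
        refine congrArg (fun F : ℂ → ℂ => circleIntegral F 0 R) (funext fun z => ?_)
        simp only [Submodule.coe_add, Pi.add_apply]; ring
      map_smul' := fun c g => by
        rw [RingHom.id_apply, smul_eq_mul, ← circleIntegral.integral_const_mul]
        refine congrArg (fun F : ℂ → ℂ => circleIntegral F 0 R) (funext fun z => ?_)
        simp only [Submodule.coe_smul, Pi.smul_apply, smul_eq_mul]; ring }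
  let ℓ : (Σ μ : S, Fin (analyticOrderNatAt Δ μ)) → V →ₗ[ℂ] ℂ := fun i =>
    { toFun := fun g => iteratedDeriv i.2 g.1 i.1
      map_add' := fun g₁ g₂ => by
        have h1 : ContDiff ℂ i.2 g₁.1 := Differentiable.contDiff g₁.2
        have h2 : ContDiff ℂ i.2 g₂.1 := Differentiable.contDiff g₂.2
        exact iteratedDeriv_add h1.contDiffAt h2.contDiffAt
      map_smul' := fun c g => by
        have h1 : ContDiff ℂ i.2 g.1 := Differentiable.contDiff g.2
        exact iteratedDeriv_const_smul h1.contDiffAt c }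
  -- No residue is computed. If all the listed derivatives of `g` vanish, then `Δ` divides `g a` in
  -- the disc and the integral is zero by Cauchy; a functional vanishing on a finite intersection of
  -- kernels is a combination of the functionals.
  have hK : K ∈ Submodule.span ℂ (range ℓ) := by
    refine mem_span_of_iInf_ker_le_ker fun g hg => ?_
    simp only [Submodule.mem_iInf, LinearMap.mem_ker] at hg ⊢
    refine circleIntegral_quotient_eq_zero hR g.2 ha hΔ htop hs fun z hz => ?_
    by_cases h0 : Δ z = 0
    · rw [← Nat.cast_analyticOrderNatAt (htop z), natCast_le_analyticOrderAt_iff_iteratedDeriv_eq_zero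
        (Differentiable.analyticAt g.2 z)]
      exact fun i hi => hg ⟨⟨z, hS z hz h0⟩, ⟨i, hi⟩⟩
    · rw [(hΔ.analyticAt z).analyticOrderAt_eq_zero.2 h0]; exact zero_le
  obtain ⟨κ, hκ⟩ := (Submodule.mem_span_range_iff_exists_fun ℂ).1 hK
  refine ⟨κ, fun g hg => ?_⟩
  have := congrArg (fun T : V →ₗ[ℂ] ℂ => T ⟨g, hg⟩) hκ
  simp only [LinearMap.sum_apply, LinearMap.smul_apply, smul_eq_mul] at this
  exact this.symm

variable {u : ℝ → ℂ}

/-! ### Riesz projections -/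

lemma finite_zeros (hu : MemL2 u) (R : ℝ) : {z : ℂ | charFun hu z = 0 ∧ ‖z‖ < R}.Finite := by
  by_contra hinf
  obtain ⟨z, -, hz⟩ := Set.Infinite.exists_accPt_of_subset_isCompact hinf
    (isCompact_closedBall (0 : ℂ) R) fun z hz => by simpa using hz.2.le
  have h1 : ∃ᶠ s in 𝓝[≠] z, charFun hu s = 0 := by
    rw [accPt_iff_frequently_nhdsNE] at hz
    exact hz.mono fun s hs => hs.1
  have han := (differentiable_charFun hu).analyticAt z
  exact order_ne_top hu z (analyticOrderAt_eq_top.2 (han.frequently_zero_iff_eventually_zero.1 h1))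

/-- The zeros of the characteristic function in an open disc. -/
def zerosIn (hu : MemL2 u) (R : ℝ) : Finset ℂ := (finite_zeros hu R).toFinset

lemma mem_zerosIn (hu : MemL2 u) {R : ℝ} {z : ℂ} :
    z ∈ zerosIn hu R ↔ charFun hu z = 0 ∧ ‖z‖ < R := by
  simp [zerosIn]

/-- Indices of the root functions belonging to an open disc. -/
abbrev RootIdx (hu : MemL2 u) (R : ℝ) := Σ μ : zerosIn hu R, Fin (mult hu μ)

/-- The range of a Riesz projection consists of root functions. -/
lemma exists_projOp_eq_sum (hu : MemL2 u) {R : ℝ} (hR : 0 < R)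
    (hs : ∀ z ∈ Metric.sphere (0 : ℂ) R, charFun hu z ≠ 0) (Φ : CI2) :
    ∃ κ : RootIdx hu R → ℂ, (projOp hu 0 R Φ).1 = ∑ i, κ i • (rootV hu i.2 i.1).1 := by
  have ha : Differentiable ℂ fun z => evPi (solOp hu z Φ) := fun z =>
    evPi.differentiableAt.comp z ((differentiable_solOp hu z).clm_apply (differentiableAt_const Φ))
  -- The coefficients depend on `Φ` but not on the function `g`; taking `g = ω(x, ·)` for every `x`
  -- gives one combination of functions.
  obtain ⟨κ, hκ⟩ := exists_residue_formula hR ha (differentiable_charFun hu) (order_ne_top hu) hs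
    (S := zerosIn hu R) fun z hz h0 => (mem_zerosIn hu).2 ⟨h0, by simpa using hz⟩
  refine ⟨fun i => (2 * Real.pi * Complex.I)⁻¹ * κ i, ?_⟩
  ext x
  have h1 := clm_projOp hu hR.le hs (evAt x) Φ
  have hw : Differentiable ℂ fun z => evAt x (omegaV hu z) := fun z =>
    (evAt x).differentiableAt.comp z (differentiable_omegaV hu z)
  have hsol : Differentiable ℂ fun z => evAt x (solOp hu z Φ) := fun z =>
    (evAt x).differentiableAt.comp z ((differentiable_solOp hu z).clm_apply (differentiableAt_const Φ))
  -- The solution of the initial value problem is entire in `z` and integrates to zero; only the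
  -- quotient by the characteristic function contributes.
  have e : ∮ z in C(0, R), evAt x (resOp hu z Φ) = (∮ z in C(0, R), evAt x (solOp hu z Φ))
      - ∮ z in C(0, R), evAt x (omegaV hu z) * evPi (solOp hu z Φ) / charFun hu z := by
    have hi : CircleIntegrable
        (fun z => evAt x (omegaV hu z) * evPi (solOp hu z Φ) / charFun hu z) 0 R :=
      ((hw.continuous.mul ha.continuous).continuousOn.div
        (differentiable_charFun hu).continuous.continuousOn hs).circleIntegrable hR.le
    rw [← circleIntegral.integral_sub (hsol.continuous.continuousOn.circleIntegrable hR.le) hi]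
    refine congrArg (fun F : ℂ → ℂ => circleIntegral F 0 R) (funext fun z => ?_)
    rw [resOp_apply, map_sub, map_smul, smul_eq_mul]
    ring
  rw [e, hκ _ hw, DiffContOnCl.circleIntegral_eq_zero hR.le hsol.diffContOnCl, zero_sub,
    inv_neg, neg_mul_neg, Finset.mul_sum] at h1
  have h2 : evAt x (projOp hu 0 R Φ) = (projOp hu 0 R Φ).1 x := rfl
  rw [← h2, h1, ContinuousMap.sum_apply]
  refine Finset.sum_congr rfl fun i _ => ?_
  rw [← clm_rootV hu (evAt x), ContinuousMap.smul_apply, smul_eq_mul, ← mul_assoc]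
  rfl

/-- A Riesz projection acts on the root functions as the identity or as zero. -/
lemma projOp_spec_rootV (hu : MemL2 u) {R : ℝ} (hR : 0 < R)
    (hs : ∀ z ∈ Metric.sphere (0 : ℂ) R, charFun hu z ≠ 0) {μ : ℂ} {j : ℕ} (hj : j < mult hu μ) :
    (projOp hu 0 R (spec (rootV hu j μ))).1 = if ‖μ‖ < R then (rootV hu j μ).1 else 0 := by
  have h0 : charFun hu μ = 0 := (mult_pos_iff hu μ).1 (by omega)
  have hμ : ‖μ‖ ≠ R := fun h => hs μ (by simpa using h) h0
  have hI : (2 * Real.pi * Complex.I : ℂ) ≠ 0 := Complex.two_pi_I_ne_zero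
  ext x
  have h1 := clm_projOp hu hR.le hs (evAt x) (spec (rootV hu j μ))
  have h2 := circleIntegral_chain hR hμ (n := mult hu μ)
    (r := fun j z => evAt x (resOp hu z (spec (rootV hu j μ)))) (a := fun j => evAt x (rootV hu j μ))
    (fun j _ z hz => by
      have h1 := (differentiableAt_resOp hu (hs z hz)).continuousAt
      have h2 : ContinuousAt (fun z => resOp hu z (spec (rootV hu j μ))) z :=
        h1.clm_apply continuousAt_const
      exact ((evAt x).continuous.continuousAt.comp h2).continuousWithinAt)
    (fun j hj z hz => by
      have := congrArg (evAt x) (resOp_spec_rootV hu (hs z hz) (evPi_rootV_eq_zero hu hj))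
      rwa [map_add, map_smul, map_smul] at this) j hj
  have h3 : evAt x (projOp hu 0 R (spec (rootV hu j μ))) = (projOp hu 0 R (spec (rootV hu j μ))).1 x := rfl
  rw [← h3, h1, h2]
  split_ifs
  · rw [← mul_assoc, inv_mul_cancel₀ (neg_ne_zero.2 hI), one_mul]; rfl
  · rw [mul_zero]; rfl

/-! ### Independence of the root functions -/

section Chains

variable {V : Type*} [AddCommGroup V] [Module ℂ V]

lemma chain_sub_apply {B : Module.End ℂ V} {c : ℂ} (hc : c ≠ 0) {v : ℕ → V} {j : ℕ}
    (h : c • B (v j) + (j : ℂ) • B (v (j - 1)) = v j) :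
    (B - c⁻¹ • (1 : Module.End ℂ V)) (v j) = (-(c⁻¹ * j)) • B (v (j - 1)) := by
  have h1 : B (v j) + (c⁻¹ * j) • B (v (j - 1)) = c⁻¹ • v j := by
    rw [← h, smul_add, smul_smul, smul_smul, inv_mul_cancel₀ hc, one_smul, h]
  rw [LinearMap.sub_apply, LinearMap.smul_apply, Module.End.one_apply, ← h1, neg_smul]
  abel

/-- The operator `N = B - c⁻¹` sends `v j` to a multiple of `B (v (j - 1))`, commutes with `B`, and
`B` acts on `v 0` as `c⁻¹`. After `j` steps a nonzero multiple of `v 0` remains. -/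
lemma chain_pow_apply {B : Module.End ℂ V} {c : ℂ} (hc : c ≠ 0) {v : ℕ → V} {n : ℕ}
    (h : ∀ j < n, c • B (v j) + (j : ℂ) • B (v (j - 1)) = v j) (j : ℕ) (hj : j < n) :
    ((B - c⁻¹ • (1 : Module.End ℂ V)) ^ j) (v j) = ((-(c⁻¹ * c⁻¹)) ^ j * j.factorial) • v 0 := by
  set N := B - c⁻¹ • (1 : Module.End ℂ V) with hN
  have hcomm : Commute N B := by
    rw [hN]
    exact (Commute.refl B).sub_left ((Commute.one_left B).smul_left c⁻¹)
  have h0 : 0 < n → B (v 0) = c⁻¹ • v 0 := by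
    intro hn
    have := h 0 hn
    rw [Nat.cast_zero, zero_smul, add_zero] at this
    rw [← this, smul_smul, inv_mul_cancel₀ hc, one_smul, this]
  induction j with
  | zero => simp
  | succ j ih =>
    rw [pow_succ, Module.End.mul_apply, chain_sub_apply hc (h (j + 1) hj), Nat.add_sub_cancel, map_smul,
      ← Module.End.mul_apply, (hcomm.pow_left j).eq, Module.End.mul_apply, ih (by omega), map_smul,
      h0 (by omega), smul_smul, smul_smul]
    congr 1
    rw [Nat.factorial_succ]
    push_cast
    ring

lemma chain_pow_succ_apply {B : Module.End ℂ V} {c : ℂ} (hc : c ≠ 0) {v : ℕ → V} {n : ℕ}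
    (h : ∀ j < n, c • B (v j) + (j : ℂ) • B (v (j - 1)) = v j) {j k : ℕ} (hj : j < n) (hk : j < k) :
    ((B - c⁻¹ • (1 : Module.End ℂ V)) ^ k) (v j) = 0 := by
  obtain ⟨i, rfl⟩ : ∃ i, k = i + (1 + j) := ⟨k - (1 + j), by omega⟩
  rw [pow_add, pow_add, Module.End.mul_apply, Module.End.mul_apply, chain_pow_apply hc h j hj, pow_one,
    map_smul, chain_sub_apply hc (h 0 (by omega)), Nat.cast_zero, mul_zero, neg_zero, zero_smul,
    smul_zero, map_zero]

/-- The power `N^n` annihilates the earlier members of the chain but not `v n`, so the last member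
is never in the span of the others. -/
lemma linearIndependent_chain {B : Module.End ℂ V} {c : ℂ} (hc : c ≠ 0) {v : ℕ → V} {n : ℕ}
    (h : ∀ j < n, c • B (v j) + (j : ℂ) • B (v (j - 1)) = v j) (hv : v 0 ≠ 0) :
    LinearIndependent ℂ fun j : Fin n => v j := by
  induction n with
  | zero => exact linearIndependent_empty_type
  | succ n ih =>
    rw [linearIndependent_finSucc']
    refine ⟨ih fun j hj => h j (by omega), fun hmem => ?_⟩
    have hle : Submodule.span ℂ (range fun j : Fin n => v j)
        ≤ LinearMap.ker ((B - c⁻¹ • (1 : Module.End ℂ V)) ^ n) := by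
      rw [Submodule.span_le]
      rintro _ ⟨j, rfl⟩
      exact chain_pow_succ_apply hc h (j := j) (by omega) j.2
    have h1 := hle hmem
    rw [LinearMap.mem_ker, Fin.val_last, chain_pow_apply hc h n (by omega), smul_eq_zero] at h1
    rcases h1 with h1 | h1
    · have : (n.factorial : ℂ) ≠ 0 := by exact_mod_cast n.factorial_ne_zero
      have h2 : (-(c⁻¹ * c⁻¹)) ^ n ≠ 0 := pow_ne_zero _ (neg_ne_zero.2 (by simp [hc]))
      exact (mul_ne_zero h2 this) h1
    · exact hv h1

/-- Chains for distinct eigenvalues are independent. -/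
lemma linearIndependent_chains (B : Module.End ℂ V) {ι : Type*} {c : ι → ℂ} (hinj : Function.Injective c)
    (hc : ∀ i, c i ≠ 0) {v : ι → ℕ → V} {n : ι → ℕ}
    (h : ∀ i, ∀ j < n i, c i • B (v i j) + (j : ℂ) • B (v i (j - 1)) = v i j) (hv : ∀ i, v i 0 ≠ 0) :
    LinearIndependent ℂ fun s : Σ i, Fin (n i) => v s.1 s.2 := by
  refine linearIndependent_iUnion_finite (f := fun i (j : Fin (n i)) => v i j)
    (fun i => linearIndependent_chain (hc i) (h i) (hv i)) fun i t _ hi => ?_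
  have hind : iSupIndep fun i => B.maxGenEigenspace (c i)⁻¹ :=
    B.independent_maxGenEigenspace.comp (f := fun i => (c i)⁻¹) fun a b hab => hinj (inv_injective hab)
  have hle : ∀ i, Submodule.span ℂ (range fun j : Fin (n i) => v i j)
      ≤ B.maxGenEigenspace (c i)⁻¹ := by
    intro i
    rw [Submodule.span_le]
    rintro _ ⟨j, rfl⟩
    rw [SetLike.mem_coe, Module.End.mem_maxGenEigenspace]
    exact ⟨j + 1, chain_pow_succ_apply (hc i) (h i) j.2 (Nat.lt_succ_self _)⟩
  refine (hind i).mono (hle i) (iSup₂_le fun k hk => (hle k).trans ?_)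
  exact le_iSup₂_of_le k (fun hki => hi (hki ▸ hk)) le_rfl

end Chains

variable {u : ℝ → ℂ}

/-- The resolvent as an operator on continuous functions. -/
def resEnd (hu : MemL2 u) (z : ℂ) : Module.End ℂ CI :=
  (((ContinuousLinearMap.fst ℂ CI CI).comp ((resOp hu z).comp spec)).comp
    (ContinuousLinearMap.inl ℂ CI CI)).toLinearMap

/-- The resolvent at one regular point `z` is a linear operator on continuous functions for which
the root functions of `μ` lie in the generalized eigenspace of `(μ - z)⁻¹`; distinct eigenvalues
give independent spaces. -/
lemma linearIndependent_rootV (hu : MemL2 u) {ι : Type*} {μ : ι → ℂ} (hinj : Function.Injective μ)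
    (hμ : ∀ i, charFun hu (μ i) = 0) :
    LinearIndependent ℂ fun s : Σ i, Fin (mult hu (μ i)) => (rootV hu s.2 (μ s.1)).1 := by
  obtain ⟨z, hz⟩ := exists_charFun_ne_zero hu
  refine linearIndependent_chains (resEnd hu z) (c := fun i => μ i - z)
    (v := fun i j => (rootV hu j (μ i)).1) (n := fun i => mult hu (μ i))
    (fun a b hab => hinj (sub_left_injective hab))
    (fun i h => hz ?_) (fun i j hj => ?_) fun i => ?_
  · rw [sub_eq_zero] at h
    rw [← h, hμ i]
  · exact congrArg Prod.fst (resOp_spec_rootV hu hz (evPi_rootV_eq_zero hu hj))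
  · simp only [rootV_zero]
    exact omegaV_fst_ne_zero hu (μ i)

/-! ### The Riesz projections as operators from `L₂[0, π]` to `C[0, π]` -/

lemma ext_smul (c : ℂ) (φ : CI) : ext (c • φ) = fun x => c * ext φ x := rfl

/-- The inclusion of `C[0, π]` into `L₂[0, π]`. -/
def incl : CI →L[ℂ] Lp ℂ 2 muI :=
  LinearMap.mkContinuous
    { toFun := fun φ => toL2 (ext φ) (memL2_ext φ)
      map_add' := fun _ _ => rfl
      map_smul' := fun _ _ => rfl } √Real.pi fun φ => by
    change ‖toL2 (ext φ) (memL2_ext φ)‖ ≤ _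
    rw [← normL2_eq_norm]
    exact normL2_le_of_bound (norm_nonneg _) fun x _ => norm_ext_le φ x

lemma incl_apply (φ : CI) : incl φ = toL2 (ext φ) (memL2_ext φ) := rfl

lemma norm_incl_le (φ : CI) : ‖incl φ‖ ≤ √Real.pi * ‖φ‖ :=
  (LinearMap.mkContinuous_norm_le _ (Real.sqrt_nonneg _) _ |> fun h =>
    (incl.le_opNorm φ).trans (mul_le_mul_of_nonneg_right h (norm_nonneg _)))

lemma incl_injective : Function.Injective incl := by
  rw [injective_iff_map_eq_zero]
  intro φ hφ
  ext x
  rw [← ext_coe]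
  refine eq_zero_of_integral_eq_zero (continuous_ext φ) (fun y hy => ?_) x.2
  have h1 : ext φ =ᵐ[muI] 0 := by
    have h2 : MemLp.toLp (ext φ) (memL2_ext φ) = MemLp.toLp 0 (MemLp.zero (ε := ℂ)) := by
      rw [MemLp.toLp_zero]; exact hφ
    exact (MemLp.toLp_eq_toLp_iff _ _).1 h2
  rw [intervalIntegral.integral_of_le hy.1]
  have h2 : ext φ =ᵐ[volume.restrict (Ioc 0 y)] 0 :=
    ae_restrict_of_ae_restrict_of_subset (t := Icc 0 Real.pi)
      (fun t ht => ⟨ht.1.le, ht.2.trans hy.2⟩) h1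
  rw [integral_congr_ae h2]
  simp

lemma norm_intOp_one_le {f : ℝ → ℂ} (hf : MemL2 f) :
    ‖intOp f hf.intervalIntegrable 1‖ ≤ √Real.pi * normL2 f := by
  refine (ContinuousMap.norm_le _ (by have := normL2_nonneg f; positivity)).2 fun x => ?_
  rw [intOp_one_apply]
  have hone : MemL2 (fun _ => (1 : ℂ)) := memL2_of_continuousOn continuousOn_const
  have hn : MemL2 (fun t => ((‖f t‖ : ℝ) : ℂ)) :=
    (MemLp.norm hf).ofReal
  calc ‖∫ t in (0 : ℝ)..x, f t‖ ≤ ∫ t in (0 : ℝ)..x, ‖f t‖ :=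
        intervalIntegral.norm_integral_le_integral_norm x.2.1
    _ ≤ ∫ t in (0 : ℝ)..Real.pi, ‖f t‖ := integral_norm_le_I hf.intervalIntegrable x.2
    _ ≤ ‖inn (fun t => ((‖f t‖ : ℝ) : ℂ)) (fun _ => 1)‖ := by
        have : inn (fun t => ((‖f t‖ : ℝ) : ℂ)) (fun _ => 1)
            = ((∫ t in (0 : ℝ)..Real.pi, ‖f t‖ : ℝ) : ℂ) := by
          rw [inn, ← intervalIntegral.integral_ofReal]
          simp
        rw [this, Complex.norm_real]
        exact le_abs_self _
    _ ≤ normL2 (fun t => ((‖f t‖ : ℝ) : ℂ)) * normL2 (fun _ => 1) := norm_inn_le hn hone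
    _ ≤ normL2 f * (√Real.pi * 1) := by
        have e : normL2 (fun t => ((‖f t‖ : ℝ) : ℂ)) = normL2 f := by simp [normL2]
        rw [e]
        exact mul_le_mul_of_nonneg_left (normL2_le_of_bound zero_le_one fun x _ => by simp)
          (normL2_nonneg f)
    _ = √Real.pi * normL2 f := by ring

lemma intOp_one_congr {f g : ℝ → ℂ} (hf : IntervalIntegrable f volume 0 Real.pi)
    (hg : IntervalIntegrable g volume 0 Real.pi) (h : f =ᵐ[muI] g) : intOp f hf 1 = intOp g hg 1 := by
  ext x
  rw [intOp_one_apply, intOp_one_apply, intervalIntegral.integral_of_le x.2.1,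
    intervalIntegral.integral_of_le x.2.1]
  exact integral_congr_ae
    (ae_restrict_of_ae_restrict_of_subset (t := Icc 0 Real.pi)
      (fun t ht => ⟨ht.1.le, ht.2.trans x.2.2⟩) h)

/-- Indefinite integration as an operator from `L₂[0, π]` to `C[0, π]`. -/
def primOp : Lp ℂ 2 muI →L[ℂ] CI :=
  LinearMap.mkContinuous
    { toFun := fun F => intOp F (MemL2.intervalIntegrable (Lp.memLp F)) 1
      map_add' := fun F G => by
        have hF := MemL2.intervalIntegrable (Lp.memLp F)
        have hG := MemL2.intervalIntegrable (Lp.memLp G)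
        rw [intOp_one_congr _ (hF.add hG) (Lp.coeFn_add F G)]
        ext x
        rw [ContinuousMap.add_apply, intOp_one_apply, intOp_one_apply, intOp_one_apply]
        exact intervalIntegral.integral_add (IntervalIntegrable.sub_I hF x.2) (IntervalIntegrable.sub_I hG x.2)
      map_smul' := fun c F => by
        have hF := MemL2.intervalIntegrable (Lp.memLp F)
        rw [intOp_one_congr _ (hF.smul c) (Lp.coeFn_smul c F)]
        ext x
        rw [RingHom.id_apply, ContinuousMap.smul_apply, intOp_one_apply, intOp_one_apply]
        exact intervalIntegral.integral_smul c _ } √Real.pi fun F => by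
    have h := norm_intOp_one_le (f := F) (Lp.memLp F)
    rwa [normL2_eq_norm (Lp.memLp F), toL2_coe] at h

lemma primOp_toL2 {f : ℝ → ℂ} (hf : MemL2 f) : primOp (toL2 f hf) = intOp f hf.intervalIntegrable 1 :=
  intOp_one_congr (MemL2.intervalIntegrable (Lp.memLp _)) _ (MemLp.coeFn_toLp hf)

/-- The data of the equation `l(y) = z y + f` with zero initial values. -/
def srcOp : Lp ℂ 2 muI →L[ℂ] CI2 := (0 : Lp ℂ 2 muI →L[ℂ] CI).prod (-primOp)

lemma srcOp_toL2 {f : ℝ → ℂ} (hf : MemL2 f) :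
    srcOp (toL2 f hf) = initData 0 0 f hf.intervalIntegrable := by
  refine Prod.ext ?_ ?_
  · ext x; simp [srcOp, initData]
  · have : (srcOp (toL2 f hf)).2 = -primOp (toL2 f hf) := rfl
    rw [this, primOp_toL2]
    ext x; simp [initData]

lemma srcOp_incl (Y : CI2) : srcOp (incl Y.1) = spec Y := by
  rw [incl_apply, srcOp_toL2, spec_eq_initData]

/-- The Riesz projection of the disc of radius `(m + 1/2)²`. -/
def riesz (hu : MemL2 u) (m : ℕ) : Lp ℂ 2 muI →L[ℂ] CI :=
  (ContinuousLinearMap.fst ℂ CI CI).comp ((projOp hu 0 (rad m ^ 2)).comp srcOp)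

lemma riesz_apply (hu : MemL2 u) (m : ℕ) (F : Lp ℂ 2 muI) :
    riesz hu m F = (projOp hu 0 (rad m ^ 2) (srcOp F)).1 := rfl

/-- The function `√(2/π) sin nx`. -/
def sinCI (n : ℕ) : CI := res (sinFun n) (continuous_sinFun n).continuousOn

lemma incl_sinCI (n : ℕ) : incl (sinCI n) = toL2 (sinFun n) (memL2_sinFun n) :=
  toL2_congr (memL2_ext _) _ fun _ hx => ext_res _ hx

/-- The partial sum of the sine series. -/
def sineSum (m : ℕ) : Lp ℂ 2 muI →L[ℂ] CI :=
  ∑ n ∈ Finset.Icc 1 m, (innerSL ℂ (incl (sinCI n))).smulRight (sinCI n)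

lemma sineSum_apply (m : ℕ) (F : Lp ℂ 2 muI) :
    sineSum m F = ∑ n ∈ Finset.Icc 1 m, inner ℂ (incl (sinCI n)) F • sinCI n := by
  simp [sineSum]

lemma inner_sinCI {f : ℝ → ℂ} (hf : MemL2 f) (n : ℕ) :
    inner ℂ (incl (sinCI n)) (toL2 f hf) = sineCoeff f n := by
  rw [incl_sinCI, ← inn_eq_inner hf (memL2_sinFun n), sineCoeff_eq]

lemma sineSum_toL2 (m : ℕ) {f : ℝ → ℂ} (hf : MemL2 f) :
    sineSum m (toL2 f hf) = ∑ n ∈ Finset.Icc 1 m, sineCoeff f n • sinCI n := by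
  simp only [sineSum_apply, inner_sinCI hf]

lemma ext_sum {ι : Type*} (s : Finset ι) (φ : ι → CI) (x : ℝ) :
    ext (∑ i ∈ s, φ i) x = ∑ i ∈ s, ext (φ i) x := by
  simp only [ext, IccExtend, Function.comp_apply, ContinuousMap.sum_apply]

lemma ext_sineSum_toL2 (m : ℕ) {f : ℝ → ℂ} (hf : MemL2 f) {x : ℝ} (hx : x ∈ Icc (0 : ℝ) Real.pi) :
    ext (sineSum m (toL2 f hf)) x = ∑ n ∈ Finset.Icc 1 m, sineCoeff f n * sinFun n x := by
  rw [sineSum_toL2, ext_sum]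
  refine Finset.sum_congr rfl fun n _ => ?_
  rw [ext_smul]
  exact congrArg _ (ext_res _ hx)

lemma tendsto_incl_sineSum (F : Lp ℂ 2 muI) :
    Tendsto (fun m => incl (sineSum m F)) atTop (𝓝 F) := by
  obtain ⟨f, hf, rfl⟩ : ∃ f, ∃ hf : MemL2 f, toL2 f hf = F := ⟨F, Lp.memLp F, toL2_coe F⟩
  have h := tendsto_sine_sum hf
  rw [tendsto_iff_norm_sub_tendsto_zero]
  refine h.congr fun m => ?_
  have hs : MemL2 (fun x => ∑ n ∈ Finset.Icc 1 m, sineCoeff f n * sinFun n x) :=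
    MemL2.sum fun n _ => (memL2_sinFun n).const_mul _
  rw [normL2_eq_norm (hf.sub hs), toL2_sub hf hs, norm_sub_rev]
  congr 2
  exact toL2_congr _ (memL2_ext _) fun x hx => (ext_sineSum_toL2 m hf hx).symm

lemma sineSum_incl_sinCI {m n : ℕ} (hn : n ∈ Finset.Icc 1 m) : sineSum m (incl (sinCI n)) = sinCI n := by
  rw [incl_sinCI, sineSum_toL2, Finset.sum_eq_single n]
  · rw [sineCoeff_eq, inn_sinFun_sinFun _ _ (by have := (Finset.mem_Icc.1 hn).1; omega), if_pos rfl,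
      one_smul]
  · intro k hk hne
    rw [sineCoeff_eq, inn_sinFun_sinFun _ _ (by have := (Finset.mem_Icc.1 hk).1; omega),
      if_neg hne.symm]
    exact zero_smul ℂ (sinCI k)
  · exact fun h => absurd hn h

/-- The rate of equiconvergence. -/
def rate (u : ℝ → ℂ) (m : ℕ) : ℝ := √(firstConst u m).toReal + 32 * √(remConst u m).toReal

lemma tendsto_rate (hu : MemL2 u) : Tendsto (rate u) atTop (𝓝 0) := by
  have h : ∀ c : ℕ → ℝ≥0∞, Tendsto c atTop (𝓝 0) → Tendsto (fun m => √(c m).toReal) atTop (𝓝 0) := by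
    intro c hc
    have h1 := (ENNReal.tendsto_toReal ENNReal.zero_ne_top).comp hc
    have h2 := (Real.continuous_sqrt.tendsto 0).comp h1
    rw [Real.sqrt_zero] at h2
    exact h2
  have := (h _ (tendsto_firstConst hu)).add ((h _ (tendsto_remConst hu)).const_mul 32)
  rw [mul_zero, add_zero] at this
  exact this

/-- The circle of radius `(m + 1/2)²` separates the spectrum and the Riesz projection is close to
the partial sum of the sine series. -/
structure Separates (hu : MemL2 u) (m : ℕ) : Prop where
  ne_zero : ∀ z ∈ Metric.sphere (0 : ℂ) (rad m ^ 2), charFun hu z ≠ 0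
  norm_le : ∀ F, ‖riesz hu m F - sineSum m F‖ ≤ rate u m * ‖F‖
  lt_one : √Real.pi * rate u m < 1

lemma eventually_separates (hu : MemL2 u) : ∀ᶠ m in atTop, Separates hu m := by
  have h1 : ∀ᶠ m in atTop, firstConst u m ≠ ⊤ :=
    ((tendsto_firstConst hu).eventually (gt_mem_nhds (zero_lt_one : (0 : ℝ≥0∞) < 1))).mono fun m hm =>
      (hm.trans ENNReal.one_lt_top).ne
  have h2 : ∀ᶠ m in atTop, √Real.pi * rate u m < 1 := by
    have := (tendsto_rate hu).const_mul √Real.pi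
    rw [mul_zero] at this
    exact this.eventually (gt_mem_nhds one_pos)
  filter_upwards [h1, h2, eventually_hsNorm_le hu, eventually_ge_atTop 1] with m h1 h2 hK hm
  refine ⟨fun z hz => charFun_ne_zero_of_circle hu (mem_sphere_rad.1 hz) (hK z (mem_sphere_rad.1 hz)),
    fun F => ?_, h2⟩
  obtain ⟨f, hf, rfl⟩ : ∃ f, ∃ hf : MemL2 f, toL2 f hf = F := ⟨F, Lp.memLp F, toL2_coe F⟩
  have hr : 0 ≤ rate u m := by rw [rate]; positivity
  refine (ContinuousMap.norm_le _ (by positivity)).2 fun x => ?_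
  have h3 := norm_projOp_sub_le hu hm hK h1 hf x.2
  rw [← srcOp_toL2, ← riesz_apply, ← ext_sineSum_toL2 m hf x.2, ext_coe, ext_coe, normL2_eq_norm hf] at h3
  exact h3

/-- The inclusion of `C` in `L₂` has norm at most `√π`, so the two projections differ by less than
one in `L₂`. Hence a nonzero function fixed by one of them is not annihilated by the other. -/
lemma Separates.norm_incl_lt {hu : MemL2 u} {m : ℕ} (h : Separates hu m) {φ : CI} (hφ : φ ≠ 0) :
    ‖incl (riesz hu m (incl φ) - sineSum m (incl φ))‖ < ‖incl φ‖ := by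
  have hpos : 0 < ‖incl φ‖ := norm_pos_iff.2 fun h0 => hφ (incl_injective (by rw [h0, map_zero]))
  calc _ ≤ √Real.pi * (rate u m * ‖incl φ‖) :=
        (norm_incl_le _).trans (mul_le_mul_of_nonneg_left (h.norm_le _) (Real.sqrt_nonneg _))
    _ = √Real.pi * rate u m * ‖incl φ‖ := by ring
    _ < 1 * ‖incl φ‖ := mul_lt_mul_of_pos_right h.lt_one hpos
    _ = ‖incl φ‖ := one_mul _

lemma rad_sq_pos (m : ℕ) : 0 < rad m ^ 2 := pow_pos (rad_pos m) 2

lemma Separates.riesz_incl_rootV {hu : MemL2 u} {m : ℕ} (h : Separates hu m) {μ : ℂ} {j : ℕ}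
    (hj : j < mult hu μ) :
    riesz hu m (incl (rootV hu j μ).1) = if ‖μ‖ < rad m ^ 2 then (rootV hu j μ).1 else 0 := by
  rw [riesz_apply, srcOp_incl]
  exact projOp_spec_rootV hu (rad_sq_pos m) h.ne_zero hj

/-- The span of the root functions of a disc. -/
def rootSpan (hu : MemL2 u) (R : ℝ) : Submodule ℂ CI :=
  Submodule.span ℂ (range fun i : RootIdx hu R => (rootV hu i.2 i.1).1)

lemma Separates.riesz_mem {hu : MemL2 u} {m : ℕ} (h : Separates hu m) (F : Lp ℂ 2 muI) :
    riesz hu m F ∈ rootSpan hu (rad m ^ 2) := by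
  obtain ⟨κ, hκ⟩ := exists_projOp_eq_sum hu (rad_sq_pos m) h.ne_zero (srcOp F)
  rw [riesz_apply, hκ]
  exact Submodule.sum_mem _ fun i _ => Submodule.smul_mem _ _ (Submodule.subset_span ⟨i, rfl⟩)

lemma Separates.riesz_incl_of_mem {hu : MemL2 u} {m : ℕ} (h : Separates hu m) {φ : CI}
    (hφ : φ ∈ rootSpan hu (rad m ^ 2)) : riesz hu m (incl φ) = φ := by
  induction hφ using Submodule.span_induction with
  | mem φ hφ =>
    obtain ⟨i, rfl⟩ := hφ
    rw [h.riesz_incl_rootV i.2.2, if_pos ((mem_zerosIn hu).1 i.1.2).2]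
  | zero => simp
  | add φ ψ _ _ h1 h2 => rw [map_add, map_add, h1, h2]
  | smul c φ _ h1 => rw [map_smul, map_smul, h1]

lemma sineSum_incl_of_mem {m : ℕ} {φ : CI}
    (hφ : φ ∈ Submodule.span ℂ (range fun n : Finset.Icc 1 m => sinCI n)) :
    sineSum m (incl φ) = φ := by
  induction hφ using Submodule.span_induction with
  | mem φ hφ =>
    obtain ⟨n, rfl⟩ := hφ
    exact sineSum_incl_sinCI n.2
  | zero => simp
  | add φ ψ _ _ h1 h2 => rw [map_add, map_add, h1, h2]
  | smul c φ _ h1 => rw [map_smul, map_smul, h1]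

lemma linearIndependent_sinCI (m : ℕ) : LinearIndependent ℂ fun n : Finset.Icc 1 m => sinCI n := by
  refine LinearIndependent.of_comp incl.toLinearMap ?_
  refine Orthonormal.linearIndependent ?_
  rw [orthonormal_iff_ite]
  intro i j
  have hi : (i : ℕ) ≠ 0 := by have := (Finset.mem_Icc.1 i.2).1; omega
  change inner ℂ (incl (sinCI i)) (incl (sinCI j)) = _
  rw [incl_sinCI, incl_sinCI, ← inn_eq_inner (memL2_sinFun _) (memL2_sinFun _),
    inn_sinFun_sinFun _ _ hi]
  simp only [Subtype.ext_iff, eq_comm]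

lemma finrank_le_of_injOn {V : Type*} [AddCommGroup V] [Module ℂ V] {E F : Submodule ℂ V}
    [FiniteDimensional ℂ F] (T : V →ₗ[ℂ] V) (hT : ∀ v, T v ∈ F) (hinj : ∀ v ∈ E, T v = 0 → v = 0) :
    Module.finrank ℂ E ≤ Module.finrank ℂ F := by
  refine LinearMap.finrank_le_finrank_of_injective (f := (T.codRestrict F hT).domRestrict E) ?_
  rw [← LinearMap.ker_eq_bot, LinearMap.ker_eq_bot']
  intro v hv
  refine Subtype.ext (hinj v v.2 ?_)
  exact congrArg Subtype.val hv

/-- The number of eigenvalues in a separating circle, with multiplicities. -/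
lemma Separates.sum_mult {hu : MemL2 u} {m : ℕ} (h : Separates hu m) :
    ∑ μ ∈ zerosIn hu (rad m ^ 2), mult hu μ = m := by
  have hli : LinearIndependent ℂ fun i : RootIdx hu (rad m ^ 2) => (rootV hu i.2 i.1).1 :=
    linearIndependent_rootV hu (μ := fun i : zerosIn hu (rad m ^ 2) => (i : ℂ)) Subtype.val_injective
      fun i => ((mem_zerosIn hu).1 i.2).1
  have hE : Module.finrank ℂ (rootSpan hu (rad m ^ 2)) = _ := finrank_span_eq_card hli
  have hF := finrank_span_eq_card (linearIndependent_sinCI m)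
  have hcard : Fintype.card (RootIdx hu (rad m ^ 2)) = ∑ μ ∈ zerosIn hu (rad m ^ 2), mult hu μ := by
    rw [Fintype.card_sigma]
    simp only [Fintype.card_fin]
    exact Finset.sum_coe_sort (zerosIn hu (rad m ^ 2)) (fun μ => mult hu μ)
  rw [Fintype.card_coe, Nat.card_Icc, Nat.add_sub_cancel] at hF
  rw [hcard] at hE
  rw [← hE]
  refine Eq.trans ?_ hF
  have : FiniteDimensional ℂ (rootSpan hu (rad m ^ 2)) :=
    FiniteDimensional.span_of_finite ℂ (finite_range _)
  have : FiniteDimensional ℂ (Submodule.span ℂ (range fun n : Finset.Icc 1 m => sinCI n)) :=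
    FiniteDimensional.span_of_finite ℂ (finite_range _)
  refine le_antisymm ?_ ?_
  -- Each projection is injective on the range of the other: `P φ = φ` and `S φ = 0` would give `‖φ‖
  -- = ‖(P - S) φ‖ < ‖φ‖`.
  · refine finrank_le_of_injOn (((sineSum m).comp incl).toLinearMap) (fun φ => ?_) fun φ hφ h0 => ?_
    · change sineSum m (incl φ) ∈ _
      rw [sineSum_apply]
      exact Submodule.sum_mem _ fun n hn => Submodule.smul_mem _ _ (Submodule.subset_span ⟨⟨n, hn⟩, rfl⟩)
    · by_contra hne
      have := h.norm_incl_lt hne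
      have h0' : sineSum m (incl φ) = 0 := h0
      rw [h.riesz_incl_of_mem hφ, h0', sub_zero] at this
      exact lt_irrefl _ this
  · refine finrank_le_of_injOn (((riesz hu m).comp incl).toLinearMap) (fun φ => h.riesz_mem _)
      fun φ hφ h0 => ?_
    by_contra hne
    have := h.norm_incl_lt hne
    have h0' : riesz hu m (incl φ) = 0 := h0
    rw [sineSum_incl_of_mem hφ, h0', zero_sub, map_neg, norm_neg] at this
    exact lt_irrefl _ this

/-- The Riesz projections converge strongly. -/
lemma tendsto_incl_riesz (hu : MemL2 u) (F : Lp ℂ 2 muI) :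
    Tendsto (fun m => incl (riesz hu m F)) atTop (𝓝 F) := by
  have h1 : Tendsto (fun m => incl (riesz hu m F - sineSum m F)) atTop (𝓝 0) := by
    have h2 : Tendsto (fun m => √Real.pi * (rate u m * ‖F‖)) atTop (𝓝 0) := by
      have := ((tendsto_rate hu).mul_const ‖F‖).const_mul √Real.pi
      simpa using this
    refine squeeze_zero_norm' ?_ h2
    filter_upwards [eventually_separates hu] with m hm
    exact (norm_incl_le _).trans (mul_le_mul_of_nonneg_left (hm.norm_le F) (Real.sqrt_nonneg _))
  have h3 := h1.add (tendsto_incl_sineSum F)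
  rw [zero_add] at h3
  refine h3.congr fun m => ?_
  rw [map_sub, sub_add_cancel]

/-! ### Enumeration of the eigenvalues -/

/-- The ordering key of the eigenvalues: modulus, then argument. -/
def orderKey (z : ℂ) : ℝ ×ₗ ℝ := toLex (‖z‖, z.arg)

lemma orderKey_lt {z w : ℂ} :
    orderKey z < orderKey w ↔ ‖z‖ < ‖w‖ ∨ (‖z‖ = ‖w‖ ∧ z.arg < w.arg) :=
  Prod.Lex.toLex_lt_toLex

lemma orderKey_injective : Function.Injective orderKey := by
  intro z w h
  have h' := toLex.injective h
  rw [Prod.mk.injEq] at h'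
  exact Complex.ext_norm_arg h'.1 h'.2

lemma norm_le_of_orderKey_lt {z w : ℂ} (h : orderKey z < orderKey w) : ‖z‖ ≤ ‖w‖ := by
  rcases orderKey_lt.1 h with h | h
  exacts [h.le, h.1.le]

/-- The rank of a point, the number of elements of `S` below it in the order, is finite because
discs contain finitely many elements. Ranks are strictly increasing along `S`, and listing them in
order lists `S`. -/
lemma exists_enumeration {S : Set ℂ} (hinf : S.Infinite)
    (hfin : ∀ R : ℝ, {z : ℂ | z ∈ S ∧ ‖z‖ < R}.Finite) :
    ∃ μ : ℕ → ℂ, range μ = S ∧ StrictMono fun k => orderKey (μ k) := by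
  let below : ℂ → Set ℂ := fun z => {w | w ∈ S ∧ orderKey w < orderKey z}
  have hbelow : ∀ z, (below z).Finite := fun z =>
    (hfin (‖z‖ + 1)).subset fun w hw => ⟨hw.1, by have := norm_le_of_orderKey_lt hw.2; linarith⟩
  let r : ℂ → ℕ := fun z => (below z).ncard
  have hr : ∀ z ∈ S, ∀ w, orderKey z < orderKey w → r z < r w := by
    intro z hz w hzw
    refine ncard_lt_ncard ⟨fun x hx => ⟨hx.1, hx.2.trans hzw⟩, fun h => ?_⟩ (hbelow w)
    exact lt_irrefl _ (h ⟨hz, hzw⟩ : z ∈ below z).2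
  have hinj : InjOn r S := by
    intro z hz w hw h
    refine orderKey_injective (le_antisymm ?_ ?_)
    · exact not_lt.1 fun hlt => (hr w hw z hlt).ne' h
    · exact not_lt.1 fun hlt => (hr z hz w hlt).ne h
  have hR : {n | n ∈ r '' S}.Infinite := hinf.image hinj
  choose μ hμS hμr using fun k => Nat.nth_mem_of_infinite hR k
  refine ⟨μ, ?_, ?_⟩
  · refine Subset.antisymm (range_subset_iff.2 hμS) fun z hz => ?_
    have : r z ∈ range (Nat.nth fun n => n ∈ r '' S) := by
      rw [Nat.range_nth_of_infinite hR]; exact ⟨z, hz, rfl⟩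
    obtain ⟨k, hk⟩ := this
    exact ⟨k, hinj (hμS k) hz ((hμr k).trans hk)⟩
  · intro k l hkl
    have h1 : r (μ k) < r (μ l) := by
      rw [hμr, hμr]; exact Nat.nth_strictMono hR hkl
    by_contra hle
    rcases (not_lt.1 hle).lt_or_eq with h | h
    · exact absurd (hr _ (hμS l) _ h) h1.not_gt
    · rw [orderKey_injective h] at h1
      exact lt_irrefl _ h1

section Blocks

variable {p : ℕ → ℕ}

lemma exists_block (hp : ∀ k, 0 < p k) (n : ℕ) :
    ∃ i : Σ k, Fin (p k), (∑ l ∈ Finset.range i.1, p l) + i.2 = n := by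
  induction n with
  | zero => exact ⟨⟨0, ⟨0, hp 0⟩⟩, by simp⟩
  | succ n ih =>
    obtain ⟨⟨k, j, hj⟩, h⟩ := ih
    by_cases hlt : j + 1 < p k
    · exact ⟨⟨k, ⟨j + 1, hlt⟩⟩, by simp only at h ⊢; omega⟩
    · refine ⟨⟨k + 1, ⟨0, hp _⟩⟩, ?_⟩
      simp only [Finset.sum_range_succ] at h ⊢
      omega

lemma sum_range_mono {k l : ℕ} (h : k ≤ l) : ∑ i ∈ Finset.range k, p i ≤ ∑ i ∈ Finset.range l, p i :=
  Finset.sum_le_sum_of_subset (Finset.range_mono h)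

lemma block_le {k k' j j' : ℕ} (hj : j < p k)
    (h : (∑ i ∈ Finset.range k, p i) + j = (∑ i ∈ Finset.range k', p i) + j') : k' ≤ k := by
  by_contra hlt
  have h1 := sum_range_mono (p := p) (Nat.succ_le_of_lt (not_le.1 hlt))
  rw [Finset.sum_range_succ] at h1
  omega

lemma block_unique {i i' : Σ k, Fin (p k)} (h : (∑ l ∈ Finset.range i.1, p l) + i.2
    = (∑ l ∈ Finset.range i'.1, p l) + i'.2) : i = i' := by
  obtain ⟨k, j, hj⟩ := i
  obtain ⟨k', j', hj'⟩ := i'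
  simp only at h
  obtain rfl : k = k' := le_antisymm (block_le hj' h.symm) (block_le hj h)
  obtain rfl : j = j' := by omega
  rfl

end Blocks

/-! ### Numbering of the eigenvalues and of the root functions -/

variable {u : ℝ → ℂ}

/-- A finite spectrum has a finite total multiplicity, whereas separating circles of order `m`
enclose exactly `m` for all large `m`. -/
lemma infinite_zeros (hu : MemL2 u) : {z : ℂ | charFun hu z = 0}.Infinite := by
  intro hfin
  obtain ⟨m, hm, hlt⟩ := ((eventually_separates hu).and
    (eventually_gt_atTop (∑ μ ∈ hfin.toFinset, mult hu μ))).exists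
  have h1 := hm.sum_mult
  have h2 : ∑ μ ∈ zerosIn hu (rad m ^ 2), mult hu μ ≤ ∑ μ ∈ hfin.toFinset, mult hu μ :=
    Finset.sum_le_sum_of_subset fun z hz => by simpa using ((mem_zerosIn hu).1 hz).1
  omega

lemma exists_eig (hu : MemL2 u) : ∃ μ : ℕ → ℂ, range μ = {z : ℂ | charFun hu z = 0} ∧
    StrictMono fun k => orderKey (μ k) :=
  exists_enumeration (infinite_zeros hu) (finite_zeros hu)

/-- The eigenvalues in the order of increasing modulus and argument. -/
def eig (hu : MemL2 u) : ℕ → ℂ := (exists_eig hu).choose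

lemma range_eig (hu : MemL2 u) : range (eig hu) = {z : ℂ | charFun hu z = 0} :=
  (exists_eig hu).choose_spec.1

lemma strictMono_eig (hu : MemL2 u) : StrictMono fun k => orderKey (eig hu k) :=
  (exists_eig hu).choose_spec.2

lemma charFun_eig (hu : MemL2 u) (k : ℕ) : charFun hu (eig hu k) = 0 := by
  have : eig hu k ∈ {z : ℂ | charFun hu z = 0} := range_eig hu ▸ mem_range_self k
  exact this

lemma mult_eig_pos (hu : MemL2 u) (k : ℕ) : 0 < mult hu (eig hu k) :=
  (mult_pos_iff hu _).2 (charFun_eig hu k)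

lemma eig_injective (hu : MemL2 u) : Function.Injective (eig hu) := fun _ _ h =>
  (strictMono_eig hu).injective (congrArg orderKey h)

lemma norm_eig_mono (hu : MemL2 u) {k l : ℕ} (h : k ≤ l) : ‖eig hu k‖ ≤ ‖eig hu l‖ := by
  rcases h.eq_or_lt with rfl | h
  · exact le_rfl
  · exact norm_le_of_orderKey_lt (strictMono_eig hu h)

/-- The position of the `n`-th root function. -/
def block (hu : MemL2 u) (n : ℕ) : Σ k, Fin (mult hu (eig hu k)) :=
  (exists_block (mult_eig_pos hu) n).choose

lemma block_spec (hu : MemL2 u) (n : ℕ) :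
    (∑ l ∈ Finset.range (block hu n).1, mult hu (eig hu l)) + (block hu n).2 = n :=
  (exists_block (mult_eig_pos hu) n).choose_spec

lemma block_sum (hu : MemL2 u) (i : Σ k, Fin (mult hu (eig hu k))) :
    block hu ((∑ l ∈ Finset.range i.1, mult hu (eig hu l)) + i.2) = i :=
  block_unique (block_spec hu _)

lemma block_injective (hu : MemL2 u) : Function.Injective (block hu) := fun m n h => by
  rw [← block_spec hu m, ← block_spec hu n, h]

/-- The unnormalized root functions. -/
def rawRoot (hu : MemL2 u) (i : Σ k, Fin (mult hu (eig hu k))) : CI := (rootV hu i.2 (eig hu i.1)).1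

/-- The normalized root functions, numbered from one. -/
def rootFn (hu : MemL2 u) (n : ℕ) : CI :=
  ((normL2 (ext (rawRoot hu (block hu (n - 1)))) : ℂ))⁻¹ • rawRoot hu (block hu (n - 1))

lemma linearIndependent_rawRoot (hu : MemL2 u) : LinearIndependent ℂ (rawRoot hu) :=
  linearIndependent_rootV hu (eig_injective hu) (charFun_eig hu)

lemma normL2_rawRoot_ne_zero (hu : MemL2 u) (i : Σ k, Fin (mult hu (eig hu k))) :
    ((normL2 (ext (rawRoot hu i)) : ℝ) : ℂ) ≠ 0 := by
  rw [normL2_eq_norm (memL2_ext _), Complex.ofReal_ne_zero, norm_ne_zero_iff]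
  intro h
  exact (linearIndependent_rawRoot hu).ne_zero i (incl_injective (by rw [map_zero]; exact h))

lemma rawRoot_eq (hu : MemL2 u) (n : ℕ) :
    rawRoot hu (block hu n) = (normL2 (ext (rawRoot hu (block hu n))) : ℂ) • rootFn hu (n + 1) := by
  rw [rootFn, Nat.add_sub_cancel, smul_smul, mul_inv_cancel₀ (normL2_rawRoot_ne_zero hu _), one_smul]

lemma linearIndependent_rootFn (hu : MemL2 u) : LinearIndependent ℂ fun n => rootFn hu (n + 1) := by
  have h := (linearIndependent_rawRoot hu).comp (block hu) (block_injective hu)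
  exact h.units_smul fun n => (Units.mk0 _ (normL2_rawRoot_ne_zero hu (block hu n)))⁻¹

/-! ### The root system -/

lemma IsOmega.eq_ext (hu : MemL2 u) {ω : ℂ → ℝ → ℂ} (h : IsOmega u ω) (z : ℂ) {x : ℝ}
    (hx : x ∈ Icc (0 : ℝ) Real.pi) : ω z x = ext (omegaV hu z).1 x := by
  obtain ⟨h0, ω₁, h1, hq⟩ := h z
  have hq' : QuasiDiff u (ω z) ω₁ (fun x => z * ω z x + (fun _ => (0 : ℂ)) x) := by
    simpa only [add_zero] using hq
  have := (hq'.eq_sol hu zero_integrable hx).1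
  rwa [h0, h1, sol, ← unitData_eq] at this

lemma IsOmega.omegaDeriv_eq (hu : MemL2 u) {ω : ℂ → ℝ → ℂ} (h : IsOmega u ω) (j : ℕ) (z : ℂ) {x : ℝ}
    (hx : x ∈ Icc (0 : ℝ) Real.pi) : omegaDeriv ω j z x = ext (rootV hu j z).1 x := by
  have h1 := clm_rootV hu (evAt ⟨x, hx⟩) j z
  rw [evAt_apply] at h1
  rw [h1, omegaDeriv]
  congr 1
  funext s
  rw [h.eq_ext hu s hx, evAt_apply]

lemma isOmega_omegaV (hu : MemL2 u) : IsOmega u fun z => ext (omegaV hu z).1 := fun z =>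
  ⟨(omegaV_spec hu z).1, _, (omegaV_spec hu z).2.1, (omegaV_spec hu z).2.2⟩

lemma normL2_congr {f g : ℝ → ℂ} (h : ∀ x ∈ Icc (0 : ℝ) Real.pi, f x = g x) : normL2 f = normL2 g := by
  rw [normL2, normL2]
  congr 1
  refine intervalIntegral.integral_congr fun x hx => ?_
  rw [uIcc_of_le Real.pi_pos.le] at hx
  simp only [h x hx]

lemma inn_congr {f f' g : ℝ → ℂ} (h : ∀ x ∈ Icc (0 : ℝ) Real.pi, f x = f' x) : inn f g = inn f' g := by
  refine intervalIntegral.integral_congr fun x hx => ?_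
  rw [uIcc_of_le Real.pi_pos.le] at hx
  simp only [h x hx]

lemma IsOmega.normalized_eq (hu : MemL2 u) {ω : ℂ → ℝ → ℂ} (h : IsOmega u ω)
    (i : Σ k, Fin (mult hu (eig hu k))) {x : ℝ} (hx : x ∈ Icc (0 : ℝ) Real.pi) :
    omegaDeriv ω i.2 (eig hu i.1) x / (normL2 (omegaDeriv ω i.2 (eig hu i.1)) : ℂ)
      = ext (rootFn hu ((∑ l ∈ Finset.range i.1, mult hu (eig hu l)) + i.2 + 1)) x := by
  rw [rootFn, Nat.add_sub_cancel, block_sum, ext_smul, h.omegaDeriv_eq hu _ _ hx,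
    normL2_congr fun x hx => h.omegaDeriv_eq hu _ _ hx, div_eq_inv_mul]
  rfl

lemma isRootSystem_rootFn (hu : MemL2 u) : IsRootSystem u fun n => ext (rootFn hu n) := by
  refine ⟨_, eig hu, fun k => mult hu (eig hu k), isOmega_omegaV hu, ?_, fun k => ?_, fun k => ?_,
    fun k j hj x hx => ?_⟩
  · rw [range_eig]
    ext z
    exact (isEigenvalue_iff hu z).symm
  · exact orderKey_lt.1 (strictMono_eig hu k.lt_succ_self)
  · exact hasAlgMultiplicity_mult hu (charFun_eig hu k)
  · exact ((isOmega_omegaV hu).normalized_eq hu ⟨k, ⟨j, hj⟩⟩ hx).symm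

/-- The root system is determined on `[0, π]` by the potential. -/
lemma IsRootSystem.eq_rootFn (hu : MemL2 u) {y : ℕ → ℝ → ℂ} (h : IsRootSystem u y) {n : ℕ} (hn : 1 ≤ n)
    {x : ℝ} (hx : x ∈ Icc (0 : ℝ) Real.pi) : y n x = ext (rootFn hu n) x := by
  obtain ⟨ω, μ, p, hω, hrange, hord, hp, hy⟩ := h
  have hmono : StrictMono fun k => orderKey (μ k) := strictMono_nat_of_lt_succ fun k => orderKey_lt.2 (hord k)
  -- Modulus and argument determine a complex number, and two strictly increasing sequences with the
  -- same range coincide.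
  have hμ : μ = eig hu := by
    have h1 : (fun k => orderKey (μ k)) = fun k => orderKey (eig hu k) := by
      rw [← hmono.range_inj (strictMono_eig hu)]
      have h2 : range μ = range (eig hu) := by
        rw [hrange, range_eig]
        ext z
        exact isEigenvalue_iff hu z
      change range (orderKey ∘ μ) = range (orderKey ∘ eig hu)
      rw [range_comp, range_comp, h2]
    exact funext fun k => orderKey_injective (congrFun h1 k)
  have hpm : p = fun k => mult hu (eig hu k) := funext fun k => by
    have := hp k
    rw [hμ] at this
    exact this.unique (hasAlgMultiplicity_mult hu (charFun_eig hu k))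
  subst hpm hμ
  have h1 := hy (block hu (n - 1)).1 (block hu (n - 1)).2 (block hu (n - 1)).2.2 x hx
  rw [hω.normalized_eq hu _ hx, block_spec, Nat.sub_add_cancel hn] at h1
  exact h1

/-! ### Expansion in the root functions -/

/-- Ordering by modulus puts the root functions of a disc in an initial segment made of whole
blocks, and by `Separates.sum_mult` its length is `m`. Thus a cut at a separating circle splits no
block. -/
lemma Separates.norm_eig_lt_iff {hu : MemL2 u} {m : ℕ} (h : Separates hu m) (n : ℕ) :
    ‖eig hu (block hu n).1‖ < rad m ^ 2 ↔ n < m := by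
  classical
  have hex : ∃ k, ¬ ‖eig hu k‖ < rad m ^ 2 := by
    by_contra! hall
    refine Set.infinite_range_of_injective (eig_injective hu) ((finite_zeros hu (rad m ^ 2)).subset ?_)
    rintro _ ⟨k, rfl⟩
    exact ⟨charFun_eig hu k, hall k⟩
  set K := Nat.find hex with hK
  have hlt : ∀ k, ‖eig hu k‖ < rad m ^ 2 ↔ k < K := fun k =>
    ⟨fun hk => by
      by_contra hle
      exact Nat.find_spec hex ((norm_eig_mono hu (not_lt.1 hle)).trans_lt hk),
    fun hk => not_not.1 (Nat.find_min hex hk)⟩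
  have hz : zerosIn hu (rad m ^ 2) = (Finset.range K).image (eig hu) := by
    ext z
    rw [mem_zerosIn, Finset.mem_image]
    constructor
    · rintro ⟨h0, h1⟩
      obtain ⟨k, rfl⟩ : z ∈ range (eig hu) := by rw [range_eig]; exact h0
      exact ⟨k, Finset.mem_range.2 ((hlt k).1 h1), rfl⟩
    · rintro ⟨k, hk, rfl⟩
      exact ⟨charFun_eig hu k, (hlt k).2 (Finset.mem_range.1 hk)⟩
  have hsum := h.sum_mult
  rw [hz, Finset.sum_image fun a _ b _ hab => eig_injective hu hab] at hsum
  have hn := block_spec hu n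
  have hj := (block hu n).2.2
  rw [hlt]
  constructor
  · intro hk
    have h1 := sum_range_mono (p := fun k => mult hu (eig hu k)) (Nat.succ_le_of_lt hk)
    rw [Finset.sum_range_succ] at h1
    omega
  · intro hnm
    by_contra hle
    have h1 := sum_range_mono (p := fun k => mult hu (eig hu k)) (not_lt.1 hle)
    omega

lemma Separates.riesz_rootFn {hu : MemL2 u} {m : ℕ} (h : Separates hu m) (n : ℕ) :
    riesz hu m (incl (rootFn hu (n + 1))) = if n < m then rootFn hu (n + 1) else 0 := by
  rw [rootFn, Nat.add_sub_cancel, map_smul, map_smul, rawRoot, h.riesz_incl_rootV (block hu n).2.2]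
  simp only [h.norm_eig_lt_iff]
  split_ifs
  · rfl
  · exact smul_zero (M := ℂ) (A := CI) _

lemma Separates.riesz_mem_span {hu : MemL2 u} {m : ℕ} (h : Separates hu m) (F : Lp ℂ 2 muI) :
    riesz hu m F ∈ Submodule.span ℂ (range fun n : Fin m => rootFn hu (n + 1)) := by
  refine (Submodule.span_le.2 ?_ : rootSpan hu (rad m ^ 2) ≤ _) (h.riesz_mem F)
  rintro _ ⟨⟨⟨μ, hμ⟩, j⟩, rfl⟩
  obtain ⟨h0, hlt⟩ := (mem_zerosIn hu).1 hμ
  obtain ⟨k, rfl⟩ : μ ∈ range (eig hu) := by rw [range_eig]; exact h0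
  set n := (∑ l ∈ Finset.range k, mult hu (eig hu l)) + j with hn
  have hb : block hu n = ⟨k, j⟩ := block_sum hu ⟨k, j⟩
  have hnm : n < m := by
    rw [← h.norm_eig_lt_iff n, hb]; exact hlt
  have h1 := rawRoot_eq hu n
  rw [hb] at h1
  change rawRoot hu ⟨k, j⟩ ∈ _
  rw [h1]
  exact Submodule.smul_mem _ _ (Submodule.subset_span ⟨⟨n, hnm⟩, rfl⟩)

/-- Completeness: the Riesz projections of `F` are eventually combinations of root functions, and
they converge to `F`. -/
lemma dense_span_rootFn (hu : MemL2 u) :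
    Dense (Submodule.span ℂ (range fun n => incl (rootFn hu (n + 1))) : Set (Lp ℂ 2 muI)) := by
  intro F
  refine mem_closure_of_tendsto (tendsto_incl_riesz hu F) ?_
  filter_upwards [eventually_separates hu] with m hm
  have h1 : incl (riesz hu m F) ∈ (Submodule.span ℂ (range fun n : Fin m => rootFn hu (n + 1))).map
      incl.toLinearMap := ⟨_, hm.riesz_mem_span F, rfl⟩
  rw [Submodule.map_span, ← range_comp] at h1
  refine Submodule.span_mono ?_ h1
  rintro _ ⟨n, rfl⟩
  exact ⟨n, rfl⟩

/-- `W 1, W 2, …` is biorthogonal to the root functions. -/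
def Biorth (hu : MemL2 u) (W : ℕ → Lp ℂ 2 muI) : Prop :=
  ∀ n k, inner ℂ (W (k + 1)) (incl (rootFn hu (n + 1))) = if n = k then 1 else 0

lemma exists_coord_comp {H V ι : Type*} [NormedAddCommGroup H] [NormedSpace ℂ H]
    [NormedAddCommGroup V] [NormedSpace ℂ V] [Finite ι] [DecidableEq ι] {v : ι → V}
    (hv : LinearIndependent ℂ v) (T : H →L[ℂ] V)
    (hT : ∀ x, T x ∈ Submodule.span ℂ (range v)) (k : ι) :
    ∃ ℓ : H →L[ℂ] ℂ, (∀ n x, T x = v n → ℓ x = if n = k then 1 else 0) ∧ ∀ x, T x = 0 → ℓ x = 0 := by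
  let b := Module.Basis.span hv
  have : FiniteDimensional ℂ (Submodule.span ℂ (range v)) :=
    FiniteDimensional.span_of_finite ℂ (finite_range _)
  refine ⟨(LinearMap.toContinuousLinearMap (b.coord k)).comp (T.codRestrict _ hT),
    fun n x hx => ?_, fun x hx => ?_⟩
  · have h1 : T.codRestrict _ hT x = b n := Subtype.ext (by rw [Module.Basis.span_apply]; exact hx)
    change b.coord k (T.codRestrict _ hT x) = _
    rw [h1, Module.Basis.coord_apply, Module.Basis.repr_self, Finsupp.single_apply]
  · have h1 : T.codRestrict _ hT x = 0 := Subtype.ext hx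
    change b.coord k (T.codRestrict _ hT x) = _
    rw [h1, map_zero]

/-- The functional of index `k` is a coordinate of the Riesz projection of some disc containing that
root function. It vanishes on root functions outside the disc because the projection does. -/
lemma exists_biorth (hu : MemL2 u) : ∃ W, Biorth hu W := by
  have key : ∀ k, ∃ w : Lp ℂ 2 muI, ∀ n,
      inner ℂ w (incl (rootFn hu (n + 1))) = if n = k then 1 else 0 := by
    intro k
    obtain ⟨m, hm, hk⟩ := ((eventually_separates hu).and (eventually_gt_atTop k)).exists
    have hli : LinearIndependent ℂ fun n : Fin m => rootFn hu (n + 1) :=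
      (linearIndependent_rootFn hu).comp (fun n : Fin m => (n : ℕ)) Fin.val_injective
    obtain ⟨ℓ, hℓ, hℓ₀⟩ := exists_coord_comp hli (riesz hu m) hm.riesz_mem_span ⟨k, hk⟩
    refine ⟨(InnerProductSpace.toDual ℂ _).symm ℓ, fun n => ?_⟩
    rw [InnerProductSpace.toDual_symm_apply]
    have h1 := hm.riesz_rootFn n
    by_cases hn : n < m
    · rw [if_pos hn] at h1
      rw [hℓ ⟨n, hn⟩ _ h1]
      simp
    · rw [if_neg hn] at h1
      rw [hℓ₀ _ h1, if_neg (by omega)]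
  choose w hw using key
  exact ⟨fun n => w (n - 1), fun n k => hw k n⟩

/-- By completeness the biorthogonal system is determined, so the coefficients, and the rate in the
theorem, depend only on `u`. -/
lemma Biorth.unique {hu : MemL2 u} {W W' : ℕ → Lp ℂ 2 muI} (h : Biorth hu W) (h' : Biorth hu W')
    {n : ℕ} (hn : 1 ≤ n) : W n = W' n := by
  obtain ⟨n, rfl⟩ : ∃ k, n = k + 1 := ⟨n - 1, by omega⟩
  have : innerSL ℂ (W (n + 1)) = innerSL ℂ (W' (n + 1)) := by
    refine ContinuousLinearMap.ext_on (dense_span_rootFn hu) ?_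
    rintro _ ⟨k, rfl⟩
    exact (h k n).trans (h' k n).symm
  refine ext_inner_right ℂ fun F => ?_
  exact congrArg (fun T : Lp ℂ 2 muI →L[ℂ] ℂ => T F) this

/-- The partial sum of the expansion in the root functions. -/
def rootSum (hu : MemL2 u) (W : ℕ → Lp ℂ 2 muI) (m : ℕ) : Lp ℂ 2 muI →L[ℂ] CI :=
  ∑ n ∈ Finset.Icc 1 m, (innerSL ℂ (W n)).smulRight (rootFn hu n)

lemma rootSum_apply (hu : MemL2 u) (W : ℕ → Lp ℂ 2 muI) (m : ℕ) (F : Lp ℂ 2 muI) :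
    rootSum hu W m F = ∑ n ∈ Finset.Icc 1 m, inner ℂ (W n) F • rootFn hu n := by
  simp [rootSum]

/-- Both sides are bounded operators, and they agree on the root functions, whose span is dense. -/
lemma Separates.riesz_eq_rootSum {hu : MemL2 u} {m : ℕ} (h : Separates hu m) {W : ℕ → Lp ℂ 2 muI}
    (hW : Biorth hu W) : riesz hu m = rootSum hu W m := by
  refine ContinuousLinearMap.ext_on (dense_span_rootFn hu) ?_
  rintro _ ⟨k, rfl⟩
  simp only [h.riesz_rootFn, rootSum_apply]
  have hterm : ∀ n ∈ Finset.Icc 1 m, inner ℂ (W n) (incl (rootFn hu (k + 1))) • rootFn hu n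
      = if n = k + 1 then rootFn hu (k + 1) else 0 := by
    intro n hn
    obtain ⟨n, rfl⟩ : ∃ l, n = l + 1 := ⟨n - 1, by have := (Finset.mem_Icc.1 hn).1; omega⟩
    rw [hW k n]
    by_cases hkn : k = n
    · subst hkn
      rw [if_pos rfl, if_pos rfl]
      exact one_smul ℂ (rootFn hu (k + 1))
    · rw [if_neg hkn, if_neg (by omega)]
      exact zero_smul ℂ (rootFn hu (n + 1))
  rw [Finset.sum_congr rfl hterm, Finset.sum_ite_eq']
  refine if_congr ?_ rfl rfl
  rw [Finset.mem_Icc]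
  omega

lemma tendsto_norm_rootSum_sub (hu : MemL2 u) {W : ℕ → Lp ℂ 2 muI} (hW : Biorth hu W) :
    Tendsto (fun m => ‖rootSum hu W m - sineSum m‖) atTop (𝓝 0) := by
  refine squeeze_zero' (Eventually.of_forall fun _ => ContinuousLinearMap.opNorm_nonneg _) ?_ (tendsto_rate hu)
  filter_upwards [eventually_separates hu] with m hm
  refine ContinuousLinearMap.opNorm_le_bound _ (by rw [rate]; positivity) fun F => ?_
  rw [← hm.riesz_eq_rootSum hW]
  exact hm.norm_le F

/-- The index `0` is not part of the system and membership in `L₂` is not known there, hence the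
default value zero. -/
lemma IsBiorthogonal.biorth (hu : MemL2 u) {y w : ℕ → ℝ → ℂ} (hy : IsRootSystem u y)
    (hw : IsBiorthogonal y w) :
    Biorth hu fun n => if h : 1 ≤ n then toL2 (w n) (hw.1 n h) else 0 := by
  intro n k
  change inner ℂ (dite (1 ≤ k + 1) (fun h => toL2 (w (k + 1)) (hw.1 (k + 1) h)) fun _ => 0) _ = _
  rw [dif_pos (Nat.le_add_left 1 k), incl_apply, ← inn_eq_inner (memL2_ext _) (hw.1 _ (Nat.le_add_left 1 k)),
    ← inn_congr fun x hx => hy.eq_rootFn hu (Nat.le_add_left 1 n) hx,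
    hw.2 _ _ (Nat.le_add_left 1 n) (Nat.le_add_left 1 k)]
  simp

lemma partialSumDiff_eq (hu : MemL2 u) {W : ℕ → Lp ℂ 2 muI} (hW : Biorth hu W) {y w : ℕ → ℝ → ℂ}
    (hy : IsRootSystem u y) (hw : IsBiorthogonal y w) {f : ℝ → ℂ} (hf : MemL2 f) (m : ℕ) {x : ℝ}
    (hx : x ∈ Icc (0 : ℝ) Real.pi) :
    partialSumDiff y w f m x = ext ((rootSum hu W m - sineSum m) (toL2 f hf)) x := by
  have e : ext ((rootSum hu W m - sineSum m) (toL2 f hf)) x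
      = ext (rootSum hu W m (toL2 f hf)) x - ext (sineSum m (toL2 f hf)) x := rfl
  rw [e, ext_sineSum_toL2 m hf hx, rootSum_apply, ext_sum, partialSumDiff]
  congr 1
  · refine Finset.sum_congr rfl fun n hn => ?_
    have hn1 := (Finset.mem_Icc.1 hn).1
    have h1 := hW.unique (hw.biorth hu hy) hn1
    rw [dif_pos hn1] at h1
    rw [ext_smul, h1, ← inn_eq_inner hf (hw.1 n hn1), hy.eq_rootFn hu hn1 hx]
  · refine Finset.sum_congr rfl fun n _ => ?_
    rw [sinFun]
    push_cast
    ring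

lemma norm_partialSumDiff_le (hu : MemL2 u) {W : ℕ → Lp ℂ 2 muI} (hW : Biorth hu W) {y w : ℕ → ℝ → ℂ}
    (hy : IsRootSystem u y) (hw : IsBiorthogonal y w) {f : ℝ → ℂ} (hf : MemL2 f) (m : ℕ) {x : ℝ}
    (hx : x ∈ Icc (0 : ℝ) Real.pi) :
    ‖partialSumDiff y w f m x‖ ≤ normL2 f * ‖rootSum hu W m - sineSum m‖ := by
  rw [partialSumDiff_eq hu hW hy hw hf m hx, mul_comm, normL2_eq_norm hf]
  exact (norm_ext_le _ _).trans (ContinuousLinearMap.le_opNorm _ _)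

lemma isBiorthogonal_rootFn (hu : MemL2 u) {W : ℕ → Lp ℂ 2 muI} (hW : Biorth hu W) :
    IsBiorthogonal (fun n => ext (rootFn hu n)) fun n => (W n : ℝ → ℂ) := by
  refine ⟨fun n _ => Lp.memLp (W n), fun n k hn hk => ?_⟩
  obtain ⟨n, rfl⟩ : ∃ l, n = l + 1 := ⟨n - 1, by omega⟩
  obtain ⟨k, rfl⟩ : ∃ l, k = l + 1 := ⟨k - 1, by omega⟩
  rw [inn_eq_inner (memL2_ext _) (Lp.memLp (W (k + 1))), toL2_coe, ← incl_apply, hW n k]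
  simp

end SturmLiouville

end

/-! ### The equiconvergence theorem -/

theorem mainTheorem1 (u : ℝ → ℂ) (hu : SturmLiouville.MemL2 u) :
    (∃ y w : ℕ → ℝ → ℂ,
      SturmLiouville.IsRootSystem u y ∧ SturmLiouville.IsBiorthogonal y w) ∧
    ∃ (C : ℝ) (υ : ℕ → ℝ), Tendsto υ atTop (𝓝 0) ∧
      ∀ y w : ℕ → ℝ → ℂ,
        SturmLiouville.IsRootSystem u y → SturmLiouville.IsBiorthogonal y w →
        ∀ f : ℝ → ℂ, SturmLiouville.MemL2 f →
          TendstoUniformlyOn (SturmLiouville.partialSumDiff y w f) (fun _ => 0) atTop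
            (Icc (0 : ℝ) Real.pi) ∧
          ∀ m : ℕ, 1 ≤ m → ∀ x ∈ Icc (0 : ℝ) Real.pi,
            ‖SturmLiouville.partialSumDiff y w f m x‖ ≤
              C * Real.sqrt (∑' n : {n : ℕ // Real.sqrt m ≤ n},
                ‖SturmLiouville.sineCoeff f n‖ ^ 2)
              + SturmLiouville.normL2 f * υ m := by
  obtain ⟨W, hW⟩ := SturmLiouville.exists_biorth hu
  have hlim := SturmLiouville.tendsto_norm_rootSum_sub hu hW
  -- The witnesses are `C = 0` and `υ(m)`, the norm of the difference of the partial sums as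
  -- operators from `L₂` to `C`. This is defined for every `m`, including those whose circle does
  -- not separate the spectrum.
  refine ⟨⟨_, _, SturmLiouville.isRootSystem_rootFn hu, SturmLiouville.isBiorthogonal_rootFn hu hW⟩,
    0, _, hlim, fun y w hy hw f hf => ⟨?_, fun m _ x hx => ?_⟩⟩
  · have h0 := hlim.const_mul (SturmLiouville.normL2 f)
    rw [mul_zero] at h0
    rw [Metric.tendstoUniformlyOn_iff]
    intro ε hε
    filter_upwards [h0.eventually (gt_mem_nhds hε)] with m hm x hx
    rw [dist_zero_left]
    exact (SturmLiouville.norm_partialSumDiff_le hu hW hy hw hf m hx).trans_lt hm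
  · rw [zero_mul, zero_add]
    exact SturmLiouville.norm_partialSumDiff_le hu hW hy hw hf m hx
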